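/- **Setting.** Let $n\in\mathbb N$, let $\Lambda\subset\mathbb R^n$ be a lattice, $T^n=\mathbb R^n/\Lambda$, $r>0$, and for $\rho>0$ put $Y_\rho=T^n\times B(0,\rho)$, where $B(0,\rho)\subset\mathbb R^n$ is the open Euclidean ball. Let $(\omega,g,J,\Omega)$ be the flat Calabi–Yau structure on $Y=T^n\times\mathbb R^n$, $$g=\sum_j(dx_j^2+dy_j^2),\qquad \omega=\sum_j dx_j\wedge dy_j,\qquad \Omega=\bigwedge_{j=1}^n(dx_j+\sqrt{-1}\,dy_j),$$ where $x_j$, $y_j$ are the standard coordinates of $T^n=\mathbb R^n/\Lambda$ and of $\mathbb R^n$. A Calabi–Yau structure $(\omega',g',J',\Omega')$ is a Ricci-flat Kähler structure $(g',J')$ with Kähler form $\omega'$, together with a nowhere vanishing holomorphic $n$-form $\Omega'$. Let $(\omega_k,g_k,J_k,\Omega_k)$, $k\in\mathbb N$, be Calabi–Yau structures on $Y_{2r}$ that converge to $(\omega,g,J,\Omega)$ in the $C^\infty$-sense on $Y_{2r}$ (all derivatives converge uniformly on compact subsets), with $[\omega_k]=[\omega]\in H^2(Y_{2r},\mathbb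 R)$ for all $k$. Let a finite group $\Gamma$ act smoothly on $Y_{2r}$ by a product action $\gamma\cdot(x,y)=(\gamma\cdot x,\gamma\cdot y)$ that preserves $\omega,g,\Omega$ and all $\omega_k,g_k,\Omega_k$ and leaves $T^n\times\{0\}$ invariant. **Proposition 4.1.** There are real sequences $a_k\to1$ and $\theta_k\to0$ such that, for all sufficiently large $k$, $a_k>0$ and $$\int_{T^n\times\{0\}}\Omega_k=a_k\,e^{-\sqrt{-1}\theta_k}\int_{T^n\times\{0\}}\Omega ,$$ and there are a $\Gamma$-invariant open set $W_k$ with $Y_r\subset W_k\subset Y_{2r}$, a $\Gamma$-invariant open set $B_k\subset B(0,2r)$, and a continuous, $\Gamma$-equivariant surjection $f_k:W_k\to B_k$ which is a special Lagrangian fibration of phase $\theta_k$ with respect to $(\omega_k,\Omega_k)$: for every $b\in B_k$ the fiber $f_k^{-1}(b)$ is the graph $\{(x,s(x)):x\in T^n\}$ of a $C^\infty$ map $s=s_{k,b}:T^n\to B(0,2r)$ (in particular a smooth $n$-dimensional submanifold), and $$\omega_k|_{f_k^{-1}(b)}\equiv0,\qquad \operatorname{Im}\bigl(e^{\sqrt{-1}\theta_k}\Omega_k\bigr)\big|_{f_k^{-1}(b)}\equiv0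 .$$ -/

import Mathlib

open scoped ContDiff Topology
open Filter

noncomputable section

namespace TorusCY

/-- Euclidean `ℝⁿ`. -/
abbrev Rn (n : ℕ) : Type := EuclideanSpace ℝ (Fin n)

/-- `ℝⁿ × ℝⁿ` with coordinates `(x, y)`: the universal cover of `Tⁿ × ℝⁿ`, and at the same time
every tangent space of `Tⁿ × ℝⁿ`, trivialised by `∂/∂x₁, …, ∂/∂xₙ, ∂/∂y₁, …, ∂/∂yₙ`. -/
abbrev Tan (n : ℕ) : Type := Rn n × Rn n

/-- The torus `Tⁿ = ℝⁿ / Λ`, where `Λ` is the lattice generated by the basis `b` of `ℝⁿ`. -/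
abbrev Torus {n : ℕ} (b : Module.Basis (Fin n) ℝ (Rn n)) : Type :=
  Rn n ⧸ Submodule.span ℤ (Set.range b)

/-- The quotient map `ℝⁿ → Tⁿ`. -/
def toTorus {n : ℕ} (b : Module.Basis (Fin n) ℝ (Rn n)) (x : Rn n) : Torus b :=
  Submodule.Quotient.mk x

/-- The ball `B(0, R) ⊆ ℝⁿ`, as a space. -/
abbrev Ball (n : ℕ) (R : ℝ) : Type := Metric.ball (0 : Rn n) R

/-- `Y_R = Tⁿ × B(0, R)`, as a space. -/
abbrev Tube {n : ℕ} (b : Module.Basis (Fin n) ℝ (Rn n)) (R : ℝ) : Type := Torus b × Ball n R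

/-- The preimage `ℝⁿ × B(0, R)` of `Y_R` in the universal cover. -/
def coverTube (n : ℕ) (R : ℝ) : Set (Tan n) := {z | ‖z.2‖ < R}

section Tensors

variable {n : ℕ} {b : Module.Basis (Fin n) ℝ (Rn n)}

/-- Pull-back of a field `F` on `Tⁿ × ℝⁿ` (a function, or a tensor field written in the global
frame `∂/∂x, ∂/∂y`) to the universal cover. -/
def pull {X : Type*} (F : Torus b × Rn n → X) (z : Tan n) : X := F (toTorus b z.1, z.2)

/-- The field `F` is of class `C^∞` on `Y_R`. -/
def SmoothOn {X : Type*} [NormedAddCommGroup X] [NormedSpace ℝ X]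
    (F : Torus b × Rn n → X) (R : ℝ) : Prop :=
  ContDiffOn ℝ ∞ (pull F) (coverTube n R)

/-- `C^∞` convergence on the open manifold `Y_R`: all derivatives of all orders converge uniformly
on compact subsets of `Y_R`. -/
def SmoothLimitOn {X : Type*} [NormedAddCommGroup X] [NormedSpace ℝ X]
    (F : ℕ → Torus b × Rn n → X) (G : Torus b × Rn n → X) (R : ℝ) : Prop :=
  ∀ (m : ℕ) (K : Set (Tan n)), IsCompact K → K ⊆ coverTube n R →
    TendstoUniformlyOn (fun k => iteratedFDeriv ℝ m (pull (F k))) (iteratedFDeriv ℝ m (pull G))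
      atTop K

/-- The coordinate frame `∂/∂x₁, …, ∂/∂xₙ, ∂/∂y₁, …, ∂/∂yₙ`. -/
def frame (n : ℕ) : Module.Basis (Fin n ⊕ Fin n) ℝ (Tan n) :=
  (EuclideanSpace.basisFun (Fin n) ℝ).toBasis.prod (EuclideanSpace.basisFun (Fin n) ℝ).toBasis

/-- The partial derivative in the direction of the `i`-th vector of the coordinate frame. -/
def pd {n : ℕ} (i : Fin n ⊕ Fin n) (u : Tan n → ℝ) (z : Tan n) : ℝ := fderiv ℝ u z (frame n i)

/-- The matrix `g_{ij}` of a metric in the coordinate frame. -/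
def gram {n : ℕ} (g : Tan n → Tan n →L[ℝ] Tan n →L[ℝ] ℝ) (z : Tan n) :
    Matrix (Fin n ⊕ Fin n) (Fin n ⊕ Fin n) ℝ :=
  Matrix.of fun i j => g z (frame n i) (frame n j)

/-- The Christoffel symbol `Γ^k_{ij} = ½ g^{kl} (∂ᵢ g_{jl} + ∂ⱼ g_{il} - ∂ₗ g_{ij})`. -/
def christoffel {n : ℕ} (g : Tan n → Tan n →L[ℝ] Tan n →L[ℝ] ℝ) (k i j : Fin n ⊕ Fin n)
    (z : Tan n) : ℝ :=
  (1 / 2 : ℝ) * ∑ l, (gram g z)⁻¹ k l *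
    (pd i (fun w => gram g w j l) z + pd j (fun w => gram g w i l) z
      - pd l (fun w => gram g w i j) z)

/-- The Ricci curvature
`R_{ij} = ∂ₖ Γ^k_{ij} - ∂ⱼ Γ^k_{ik} + Γ^k_{kl} Γ^l_{ij} - Γ^k_{jl} Γ^l_{ik}`. -/
def ricci {n : ℕ} (g : Tan n → Tan n →L[ℝ] Tan n →L[ℝ] ℝ) (i j : Fin n ⊕ Fin n)
    (z : Tan n) : ℝ :=
  ∑ k, (pd k (christoffel g k i j) z - pd j (christoffel g k i k) z)
    + ∑ k, ∑ l, (christoffel g k k l z * christoffel g l i j z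
      - christoffel g k j l z * christoffel g l i k z)

/-- The Nijenhuis tensor `[Ju, Jv] - J[Ju, v] - J[u, Jv] - [u, v]` of an almost complex structure,
evaluated on the constant vector fields `u` and `v`. -/
def nijenhuis {n : ℕ} (J : Tan n → Tan n →L[ℝ] Tan n) (u v : Tan n) (z : Tan n) : Tan n :=
  VectorField.lieBracket ℝ (fun w => J w u) (fun w => J w v) z
    - J z (VectorField.lieBracket ℝ (fun w => J w u) (fun _ => v) z)
    - J z (VectorField.lieBracket ℝ (fun _ => u) (fun w => J w v) z)
    - VectorField.lieBracket ℝ (fun _ => u) (fun _ => v) z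

end Tensors

/-- A quadruple of tensor fields `(ω, g, J, Ω)` on `Tⁿ × ℝⁿ`: a real 2-form `ω` (`kahler`), a field of bilinear
forms, a field of endomorphisms and a complex-valued `n`-form. When such a quadruple is considered
on `Y_R`, only its values there matter. -/
structure Quad {n : ℕ} (b : Module.Basis (Fin n) ℝ (Rn n)) where
  kahler : Torus b × Rn n → Tan n [⋀^Fin 2]→L[ℝ] ℝ
  g : Torus b × Rn n → Tan n →L[ℝ] Tan n →L[ℝ] ℝ
  J : Torus b × Rn n → Tan n →L[ℝ] Tan n
  Ω : Torus b × Rn n → Tan n [⋀^Fin n]→L[ℝ] ℂ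

/-- `(ω, g, J, Ω)` is a Calabi–Yau structure on `Y_R`: `(g, J)` is a Ricci-flat Kähler structure
with Kähler form `ω = g(J·, ·)`, and `Ω` is a nowhere vanishing holomorphic `n`-form (a form of
type `(n, 0)` is holomorphic if and only if it is closed). -/
structure Quad.IsCalabiYauOn {n : ℕ} {b : Module.Basis (Fin n) ℝ (Rn n)} (S : Quad b) (R : ℝ) :
    Prop where
  smooth_kahler : SmoothOn S.kahler R
  smooth_g : SmoothOn S.g R
  smooth_J : SmoothOn S.J R
  smooth_Ω : SmoothOn S.Ω R
  g_symm : ∀ z ∈ coverTube n R, ∀ u v, pull S.g z u v = pull S.g z v u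
  g_pos : ∀ z ∈ coverTube n R, ∀ u, u ≠ 0 → 0 < pull S.g z u u
  J_sq : ∀ z ∈ coverTube n R, ∀ u, pull S.J z (pull S.J z u) = -u
  J_integrable : ∀ z ∈ coverTube n R, ∀ u v, nijenhuis (pull S.J) u v z = 0
  g_hermitian : ∀ z ∈ coverTube n R, ∀ u v,
    pull S.g z (pull S.J z u) (pull S.J z v) = pull S.g z u v
  kahler_eq : ∀ z ∈ coverTube n R, ∀ u v, pull S.kahler z ![u, v] = pull S.g z (pull S.J z u) v
  kahler_closed : ∀ z ∈ coverTube n R, extDeriv (pull S.kahler) z = 0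
  ricci_flat : ∀ z ∈ coverTube n R, ∀ i j, ricci (pull S.g) i j z = 0
  Ω_ne_zero : ∀ z ∈ coverTube n R, pull S.Ω z ≠ 0
  Ω_type : ∀ z ∈ coverTube n R, ∀ (v : Fin n → Tan n) (i : Fin n),
    pull S.Ω z (Function.update v i (pull S.J z (v i))) = Complex.I * pull S.Ω z v
  Ω_closed : ∀ z ∈ coverTube n R, extDeriv (pull S.Ω) z = 0

/-- The form `∑ⱼ dxⱼ ∧ dyⱼ` on `ℝⁿ × ℝⁿ`. -/
def stdKahler (n : ℕ) : Tan n [⋀^Fin 2]→L[ℝ] ℝ where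
  toFun v := ∑ j, ((v 0).1 j * (v 1).2 j - (v 0).2 j * (v 1).1 j)
  map_update_add' v i u w := by
    rw [← Finset.sum_add_distrib]
    refine Finset.sum_congr rfl fun j _ => ?_
    fin_cases i <;> simp [Function.update] <;> ring
  map_update_smul' v i c u := by
    rw [Finset.smul_sum]
    refine Finset.sum_congr rfl fun j _ => ?_
    fin_cases i <;> simp [Function.update] <;> ring
  cont := by fun_prop
  map_eq_zero_of_eq' v i j hv hij := by
    have h : v 0 = v 1 := by
      fin_cases i <;> fin_cases j <;> simp_all
    rw [h]
    exact Finset.sum_eq_zero fun j _ => by ring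

/-- The `ℂ`-valued 1-form `dzⱼ = dxⱼ + √-1 dyⱼ` on `ℝⁿ × ℝⁿ`. -/
def dz {n : ℕ} (j : Fin n) (u : Tan n) : ℂ := (u.1 j : ℂ) + Complex.I * (u.2 j : ℂ)

/-- The form `dz₁ ∧ ⋯ ∧ dzₙ` on `ℝⁿ × ℝⁿ`, that is `(v₁, …, vₙ) ↦ det (dzⱼ(vᵢ))`. -/
def stdΩ (n : ℕ) : Tan n [⋀^Fin n]→L[ℝ] ℂ where
  toFun v := Matrix.det (Matrix.of fun i j => dz j (v i))
  map_update_add' v i u w := by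
    rename_i inst
    obtain rfl : inst = instDecidableEqFin n := Subsingleton.elim _ _
    have h : ∀ p : Tan n, Matrix.of (fun k j => dz j (Function.update v i p k))
        = Matrix.updateRow (Matrix.of fun k j => dz j (v k)) i (fun j => dz j p) := by
      intro p
      ext k j
      by_cases hk : k = i <;> simp [Matrix.updateRow_apply, Function.update_apply, hk]
    rw [h, h, h, ← Matrix.det_updateRow_add]
    congr 2
    ext j
    simp [dz]
    ring
  map_update_smul' v i c u := by
    rename_i inst
    obtain rfl : inst = instDecidableEqFin n := Subsingleton.elim _ _
    have h : ∀ p : Tan n, Matrix.of (fun k j => dz j (Function.update v i p k))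
        = Matrix.updateRow (Matrix.of fun k j => dz j (v k)) i (fun j => dz j p) := by
      intro p
      ext k j
      by_cases hk : k = i <;> simp [Matrix.updateRow_apply, Function.update_apply, hk]
    rw [h, h, Complex.real_smul, ← Matrix.det_updateRow_smul]
    congr 2
    ext j
    simp [dz]
    ring
  cont := by
    refine Continuous.matrix_det ?_
    refine continuous_matrix fun i j => ?_
    simp only [Matrix.of_apply, dz]
    fun_prop
  map_eq_zero_of_eq' v i j hv hij :=
    Matrix.det_zero_of_row_eq hij (by ext k; simp [hv])

/-- The Euclidean metric `∑ⱼ (dxⱼ² + dyⱼ²)` on `ℝⁿ × ℝⁿ`. -/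
def stdg (n : ℕ) : Tan n →L[ℝ] Tan n →L[ℝ] ℝ :=
  (innerSL ℝ).bilinearComp (ContinuousLinearMap.fst ℝ (Rn n) (Rn n))
      (ContinuousLinearMap.fst ℝ (Rn n) (Rn n))
    + (innerSL ℝ).bilinearComp (ContinuousLinearMap.snd ℝ (Rn n) (Rn n))
      (ContinuousLinearMap.snd ℝ (Rn n) (Rn n))

/-- The complex structure `J ∂/∂xⱼ = ∂/∂yⱼ`, `J ∂/∂yⱼ = -∂/∂xⱼ` on `ℝⁿ × ℝⁿ`. -/
def stdJ (n : ℕ) : Tan n →L[ℝ] Tan n :=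
  (-ContinuousLinearMap.snd ℝ (Rn n) (Rn n)).prod (ContinuousLinearMap.fst ℝ (Rn n) (Rn n))

/-- The flat Calabi–Yau structure of `Tⁿ × ℝⁿ`. -/
def flat {n : ℕ} (b : Module.Basis (Fin n) ℝ (Rn n)) : Quad b where
  kahler _ := stdKahler n
  g _ := stdg n
  J _ := stdJ n
  Ω _ := stdΩ n

section Hypotheses

variable {n : ℕ} {b : Module.Basis (Fin n) ℝ (Rn n)}

/-- `C^∞` convergence `(ωₖ, gₖ, Jₖ, Ωₖ) → (ω, g, J, Ω)` on `Y_R`. -/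
def Quad.SmoothLimit (S : ℕ → Quad b) (S₀ : Quad b) (R : ℝ) : Prop :=
  SmoothLimitOn (fun k => (S k).kahler) S₀.kahler R ∧ SmoothLimitOn (fun k => (S k).g) S₀.g R ∧
    SmoothLimitOn (fun k => (S k).J) S₀.J R ∧ SmoothLimitOn (fun k => (S k).Ω) S₀.Ω R

/-- The 2-forms `η` and `η'` define the same class in the de Rham cohomology `H²(Y_R, ℝ)`: they
differ by the exterior derivative of a smooth 1-form on `Y_R`. -/
def SameClassOn (η η' : Torus b × Rn n → Tan n [⋀^Fin 2]→L[ℝ] ℝ) (R : ℝ) : Prop :=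
  ∃ α : Torus b × Rn n → Tan n [⋀^Fin 1]→L[ℝ] ℝ, SmoothOn α R ∧
    ∀ z ∈ coverTube n R, pull η z - pull η' z = extDeriv (pull α) z

variable {R : ℝ} {Γ : Type*} [Group Γ] [MulAction Γ (Torus b)] [MulAction Γ (Ball n R)]

/-- `φ × ψ` is a smooth lift to `ℝⁿ × B(0, R)` of the transformation
`(x, y) ↦ (γ • x, γ • y)` of `Y_R = Tⁿ × B(0, R)`. -/
structure IsLift (γ : Γ) (φ : Rn n → Rn n) (ψ : Rn n → Rn n) : Prop where
  smooth_torus : ContDiff ℝ ∞ φ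
  lift_torus : ∀ x, toTorus b (φ x) = γ • toTorus b x
  smooth_ball : ContDiffOn ℝ ∞ ψ (Metric.ball 0 R)
  lift_ball : ∀ y : Ball n R, ψ y = ((γ • y : Ball n R) : Rn n)

/-- The differential of `φ × ψ` at `z`. -/
def liftDeriv (φ ψ : Rn n → Rn n) (z : Tan n) : Tan n →L[ℝ] Tan n :=
  (fderiv ℝ φ z.1).prodMap (fderiv ℝ ψ z.2)

variable (b R Γ) in
/-- The product action of `Γ` on `Y_R = Tⁿ × B(0, R)` is by smooth maps (a self-map of `Tⁿ` is
smooth if and only if it lifts to a smooth self-map of `ℝⁿ`), and `Tⁿ × {0}` is invariant. -/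
structure IsSmoothAction : Prop where
  smooth : ∀ γ : Γ, ∃ φ ψ : Rn n → Rn n, IsLift (b := b) (R := R) γ φ ψ
  zero_invariant : ∀ (γ : Γ) (y : Ball n R), (y : Rn n) = 0 → ((γ • y : Ball n R) : Rn n) = 0

variable (R Γ) in
/-- The product action of `Γ` on `Y_R` preserves `ω`, `g` and `Ω`, that is `γ^*ω = ω`, `γ^*g = g`
and `γ^*Ω = Ω` on `Y_R` for every `γ`. -/
structure Quad.IsPreservedBy (S : Quad b) : Prop where
  kahler_inv : ∀ (γ : Γ) (φ ψ : Rn n → Rn n), IsLift (b := b) (R := R) γ φ ψ →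
    ∀ z ∈ coverTube n R, (pull S.kahler (φ z.1, ψ z.2)).compContinuousLinearMap (liftDeriv φ ψ z)
      = pull S.kahler z
  g_inv : ∀ (γ : Γ) (φ ψ : Rn n → Rn n), IsLift (b := b) (R := R) γ φ ψ →
    ∀ z ∈ coverTube n R, ∀ u v,
      pull S.g (φ z.1, ψ z.2) (liftDeriv φ ψ z u) (liftDeriv φ ψ z v) = pull S.g z u v
  Ω_inv : ∀ (γ : Γ) (φ ψ : Rn n → Rn n), IsLift (b := b) (R := R) γ φ ψ →
    ∀ z ∈ coverTube n R, (pull S.Ω (φ z.1, ψ z.2)).compContinuousLinearMap (liftDeriv φ ψ z)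
      = pull S.Ω z

end Hypotheses

section Conclusion

variable {n : ℕ} {b : Module.Basis (Fin n) ℝ (Rn n)}

/-- `∫_L Ω`, where `L = Tⁿ × {0}` is oriented by `dx₁ ∧ ⋯ ∧ dxₙ`: the integral of
`Ω(∂/∂x₁, …, ∂/∂xₙ)` over a fundamental domain of the lattice. -/
def Quad.period (S : Quad b) : ℂ :=
  ∫ x in ZSpan.fundamentalDomain b,
    pull S.Ω (x, 0) (fun i => ((EuclideanSpace.single i (1 : ℝ) : Rn n), (0 : Rn n)))

/-- The parametrisation `x ↦ (x, s(x))`, `x ∈ ℝⁿ`, of the (universal cover of the) graph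
`{(x, s(x)) : x ∈ Tⁿ}` of a map `s : Tⁿ → B(0, R)`. -/
def graphMap {R : ℝ} (s : Torus b → Ball n R) (x : Rn n) : Tan n := (x, (s (toTorus b x) : Rn n))

/-- The graph of `s : Tⁿ → B(0, R)` is a smooth special Lagrangian submanifold of `Y_R` of phase
`θ`: `s` is smooth, and `ω` and `Im (e^{√-1 θ} Ω)` restrict to zero on the graph. -/
structure Quad.IsSpecialLagrangianGraph (S : Quad b) (θ : ℝ) {R : ℝ} (s : Torus b → Ball n R) :
    Prop where
  smooth : ContDiff ℝ ∞ (graphMap s)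
  lagrangian : ∀ x : Rn n,
    (pull S.kahler (graphMap s x)).compContinuousLinearMap (fderiv ℝ (graphMap s) x) = 0
  special : ∀ (x : Rn n) (v : Fin n → Rn n),
    (Complex.exp (Complex.I * θ) *
      (pull S.Ω (graphMap s x)).compContinuousLinearMap (fderiv ℝ (graphMap s) x) v).im = 0

/-- `f : W → B` is a `Γ`-equivariant special Lagrangian fibration of phase `θ` of the open set
`W ⊆ Y_R` over the open set `B ⊆ B(0, R)`, whose fibres are graphs over the torus. -/
structure Quad.IsEquivariantFibration (S : Quad b) (θ : ℝ) {R : ℝ} (Γ : Type*) [Group Γ]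
    [MulAction Γ (Torus b)] [MulAction Γ (Ball n R)]
    (W : Set (Tube b R)) (B : Set (Ball n R)) (f : Tube b R → Ball n R) : Prop where
  isOpen_total : IsOpen W
  isOpen_base : IsOpen B
  continuousOn : ContinuousOn f W
  surj : f '' W = B
  total_invariant : ∀ (γ : Γ), ∀ z ∈ W, γ • z ∈ W
  base_invariant : ∀ (γ : Γ), ∀ y ∈ B, γ • y ∈ B
  equivariant : ∀ (γ : Γ), ∀ z ∈ W, f (γ • z) = γ • f z
  fiber : ∀ y ∈ B, ∃ s : Torus b → Ball n R,
    {z | z ∈ W ∧ f z = y} = Set.range (fun x => (x, s x)) ∧ S.IsSpecialLagrangianGraph θ s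

end Conclusion

end TorusCY

end

open TorusCY

/-!
Special Lagrangian graphs `y = s(x)` over the torus are the solutions of a first order elliptic
system. For the flat structure its linearisation is `s ↦ (curl s, div s)`, which is injective on maps
of mean zero, and the constant maps are solutions. The system for `(ωₖ, Ωₖ)`, with the phase chosen so
that `∫ Im (e^{iθₖ} Ωₖ) = 0` over the zero section, is a small perturbation of it, and for every
`c ∈ ℝⁿ` it has exactly one small-slope solution `s_c` with mean value `c`. These solutions are the
fibres.

*The equation.* Let `green j = ∂ⱼ Δ⁻¹`. Then `green_curl_div` recovers `s - mean s` from `curl s` and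
`div s`, which turns the system into the fixed point equation `s = c - picard A s` (`IsSol`). A fixed
point solves the original system (`IsSol.isSL`): by the cohomological hypotheses, the restriction of
`ωₖ` to the graph is exact (`exists_primitive_graph`) and that of `Im (e^{iθₖ} Ωₖ)` has mean zero
(`mean_eq_zero_of_closed`), and on such pairs the Green operator is injective (`eq_zero_of_green`).

*Solving it.* The fixed point argument takes place in the norms `wienerC q`, the sum of the absolute
values of the Fourier coefficients of all derivatives up to order `q`. They are submultiplicative and
the Riesz transforms `∂ᵢ∂ⱼΔ⁻¹` are bounded by one in them (`rieszBounded_wiener`), so that no further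
elliptic regularity theory is needed, and for large `q` they are compatible with composition with smooth
coefficients (`exists_unifEst_wienerC`). Smallness of finitely many derivatives of the perturbation is
enough for solutions that are smooth: giving the derivatives beyond order `q` a small weight `ε` changes
the contraction constant by `O(ε)` only (`exists_est_lev`, `exists_solutions`). The coefficients are cut
off in the vertical direction, so that the equation is solved for all `c ∈ ℝⁿ` at once; convergence of
the structures makes the cut-off perturbation small (`eventually_pert_bd`).

*The fibration.* The map `c ↦ s_c(x)` differs from the identity by a map with Lipschitz constant `1/2`
(`Contr.lipschitz`), hence is a bijection of `ℝⁿ` for every `x`; the graphs foliate `Tⁿ × ℝⁿ`, and the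
fibration sends a point to the mean value `c` of its leaf
(`IsLeafFamily.exists_isEquivariantFibration`).

*Equivariance.* A product transformation that preserves `g` and `ω` has the form
`(x, y) ↦ (P x + t, P y)` with `P` orthogonal (`exists_affine_lift`). It maps special Lagrangian graphs
to special Lagrangian graphs (`IsSL.trSec`), and the mean value `c` to `P c`; by uniqueness it maps the
leaf `s_c` to the leaf `s_{P c}`.
-/

noncomputable section

namespace TorusCY

variable {n : ℕ} {b : Module.Basis (Fin n) ℝ (Rn n)}

/-! ### Smooth functions on the torus -/

/-- The smooth `Λ`-periodic real functions on `ℝⁿ`, as a subalgebra. -/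
def perSubalgebra (b : Module.Basis (Fin n) ℝ (Rn n)) : Subalgebra ℝ (Rn n → ℝ) where
  carrier := {f | ContDiff ℝ ∞ f ∧ ∀ x, ∀ v ∈ Submodule.span ℤ (Set.range b), f (x + v) = f x}
  mul_mem' := fun hf hg => ⟨hf.1.mul hg.1, fun x v hv => by simp [hf.2 x v hv, hg.2 x v hv]⟩
  add_mem' := fun hf hg => ⟨hf.1.add hg.1, fun x v hv => by simp [hf.2 x v hv, hg.2 x v hv]⟩
  algebraMap_mem' := fun c => ⟨contDiff_const, fun x v _ => rfl⟩

/-- The algebra `C^∞(Tⁿ)`, realised as the smooth `Λ`-periodic real functions on `ℝⁿ`. -/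
def PerSm (b : Module.Basis (Fin n) ℝ (Rn n)) : Type := perSubalgebra b

instance : CommRing (PerSm b) := inferInstanceAs (CommRing (perSubalgebra b))

instance : Algebra ℝ (PerSm b) := inferInstanceAs (Algebra ℝ (perSubalgebra b))

namespace PerSm

/-- The underlying function on `ℝⁿ`. -/
def toFun (f : PerSm b) : Rn n → ℝ := Subtype.val (p := (· ∈ perSubalgebra b)) f

instance : FunLike (PerSm b) (Rn n) ℝ where
  coe := toFun
  coe_injective _ _ h := Subtype.ext h

/-- A smooth periodic function as an element of `C^∞(Tⁿ)`. -/
def mk (f : Rn n → ℝ) (hf : ContDiff ℝ ∞ f)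
    (hp : ∀ x, ∀ v ∈ Submodule.span ℤ (Set.range b), f (x + v) = f x) : PerSm b :=
  Subtype.mk (p := (· ∈ perSubalgebra b)) f ⟨hf, hp⟩

@[simp] theorem coe_mk (f : Rn n → ℝ) (hf : ContDiff ℝ ∞ f)
    (hp : ∀ x, ∀ v ∈ Submodule.span ℤ (Set.range b), f (x + v) = f x) : ⇑(mk f hf hp) = f := rfl

theorem smooth (f : PerSm b) : ContDiff ℝ ∞ f := f.2.1

theorem periodic (f : PerSm b) (x : Rn n) {v : Rn n} (hv : v ∈ Submodule.span ℤ (Set.range b)) :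
    f (x + v) = f x := f.2.2 x v hv

theorem differentiable (f : PerSm b) : Differentiable ℝ f := f.smooth.differentiable (by simp)

theorem continuous (f : PerSm b) : Continuous f := f.smooth.continuous

@[ext] theorem ext {f g : PerSm b} (h : ∀ x, f x = g x) : f = g := DFunLike.ext _ _ h

@[simp] theorem add_apply (f g : PerSm b) (x : Rn n) : (f + g) x = f x + g x := rfl
@[simp] theorem sub_apply (f g : PerSm b) (x : Rn n) : (f - g) x = f x - g x := rfl
@[simp] theorem neg_apply (f : PerSm b) (x : Rn n) : (-f) x = -f x := rfl
@[simp] theorem mul_apply (f g : PerSm b) (x : Rn n) : (f * g) x = f x * g x := rfl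
@[simp] theorem smul_apply (c : ℝ) (f : PerSm b) (x : Rn n) : (c • f) x = c * f x := rfl
@[simp] theorem zero_apply (x : Rn n) : (0 : PerSm b) x = 0 := rfl
@[simp] theorem one_apply (x : Rn n) : (1 : PerSm b) x = 1 := rfl
@[simp] theorem algebraMap_apply (c : ℝ) (x : Rn n) : (algebraMap ℝ (PerSm b) c) x = c := rfl

/-- Evaluation at a point. -/
def eval (x : Rn n) : PerSm b →ₐ[ℝ] ℝ := (Pi.evalAlgHom ℝ _ x).comp (perSubalgebra b).val

@[simp] theorem sum_apply {ι : Type*} (s : Finset ι) (f : ι → PerSm b) (x : Rn n) :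
    (∑ i ∈ s, f i) x = ∑ i ∈ s, f i x := map_sum (eval x) f s

@[simp] theorem prod_apply {ι : Type*} (s : Finset ι) (f : ι → PerSm b) (x : Rn n) :
    (∏ i ∈ s, f i) x = ∏ i ∈ s, f i x := map_prod (eval x) f s

/-- The partial derivative `∂/∂xᵢ` on `C^∞(Tⁿ)`. -/
def D (i : Fin n) : PerSm b →ₗ[ℝ] PerSm b where
  toFun f := mk (fun x => fderiv ℝ f x (EuclideanSpace.single i 1))
    ((f.smooth.fderiv_right (m := ∞) (by simp)).clm_apply contDiff_const) fun x v hv => by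
      have : (fun x => f (x + v)) = f := funext fun x => f.periodic x hv
      rw [← fderiv_comp_add_right, this]
  map_add' f g := by
    ext x
    change fderiv ℝ (fun x => f x + g x) x _ = _
    rw [fderiv_fun_add (f.differentiable x) (g.differentiable x)]; rfl
  map_smul' c f := by
    ext x
    change fderiv ℝ (fun x => c * f x) x _ = _
    rw [fderiv_const_mul (f.differentiable x)]; rfl

theorem D_apply (i : Fin n) (f : PerSm b) (x : Rn n) :
    D i f x = fderiv ℝ f x (EuclideanSpace.single i 1) := rfl

theorem D_mul (i : Fin n) (f g : PerSm b) : D i (f * g) = D i f * g + f * D i g := by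
  ext x
  change fderiv ℝ (fun x => f x * g x) x _ = fderiv ℝ f x _ * g x + f x * fderiv ℝ g x _
  rw [fderiv_fun_mul (f.differentiable x) (g.differentiable x)]
  simp; ring

@[simp] theorem D_algebraMap (i : Fin n) (c : ℝ) : D i (algebraMap ℝ (PerSm b) c) = 0 := by
  ext x
  change fderiv ℝ (fun _ => c) x _ = 0
  simp

@[simp] theorem D_one (i : Fin n) : D i (1 : PerSm b) = 0 := by
  simpa using D_algebraMap (b := b) i 1

theorem D_comm (i j : Fin n) (f : PerSm b) : D i (D j f) = D j (D i f) := by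
  ext x
  have key : ∀ i j : Fin n, D i (D j f) x
      = fderiv ℝ (fderiv ℝ f) x (EuclideanSpace.single i 1) (EuclideanSpace.single j 1) := by
    intro i j
    rw [D_apply]
    change fderiv ℝ (fun y => fderiv ℝ f y (EuclideanSpace.single j 1)) x _ = _
    rw [fderiv_clm_apply]
    · simp
    · exact ((f.smooth.fderiv_right (m := ∞) (by simp)).differentiable (by simp)) x
    · exact differentiableAt_const _
  rw [key, key]
  exact (f.smooth.contDiffAt.isSymmSndFDerivAt (by simpa using (WithTop.coe_le_coe.2 (le_top : (2 : ℕ∞) ≤ ⊤)))) _ _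

theorem fderiv_eq_sum (f : PerSm b) (x v : Rn n) : fderiv ℝ f x v = ∑ i, v i * D i f x := by
  conv_lhs => rw [← (EuclideanSpace.basisFun (Fin n) ℝ).sum_repr v]
  simp [map_sum, D_apply]

/-- The supremum norm. -/
def supN (f : PerSm b) : ℝ := ⨆ x, |f x|

theorem bddAbove_abs (f : PerSm b) : BddAbove (Set.range fun x => |f x|) :=
  (IsZLattice.isCompact_range_of_periodic (Submodule.span ℤ (Set.range b)) (fun x => |f x|)
    f.continuous.abs fun z w hw => by simp only [f.periodic z hw]).bddAbove

theorem abs_le_supN (f : PerSm b) (x : Rn n) : |f x| ≤ supN f := le_ciSup f.bddAbove_abs x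

theorem supN_le {f : PerSm b} {C : ℝ} (h : ∀ x, |f x| ≤ C) : supN f ≤ C := ciSup_le h

/-! ### Submultiplicative seminorms and the gain of derivatives -/

/-- `ν` is a submultiplicative seminorm on `C^∞(Tⁿ)` with `ν 1 ≤ 1`. -/
structure IsAlgNorm (ν : PerSm b → ℝ) : Prop where
  nonneg : ∀ f, 0 ≤ ν f
  add_le : ∀ f g, ν (f + g) ≤ ν f + ν g
  smul_le : ∀ (c : ℝ) f, ν (c • f) ≤ |c| * ν f
  mul_le : ∀ f g, ν (f * g) ≤ ν f * ν g
  one_le : ν 1 ≤ 1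

namespace IsAlgNorm

variable {ν : PerSm b → ℝ} (h : IsAlgNorm ν)
include h

theorem zero : ν 0 = 0 :=
  le_antisymm (by simpa using h.smul_le 0 0) (h.nonneg 0)

theorem neg (f : PerSm b) : ν (-f) = ν f := by
  refine le_antisymm (by simpa using h.smul_le (-1) f) (by simpa using h.smul_le (-1) (-f))

theorem sum_le {ι : Type*} (s : Finset ι) (f : ι → PerSm b) :
    ν (∑ i ∈ s, f i) ≤ ∑ i ∈ s, ν (f i) :=
  Finset.le_sum_of_subadditive ν h.zero.le h.add_le s f

theorem sum_le_card {ι : Type*} (s : Finset ι) (f : ι → PerSm b) {C : ℝ}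
    (hf : ∀ i ∈ s, ν (f i) ≤ C) : ν (∑ i ∈ s, f i) ≤ s.card * C :=
  (h.sum_le s f).trans (by simpa using Finset.sum_le_card_nsmul s _ C hf)

theorem algebraMap_le (c : ℝ) : ν (algebraMap ℝ (PerSm b) c) ≤ |c| := by
  rw [Algebra.algebraMap_eq_smul_one]
  exact (h.smul_le c 1).trans (mul_le_of_le_one_right (abs_nonneg c) h.one_le)

end IsAlgNorm

theorem isAlgNorm_supN : IsAlgNorm (supN (b := b)) where
  nonneg f := (abs_nonneg (f 0)).trans (f.abs_le_supN 0)
  add_le f g := supN_le fun x =>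
    (abs_add_le _ _).trans (add_le_add (f.abs_le_supN x) (g.abs_le_supN x))
  smul_le c f := supN_le fun x => by
    rw [smul_apply, abs_mul]
    exact mul_le_mul_of_nonneg_left (f.abs_le_supN x) (abs_nonneg c)
  mul_le f g := supN_le fun x => by
    rw [mul_apply, abs_mul]
    exact mul_le_mul (f.abs_le_supN x) (g.abs_le_supN x) (abs_nonneg _)
      ((abs_nonneg (f 0)).trans (f.abs_le_supN 0))
  one_le := supN_le fun x => by simp

/-- The seminorm `f ↦ ν f + ε ∑ᵢ ν (∂ᵢ f)`, which controls one more derivative than `ν`, with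
weight `ε`. -/
def raise (ε : ℝ) (ν : PerSm b → ℝ) (f : PerSm b) : ℝ := ν f + ε * ∑ i, ν (D i f)

theorem IsAlgNorm.raise {ν : PerSm b → ℝ} (h : IsAlgNorm ν) {ε : ℝ} (hε : 0 ≤ ε) :
    IsAlgNorm (raise ε ν) where
  nonneg f := add_nonneg (h.nonneg f) (mul_nonneg hε (Finset.sum_nonneg fun i _ => h.nonneg _))
  add_le f g := by
    have h1 := h.add_le f g
    have h2 : ∑ i, ν (D i (f + g)) ≤ ∑ i, ν (D i f) + ∑ i, ν (D i g) := by
      rw [← Finset.sum_add_distrib]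
      exact Finset.sum_le_sum fun i _ => by rw [map_add]; exact h.add_le _ _
    have h3 := mul_le_mul_of_nonneg_left h2 hε
    simp only [PerSm.raise]
    linarith
  smul_le c f := by
    have h2 : ∑ i, ν (D i (c • f)) ≤ |c| * ∑ i, ν (D i f) := by
      rw [Finset.mul_sum]
      exact Finset.sum_le_sum fun i _ => by rw [map_smul]; exact h.smul_le _ _
    have h3 := mul_le_mul_of_nonneg_left h2 hε
    have h1 := h.smul_le c f
    simp only [PerSm.raise]
    linarith
  mul_le f g := by
    have h2 : ∑ i, ν (D i (f * g)) ≤ (∑ i, ν (D i f)) * ν g + ν f * ∑ i, ν (D i g) := by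
      rw [Finset.mul_sum, Finset.sum_mul, ← Finset.sum_add_distrib]
      exact Finset.sum_le_sum fun i _ => by
        rw [D_mul]; exact (h.add_le _ _).trans (add_le_add (h.mul_le _ _) (h.mul_le _ _))
    have h3 := mul_le_mul_of_nonneg_left h2 hε
    have h1 := h.mul_le f g
    have h4 : 0 ≤ (ε * ∑ i, ν (D i f)) * (ε * ∑ i, ν (D i g)) :=
      mul_nonneg (mul_nonneg hε (Finset.sum_nonneg fun i _ => h.nonneg _))
        (mul_nonneg hε (Finset.sum_nonneg fun i _ => h.nonneg _))
    simp only [PerSm.raise]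
    linarith
  one_le := by simpa [PerSm.raise, h.zero] using h.one_le

theorem IsAlgNorm.iterate_raise {ν : PerSm b → ℝ} (h : IsAlgNorm ν) {ε : ℝ} (hε : 0 ≤ ε) (j : ℕ) :
    IsAlgNorm ((PerSm.raise ε)^[j] ν) := by
  induction j with
  | zero => exact h
  | succ j ih => rw [Function.iterate_succ_apply']; exact ih.raise hε

theorem IsAlgNorm.le_raise {ν : PerSm b → ℝ} (h : IsAlgNorm ν) {ε : ℝ} (hε : 0 ≤ ε) (f : PerSm b) :
    ν f ≤ PerSm.raise ε ν f :=
  le_add_of_nonneg_right (mul_nonneg hε (Finset.sum_nonneg fun _ _ => h.nonneg _))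

theorem raise_mono {ν μ : PerSm b → ℝ} {C ε : ℝ} (hε : 0 ≤ ε) (h : ∀ f, ν f ≤ C * μ f)
    (f : PerSm b) : raise ε ν f ≤ C * raise ε μ f := by
  have h2 : ∑ i, ν (D i f) ≤ C * ∑ i, μ (D i f) := by
    rw [Finset.mul_sum]; exact Finset.sum_le_sum fun i _ => h _
  have h3 := mul_le_mul_of_nonneg_left h2 hε
  have h1 := h f
  simp only [raise]
  linarith

theorem iterate_raise_mono {ν μ : PerSm b → ℝ} {C ε : ℝ} (hε : 0 ≤ ε) (h : ∀ f, ν f ≤ C * μ f)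
    (j : ℕ) (f : PerSm b) : (raise ε)^[j] ν f ≤ C * (raise ε)^[j] μ f := by
  induction j generalizing f with
  | zero => exact h f
  | succ j ih => rw [Function.iterate_succ_apply', Function.iterate_succ_apply']
                 exact raise_mono hε ih f

/-- The `C^j` norm. -/
def cnorm (j : ℕ) : PerSm b → ℝ := (raise 1)^[j] supN

theorem cnorm_succ (j : ℕ) (f : PerSm b) : cnorm (j + 1) f = cnorm j f + ∑ i, cnorm j (D i f) := by
  simp [cnorm, Function.iterate_succ_apply', raise]

theorem isAlgNorm_cnorm (j : ℕ) : IsAlgNorm (cnorm (b := b) j) :=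
  isAlgNorm_supN.iterate_raise zero_le_one j

theorem norm_iteratedFDeriv_le_cnorm (j : ℕ) (f : PerSm b) (x : Rn n) :
    ‖iteratedFDeriv ℝ j f x‖ ≤ cnorm j f := by
  induction j generalizing f with
  | zero => simpa [cnorm] using f.abs_le_supN x
  | succ j ih =>
    have h1 : fderiv ℝ f = fun y => ∑ i, D i f y • (EuclideanSpace.proj (𝕜 := ℝ) i : Rn n →L[ℝ] ℝ) := by
      ext y v
      rw [fderiv_eq_sum]
      simp [mul_comm]
    rw [← norm_iteratedFDeriv_fderiv, h1, iteratedFDeriv_fun_sum_apply, cnorm_succ]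
    · refine (norm_sum_le _ _).trans ((Finset.sum_le_sum fun i _ => ?_).trans
        (le_add_of_nonneg_left ((isAlgNorm_cnorm j).nonneg f)))
      have h2 : (fun y => D i f y • (EuclideanSpace.proj (𝕜 := ℝ) i : Rn n →L[ℝ] ℝ))
        = (ContinuousLinearMap.toSpanSingleton ℝ (EuclideanSpace.proj (𝕜 := ℝ) i : Rn n →L[ℝ] ℝ)) ∘
          (D i f) := by ext; simp
      rw [h2]
      refine (ContinuousLinearMap.norm_iteratedFDeriv_comp_left _ ((D i f).smooth.contDiffAt (n := ∞))
        (by exact_mod_cast le_top)).trans ?_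
      refine (mul_le_of_le_one_left (norm_nonneg _) ?_).trans (ih _)
      rw [ContinuousLinearMap.norm_toSpanSingleton]
      refine ContinuousLinearMap.opNorm_le_bound _ zero_le_one fun v => ?_
      simpa using PiLp.norm_apply_le v i
    · intro i _
      exact (((D i f).smooth.of_le (by exact_mod_cast le_top)).smul contDiff_const).contDiffAt

/-- A series of elements of `C^∞(Tⁿ)` that converges absolutely in every `C^j` norm can be summed
and differentiated term by term. -/
theorem exists_hasSum {ι : Type*} (F : ι → PerSm b) (hF : ∀ j, Summable fun i => cnorm j (F i)) :
    ∃ S : PerSm b, ∀ x, HasSum (fun i => F i x) (S x) ∧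
      ∀ l, HasSum (fun i => D l (F i) x) (D l S x) := by
  have h0 : Summable fun i => supN (F i) := hF 0
  have hs : ∀ x, Summable fun i => F i x := fun x =>
    Summable.of_norm_bounded h0 fun i => (F i).abs_le_supN x
  have hc : ContDiff ℝ ∞ fun x => ∑' i, F i x :=
    contDiff_tsum (v := fun j i => cnorm j (F i)) (fun i => (F i).smooth) (fun j _ => hF j)
      fun j i x _ => norm_iteratedFDeriv_le_cnorm j (F i) x
  refine ⟨mk (fun x => ∑' i, F i x) hc fun x v hv => by simp only [(F _).periodic x hv],
    fun x => ⟨(hs x).hasSum, fun l => ?_⟩⟩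
  have hb : ∀ i x, ‖fderiv ℝ (F i) x‖ ≤ cnorm 1 (F i) := fun i x => by
    rw [← norm_iteratedFDeriv_one]; exact norm_iteratedFDeriv_le_cnorm 1 (F i) x
  have hd := hasFDerivAt_tsum (hF 1) (fun i x => ((F i).differentiable x).hasFDerivAt) hb (hs 0) x
  have hs2 : Summable fun i => fderiv ℝ (F i) x := Summable.of_norm_bounded (hF 1) fun i => hb i x
  have : D l (mk (b := b) (fun x => ∑' i, F i x) hc
      fun x v hv => by simp only [(F _).periodic x hv]) x = (∑' i, fderiv ℝ (F i) x) (EuclideanSpace.single l 1) := by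
    rw [← hd.fderiv]; rfl
  rw [this]
  exact hs2.hasSum.mapL (ContinuousLinearMap.apply ℝ ℝ (EuclideanSpace.single l (1 : ℝ)))

open MeasureTheory

/-! ### The mean value over the torus -/

/-- The volume of the torus. -/
def torusVol (b : Module.Basis (Fin n) ℝ (Rn n)) : ℝ :=
  (volume : Measure (Rn n)).real (ZSpan.fundamentalDomain b)

theorem volume_fundamentalDomain_lt_top :
    (volume : Measure (Rn n)) (ZSpan.fundamentalDomain b) < ⊤ :=
  (ZSpan.fundamentalDomain_isBounded b).measure_lt_top

theorem torusVol_pos : 0 < torusVol b :=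
  ENNReal.toReal_pos (ZSpan.measure_fundamentalDomain_ne_zero b)
    volume_fundamentalDomain_lt_top.ne

instance : IsFiniteMeasure ((volume : Measure (Rn n)).restrict (ZSpan.fundamentalDomain b)) :=
  ⟨by simpa using volume_fundamentalDomain_lt_top⟩

theorem integrable (f : PerSm b) :
    Integrable f ((volume : Measure (Rn n)).restrict (ZSpan.fundamentalDomain b)) :=
  Integrable.of_bound f.continuous.aestronglyMeasurable (supN f)
    (ae_of_all _ fun x => f.abs_le_supN x)

/-- The mean value of a function on the torus. -/
def mean : PerSm b →ₗ[ℝ] ℝ where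
  toFun f := (torusVol b)⁻¹ * ∫ x in ZSpan.fundamentalDomain b, f x
  map_add' f g := by
    rw [← mul_add, ← integral_add f.integrable g.integrable]; rfl
  map_smul' c f := by
    simp only [smul_apply, integral_const_mul, RingHom.id_apply, smul_eq_mul]; ring

theorem mean_def (f : PerSm b) :
    mean f = (torusVol b)⁻¹ * ∫ x in ZSpan.fundamentalDomain b, f x := rfl

theorem abs_mean_le (f : PerSm b) : |mean f| ≤ supN f := by
  have h := norm_setIntegral_le_of_norm_le_const (f := f) (volume_fundamentalDomain_lt_top (b := b))
    fun x _ => (f.abs_le_supN x)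
  rw [mean_def, abs_mul, abs_inv, abs_of_pos (torusVol_pos (b := b)), inv_mul_le_iff₀ torusVol_pos,
    mul_comm]
  exact h

@[simp] theorem mean_algebraMap (c : ℝ) : mean (algebraMap ℝ (PerSm b) c) = c := by
  rw [mean_def]
  simp only [algebraMap_apply, setIntegral_const, smul_eq_mul]
  change (torusVol b)⁻¹ * (torusVol b * c) = c
  field_simp [(torusVol_pos (b := b)).ne']

@[simp] theorem mean_one : mean (1 : PerSm b) = 1 := by simpa using mean_algebraMap (b := b) 1

theorem hasSum_mean {ι : Type*} [Countable ι] {F : ι → PerSm b} {S : PerSm b}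
    (hF : Summable fun i => supN (F i)) (hS : ∀ x, HasSum (fun i => F i x) (S x)) :
    HasSum (fun i => mean (F i)) (mean S) := by
  refine HasSum.mul_left _ ?_
  refine hasSum_integral_of_dominated_convergence (fun i _ => supN (F i))
    (fun i => (F i).continuous.aestronglyMeasurable)
    (fun i => ae_of_all _ fun x => (F i).abs_le_supN x) (ae_of_all _ fun x => hF)
    (integrable_const _) (ae_of_all _ fun x => hS x)

theorem setIntegral_comp_add (f : PerSm b) (h : Rn n) :
    ∫ x in ZSpan.fundamentalDomain b, f (x + h) = ∫ x in ZSpan.fundamentalDomain b, f x := by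
  have hD := ZSpan.isAddFundamentalDomain' b (volume : Measure (Rn n))
  have hD' := hD.vadd_of_comm h
  have : Countable (Submodule.span ℤ (Set.range b)).toAddSubgroup :=
    inferInstanceAs (Countable (Submodule.span ℤ (Set.range b)))
  rw [hD.setIntegral_eq hD' (f := f)]
  · have h1 := (measurePreserving_add_right (volume : Measure (Rn n)) h).setIntegral_image_emb
      (measurableEmbedding_addRight h) f (ZSpan.fundamentalDomain b)
    rw [← h1]
    congr 2
    exact Set.image_congr fun x _ => add_comm _ _
  · intro g x
    change f ((g : Rn n) + x) = f x
    rw [add_comm]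
    exact f.periodic x g.2

/-- The mean value of `x ↦ f (x + t e)` does not depend on `t`. -/
theorem mean_D (i : Fin n) (f : PerSm b) : mean (D i f) = 0 := by
  set e : Rn n := EuclideanSpace.single i 1
  have hd : ∀ (x : Rn n) (t : ℝ), HasDerivAt (fun t : ℝ => f (x + t • e)) (D i f (x + t • e)) t := by
    intro x t
    have h1 : HasDerivAt (fun t : ℝ => x + t • e) e t := by
      simpa using ((hasDerivAt_id t).smul_const e).const_add x
    exact ((f.differentiable (x + t • e)).hasFDerivAt).comp_hasDerivAt t h1
  have h := (hasDerivAt_integral_of_dominated_loc_of_deriv_le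
    (μ := (volume : Measure (Rn n)).restrict (ZSpan.fundamentalDomain b))
    (F := fun (t : ℝ) x => f (x + t • e)) (F' := fun t x => D i f (x + t • e))
    (x₀ := 0) (bound := fun _ => supN (D i f)) (s := Set.univ) univ_mem
    (Eventually.of_forall fun t =>
      (f.continuous.comp (continuous_id.add continuous_const)).aestronglyMeasurable)
    (by simpa using f.integrable)
    ((D i f).continuous.comp (continuous_id.add continuous_const)).aestronglyMeasurable
    (ae_of_all _ fun x t _ => (D i f).abs_le_supN _) (integrable_const _)
    (ae_of_all _ fun x t _ => hd x t)).2
  simp only [setIntegral_comp_add] at h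
  have h2 := h.unique (hasDerivAt_const _ _)
  rw [mean_def, h2, mul_zero]

theorem eq_zero_of_mean_sq {f : PerSm b} (h : mean (f * f) = 0) : f = 0 := by
  have h1 : ∫ x in ZSpan.fundamentalDomain b, f x * f x = 0 := by
    have := (mul_eq_zero.1 h).resolve_left (inv_ne_zero torusVol_pos.ne')
    simpa using this
  rw [integral_eq_zero_iff_of_nonneg (f := fun x => f x * f x) (fun x => mul_self_nonneg (f x))
    (f * f).integrable, EventuallyEq, ae_iff, Measure.restrict_apply'] at h1
  · have hD := ZSpan.isAddFundamentalDomain' b (volume : Measure (Rn n))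
    have : Countable (Submodule.span ℤ (Set.range b)).toAddSubgroup :=
      inferInstanceAs (Countable (Submodule.span ℤ (Set.range b)))
    have h2 := hD.measure_zero_of_invariant _ ?_ h1
    · have h3 : (fun x => f x * f x) =ᵐ[volume] fun _ => 0 := by
        rw [EventuallyEq, ae_iff]; exact h2
      have h4 := (Continuous.ae_eq_iff_eq volume (f.continuous.mul f.continuous)
        continuous_const).1 h3
      ext x
      simpa using congrFun h4 x
    · intro g
      ext x
      rw [Set.mem_vadd_set_iff_neg_vadd_mem]
      have : f (-g +ᵥ x) = f x := by
        change f (((-g : _) : Rn n) + x) = f x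
        rw [add_comm]
        exact f.periodic x (-g).2
      simp [this]
  · exact ZSpan.fundamentalDomain_measurableSet b

attribute [irreducible] mean

open ComplexConjugate

/-! ### Fourier series on the torus -/

/-- The linear form on `ℝⁿ` that takes the value `ξᵢ` at the `i`-th basis vector of the lattice: the
frequencies of the torus are the elements of the dual lattice, indexed by `ξ ∈ ℤⁿ`. -/
def freq (b : Module.Basis (Fin n) ℝ (Rn n)) (ξ : Fin n → ℤ) : Rn n →L[ℝ] ℝ :=
  ∑ i, (ξ i : ℝ) • LinearMap.toContinuousLinearMap (b.coord i)

theorem freq_apply (ξ : Fin n → ℤ) (x : Rn n) : freq b ξ x = ∑ i, ξ i * b.repr x i := by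
  simp [freq]

theorem freq_basis (ξ : Fin n → ℤ) (i : Fin n) : freq b ξ (b i) = ξ i := by
  simp [freq_apply, Finsupp.single_apply]

@[simp] theorem freq_zero : freq b 0 = 0 := by simp [freq]

theorem freq_add (ξ η : Fin n → ℤ) : freq b (ξ + η) = freq b ξ + freq b η := by
  simp [freq, add_smul, Finset.sum_add_distrib]

theorem freq_neg (ξ : Fin n → ℤ) : freq b (-ξ) = -freq b ξ := by
  ext x; simp [freq_apply]

theorem exists_int_freq (ξ : Fin n → ℤ) {v : Rn n} (hv : v ∈ Submodule.span ℤ (Set.range b)) :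
    ∃ m : ℤ, freq b ξ v = m := by
  induction hv using Submodule.span_induction with
  | mem x hx => obtain ⟨i, rfl⟩ := hx; exact ⟨ξ i, freq_basis ξ i⟩
  | zero => exact ⟨0, by simp⟩
  | add x y _ _ hx hy =>
    obtain ⟨m, hm⟩ := hx
    obtain ⟨k, hk⟩ := hy
    exact ⟨m + k, by simp [hm, hk]⟩
  | smul a x _ hx =>
    obtain ⟨m, hm⟩ := hx
    exact ⟨a * m, by simp [hm]⟩

/-- The real trigonometric monomial `x ↦ Re (z e^{2πi ξ(x)})`. -/
def trig (ξ : Fin n → ℤ) : ℂ →ₗ[ℝ] PerSm b where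
  toFun z := mk (fun x => z.re * Real.cos (2 * Real.pi * freq b ξ x)
      - z.im * Real.sin (2 * Real.pi * freq b ξ x))
    (by have := (freq b ξ).contDiff (n := ∞); fun_prop) fun x v hv => by
      obtain ⟨m, hm⟩ := exists_int_freq (b := b) ξ hv
      have : 2 * Real.pi * freq b ξ (x + v) = 2 * Real.pi * freq b ξ x + m * (2 * Real.pi) := by
        rw [map_add, hm]; ring
      rw [this, Real.cos_add_int_mul_two_pi, Real.sin_add_int_mul_two_pi]
  map_add' z w := by ext x; simp; ring
  map_smul' c z := by ext x; simp; ring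

theorem trig_apply (ξ : Fin n → ℤ) (z : ℂ) (x : Rn n) :
    trig (b := b) ξ z x = z.re * Real.cos (2 * Real.pi * freq b ξ x)
      - z.im * Real.sin (2 * Real.pi * freq b ξ x) := rfl

theorem trig_zero (z : ℂ) : trig (b := b) 0 z = algebraMap ℝ _ z.re := by
  ext x; simp [trig_apply]

theorem trig_neg (ξ : Fin n → ℤ) (z : ℂ) : trig (b := b) (-ξ) z = trig ξ (conj z) := by
  ext x; simp [trig_apply, freq_neg]

theorem trig_mul_trig (ξ η : Fin n → ℤ) (z w : ℂ) :
    trig (b := b) ξ z * trig η w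
      = (1 / 2 : ℝ) • (trig (ξ + η) (z * w) + trig (ξ - η) (z * conj w)) := by
  ext x
  simp only [mul_apply, smul_apply, add_apply, trig_apply, sub_eq_add_neg ξ η, freq_add, freq_neg,
    _root_.add_apply, _root_.neg_apply, mul_add, mul_neg,
    Real.cos_add, Real.sin_add, Real.cos_neg, Real.sin_neg, Complex.mul_re, Complex.mul_im,
    Complex.conj_re, Complex.conj_im]
  ring

theorem abs_trig_le (ξ : Fin n → ℤ) (z : ℂ) (x : Rn n) : |trig (b := b) ξ z x| ≤ ‖z‖ := by
  have : trig (b := b) ξ z x = (z * Complex.exp ((2 * Real.pi * freq b ξ x : ℝ) * Complex.I)).re := by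
    rw [Complex.mul_re, Complex.exp_ofReal_mul_I_re, Complex.exp_ofReal_mul_I_im, trig_apply]
  rw [this]
  refine (Complex.abs_re_le_norm _).trans ?_
  rw [norm_mul, Complex.norm_exp_ofReal_mul_I, mul_one]

/-- The wave vector `2π ξ`, expressed in the standard coordinates of `ℝⁿ`. -/
def wave (b : Module.Basis (Fin n) ℝ (Rn n)) (ξ : Fin n → ℤ) (i : Fin n) : ℝ :=
  2 * Real.pi * freq b ξ (EuclideanSpace.single i 1)

theorem wave_neg (ξ : Fin n → ℤ) (i : Fin n) : wave b (-ξ) i = -wave b ξ i := by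
  simp [wave, freq_neg]

@[simp] theorem wave_zero (i : Fin n) : wave b 0 i = 0 := by simp [wave]

theorem freq_eq_sum_wave (ξ : Fin n → ℤ) (x : Rn n) :
    2 * Real.pi * freq b ξ x = ∑ i, x i * wave b ξ i := by
  conv_lhs => rw [← (EuclideanSpace.basisFun (Fin n) ℝ).sum_repr x]
  simp only [map_sum, map_smul, smul_eq_mul, Finset.mul_sum, wave]
  refine Finset.sum_congr rfl fun i _ => ?_
  simp
  ring

theorem D_trig (i : Fin n) (ξ : Fin n → ℤ) (z : ℂ) :
    D i (trig (b := b) ξ z) = trig ξ (Complex.I * wave b ξ i * z) := by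
  ext x
  have h0 : HasFDerivAt (fun x => 2 * Real.pi * freq b ξ x) ((2 * Real.pi) • freq b ξ) x :=
    (freq b ξ).hasFDerivAt.const_mul _
  have h := ((h0.cos.const_mul z.re).sub (h0.sin.const_mul z.im)).fderiv
  rw [D_apply]
  change fderiv ℝ (fun x => z.re * Real.cos (2 * Real.pi * freq b ξ x)
      - z.im * Real.sin (2 * Real.pi * freq b ξ x)) x _ = _
  refine (congrArg (fun L => L (EuclideanSpace.single i 1)) h).trans ?_
  simp [trig_apply, wave]
  ring

/-- The Fourier coefficient `ξ` of a function on the torus: the mean of `f e^{-2πi ξ(x)}`. -/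
def fc (ξ : Fin n → ℤ) : PerSm b →ₗ[ℝ] ℂ where
  toFun f := ⟨mean (f * trig ξ 1), mean (f * trig ξ Complex.I)⟩
  map_add' f g := by simp [add_mul, Complex.ext_iff]
  map_smul' c f := by simp [Complex.ext_iff]

theorem mean_mul_trig (f : PerSm b) (ξ : Fin n → ℤ) (w : ℂ) :
    mean (f * trig ξ w) = (conj w * fc ξ f).re := by
  have : trig (b := b) ξ w = w.re • trig ξ 1 + w.im • trig ξ Complex.I := by
    rw [← map_smul, ← map_smul, ← map_add]; congr 1; simp
  rw [this, mul_add, mul_smul_comm, mul_smul_comm, map_add, map_smul, map_smul]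
  simp [fc]

theorem eq_of_forall_re {z w : ℂ} (h : ∀ u : ℂ, (conj u * z).re = (conj u * w).re) : z = w := by
  have h1 := h 1
  have h2 := h Complex.I
  simp at h1 h2
  exact Complex.ext h1 h2

theorem fc_zero_eq (f : PerSm b) : fc 0 f = mean f := by
  refine eq_of_forall_re fun u => ?_
  rw [← mean_mul_trig, trig_zero, mul_comm, ← Algebra.smul_def, map_smul]
  simp

theorem fc_neg (ξ : Fin n → ℤ) (f : PerSm b) : fc (-ξ) f = conj (fc ξ f) := by
  refine eq_of_forall_re fun u => ?_
  rw [← mean_mul_trig, trig_neg, mean_mul_trig]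
  simp

theorem fc_D (i : Fin n) (ξ : Fin n → ℤ) (f : PerSm b) :
    fc ξ (D i f) = Complex.I * wave b ξ i * fc ξ f := by
  refine eq_of_forall_re fun u => ?_
  have h := mean_D i (f * trig ξ u)
  rw [D_mul, map_add, D_trig, mean_mul_trig, mean_mul_trig] at h
  have h3 : (conj (Complex.I * wave b ξ i * u) * fc ξ f).re
      = -(conj u * (Complex.I * wave b ξ i * fc ξ f)).re := by simp; ring
  linarith

theorem fc_trig_mul (ξ η : Fin n → ℤ) (z : ℂ) (g : PerSm b) :
    fc ξ (trig η z * g) = (z * fc (ξ - η) g + conj z * fc (ξ + η) g) / 2 := by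
  refine eq_of_forall_re fun u => ?_
  rw [← mean_mul_trig, mul_right_comm, trig_mul_trig, smul_mul_assoc, map_smul, add_mul, map_add,
    mul_comm _ g, mul_comm _ g, mean_mul_trig, mean_mul_trig, ← neg_sub ξ η, fc_neg, add_comm η ξ]
  simp
  ring

theorem mean_trig (ξ : Fin n → ℤ) (hξ : ξ ≠ 0) (z : ℂ) : mean (trig (b := b) ξ z) = 0 := by
  obtain ⟨i, hi⟩ : ∃ i, wave b ξ i ≠ 0 := by
    by_contra! h
    refine hξ (funext fun j => ?_)
    have h1 := freq_eq_sum_wave (b := b) ξ (b j)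
    simp only [h, mul_zero, Finset.sum_const_zero, freq_basis] at h1
    simpa [Real.pi_ne_zero] using h1
  have h := mean_D i (trig (b := b) ξ ((wave b ξ i : ℂ)⁻¹ * (-Complex.I * z)))
  rw [D_trig] at h
  convert h using 3
  have : (wave b ξ i : ℂ) ≠ 0 := by exact_mod_cast hi
  field_simp
  simp

theorem fc_one (ξ : Fin n → ℤ) : fc ξ (1 : PerSm b) = if ξ = 0 then 1 else 0 := by
  split_ifs with h
  · rw [h, fc_zero_eq]; simp
  · refine eq_of_forall_re fun u => ?_
    rw [← mean_mul_trig, one_mul, mean_trig ξ h]; simp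

theorem fc_trig (ξ η : Fin n → ℤ) (z : ℂ) : fc ξ (trig (b := b) η z)
    = ((if ξ = η then z else 0) + (if ξ = -η then conj z else 0)) / 2 := by
  have h := fc_trig_mul (b := b) ξ η z 1
  rw [mul_one, fc_one, fc_one] at h
  simpa [sub_eq_zero, add_eq_zero_iff_eq_neg] using h

theorem norm_fc_le (ξ : Fin n → ℤ) (f : PerSm b) : ‖fc ξ f‖ ≤ 2 * supN f := by
  have h : ∀ u : ℂ, ‖u‖ = 1 → |(conj u * fc ξ f).re| ≤ supN f := fun u hu => by
    rw [← mean_mul_trig]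
    refine (abs_mean_le _).trans (supN_le fun x => ?_)
    rw [mul_apply, abs_mul]
    exact (mul_le_of_le_one_right (abs_nonneg _) ((abs_trig_le ξ u x).trans hu.le)).trans
      (f.abs_le_supN x)
  have h1 := h 1 (by simp)
  have h2 := h Complex.I (by simp)
  simp at h1 h2
  have := Complex.norm_le_abs_re_add_abs_im (fc ξ f)
  linarith

/-- The `ℓ¹` norm of the wave vector. -/
def wsum (b : Module.Basis (Fin n) ℝ (Rn n)) (ξ : Fin n → ℤ) : ℝ := ∑ i, |wave b ξ i|

theorem wsum_nonneg (ξ : Fin n → ℤ) : 0 ≤ wsum b ξ := Finset.sum_nonneg fun _ _ => abs_nonneg _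

theorem cnorm_trig_le (j : ℕ) (ξ : Fin n → ℤ) (z : ℂ) :
    cnorm j (trig (b := b) ξ z) ≤ (1 + wsum b ξ) ^ j * ‖z‖ := by
  induction j generalizing z with
  | zero => simpa [cnorm] using supN_le (abs_trig_le (b := b) ξ z)
  | succ j ih =>
    rw [cnorm_succ]
    have h : ∀ i, cnorm j (D i (trig (b := b) ξ z)) ≤ (1 + wsum b ξ) ^ j * (|wave b ξ i| * ‖z‖) := by
      intro i
      rw [D_trig]
      simpa using ih (Complex.I * wave b ξ i * z)
    refine (add_le_add (ih z) (Finset.sum_le_sum fun i _ => h i)).trans_eq ?_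
    rw [← Finset.mul_sum, ← Finset.sum_mul]
    change _ + _ * (wsum b ξ * _) = _
    ring

theorem pow_mul_norm_fc_le (j : ℕ) (ξ : Fin n → ℤ) (f : PerSm b) :
    (1 + wsum b ξ) ^ j * ‖fc ξ f‖ ≤ 2 * cnorm j f := by
  induction j generalizing f with
  | zero => simpa [cnorm] using norm_fc_le ξ f
  | succ j ih =>
    rw [cnorm_succ]
    have h : ∀ i, (1 + wsum b ξ) ^ j * (|wave b ξ i| * ‖fc ξ f‖) ≤ 2 * cnorm j (D i f) := by
      intro i
      simpa [fc_D] using ih (D i f)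
    have h2 := add_le_add (ih f) (Finset.sum_le_sum fun i (_ : i ∈ Finset.univ) => h i)
    rw [← Finset.mul_sum, ← Finset.sum_mul, ← mul_add, ← Finset.mul_sum, ← mul_add] at h2
    refine le_trans (le_of_eq ?_) h2
    change _ = _ * (_ + wsum b ξ * _)
    ring

theorem exists_abs_le_wsum (b : Module.Basis (Fin n) ℝ (Rn n)) :
    ∃ C : ℝ, 0 < C ∧ ∀ (ξ : Fin n → ℤ) i, |(ξ i : ℝ)| ≤ C * wsum b ξ := by
  refine ⟨1 + ∑ i, ‖b i‖, by positivity, fun ξ i => ?_⟩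
  have h1 := freq_eq_sum_wave (b := b) ξ (b i)
  rw [freq_basis] at h1
  have h2 : |∑ j, b i j * wave b ξ j| ≤ ‖b i‖ * wsum b ξ := by
    refine (Finset.abs_sum_le_sum_abs _ _).trans ?_
    rw [wsum, Finset.mul_sum]
    refine Finset.sum_le_sum fun j _ => ?_
    rw [abs_mul]
    exact mul_le_mul_of_nonneg_right (PiLp.norm_apply_le (b i) j) (abs_nonneg _)
  have h3 : ‖b i‖ ≤ ∑ i, ‖b i‖ :=
    Finset.single_le_sum (f := fun i => ‖b i‖) (fun _ _ => norm_nonneg _) (Finset.mem_univ i)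
  rw [← h1, abs_mul, abs_of_pos Real.two_pi_pos] at h2
  have h4 : |(ξ i : ℝ)| ≤ 2 * Real.pi * |(ξ i : ℝ)| := by
    have := Real.two_le_pi
    exact le_mul_of_one_le_left (abs_nonneg _) (by linarith)
  have h5 := mul_le_mul_of_nonneg_right h3 (wsum_nonneg (b := b) ξ)
  have := wsum_nonneg (b := b) ξ
  linarith

theorem exists_summable_wsum (b : Module.Basis (Fin n) ℝ (Rn n)) :
    ∃ q : ℕ, Summable fun ξ : Fin n → ℤ => ((1 + wsum b ξ) ^ q)⁻¹ := by
  obtain ⟨C, hC, h⟩ := exists_abs_le_wsum b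
  let B := Pi.basisFun ℝ (Fin n)
  let L := Submodule.span ℤ (Set.range B)
  let e : (Fin n → ℤ) ≃ L := (B.restrictScalars ℤ).equivFun.symm.toEquiv
  have he : ∀ ξ : Fin n → ℤ, ((e ξ : L) : Fin n → ℝ) = fun i => (ξ i : ℝ) := by
    intro ξ
    have : ((e ξ : L) : Fin n → ℝ) = ∑ i, ξ i • B i := by
      simp [e, Module.Basis.equivFun_symm_apply, L]
    rw [this]
    ext i
    simp [B, Pi.single_apply]
  refine ⟨Module.finrank ℤ L + 1, ?_⟩
  have hs := e.summable_iff.2 (ZLattice.summable_norm_pow_inv L _ (Nat.lt_succ_self _))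
  refine Summable.of_norm_bounded_eventually (hs.mul_left (C ^ (Module.finrank ℤ L + 1))) ?_
  refine (Set.finite_singleton (0 : Fin n → ℤ)).subset fun ξ hξ => ?_
  by_contra h0
  refine hξ ?_
  have hpos : 0 < ‖e ξ‖ := by
    rw [norm_pos_iff]
    intro h1
    refine h0 (funext fun i => ?_)
    have h2 := congrFun (he ξ) i
    rw [h1] at h2
    simpa using h2.symm
  have hle : ‖e ξ‖ ≤ C * (1 + wsum b ξ) := by
    rw [Submodule.coe_norm, he, pi_norm_le_iff_of_nonneg]
    · intro i
      exact (h ξ i).trans (mul_le_mul_of_nonneg_left (by linarith) hC.le)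
    · have := wsum_nonneg (b := b) ξ; positivity
  have hw : 0 < 1 + wsum b ξ := by have := wsum_nonneg (b := b) ξ; positivity
  change ‖((1 + wsum b ξ) ^ (Module.finrank ℤ L + 1))⁻¹‖
    ≤ C ^ (Module.finrank ℤ L + 1) * ‖e ξ‖⁻¹ ^ (Module.finrank ℤ L + 1)
  rw [Real.norm_of_nonneg (by positivity)]
  rw [inv_pow, ← div_eq_mul_inv, inv_eq_one_div, div_le_div_iff₀ (by positivity) (by positivity),
    one_mul, ← mul_pow]
  gcongr

attribute [irreducible] trig fc wave

theorem hasSum_fc {ι : Type*} [Countable ι] {F : ι → PerSm b} {S : PerSm b}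
    (hF : Summable fun i => supN (F i)) (hS : ∀ x, HasSum (fun i => F i x) (S x))
    (ξ : Fin n → ℤ) : HasSum (fun i => fc ξ (F i)) (fc ξ S) := by
  have key : ∀ z : ℂ, HasSum (fun i => mean (F i * trig ξ z)) (mean (S * trig ξ z)) := by
    intro z
    refine hasSum_mean (Summable.of_nonneg_of_le (fun i => isAlgNorm_supN.nonneg _)
      (fun i => isAlgNorm_supN.mul_le _ _) (hF.mul_right _)) fun x => ?_
    simpa using (hS x).mul_right (trig ξ z x)
  have h1 := key 1
  have h2 := key Complex.I
  simp only [mean_mul_trig] at h1 h2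
  rw [Complex.hasSum_iff]
  exact ⟨by simpa using h1, by simpa using h2⟩

theorem summable_cnorm_trig_fc (f : PerSm b) (m : (Fin n → ℤ) → ℂ) {C : ℝ}
    (hm : ∀ ξ, ‖m ξ‖ ≤ C) (j : ℕ) :
    Summable fun ξ => cnorm j (trig (b := b) ξ (m ξ * fc ξ f)) := by
  obtain ⟨q, hq⟩ := exists_summable_wsum b
  refine Summable.of_nonneg_of_le (fun ξ => (isAlgNorm_cnorm j).nonneg _) (fun ξ => ?_)
    (hq.mul_left (C * (2 * cnorm (j + q) f)))
  refine (cnorm_trig_le j ξ _).trans ?_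
  have h0 : 0 < 1 + wsum b ξ := by have := wsum_nonneg (b := b) ξ; positivity
  have h1 := pow_mul_norm_fc_le (j + q) ξ f
  rw [← div_eq_mul_inv, le_div_iff₀ (by positivity), norm_mul]
  calc (1 + wsum b ξ) ^ j * (‖m ξ‖ * ‖fc ξ f‖) * (1 + wsum b ξ) ^ q
      = ‖m ξ‖ * ((1 + wsum b ξ) ^ (j + q) * ‖fc ξ f‖) := by ring
    _ ≤ C * (2 * cnorm (j + q) f) :=
      mul_le_mul (hm ξ) h1 (by positivity) ((norm_nonneg _).trans (hm ξ))

/-- Fourier multipliers: a bounded symbol `m` with `m (-ξ) = conj (m ξ)` defines a real operator on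
`C^∞(Tⁿ)`. -/
theorem exists_multiplier (m : (Fin n → ℤ) → ℂ) {C : ℝ} (hm : ∀ ξ, ‖m ξ‖ ≤ C)
    (hm' : ∀ ξ, m (-ξ) = conj (m ξ)) (f : PerSm b) :
    ∃ S : PerSm b, (∀ ξ, fc ξ S = m ξ * fc ξ f) ∧
      ∀ x, HasSum (fun ξ => trig (b := b) ξ (m ξ * fc ξ f) x) (S x) := by
  have hs := summable_cnorm_trig_fc f m hm
  obtain ⟨S, hS⟩ := exists_hasSum (fun ξ => trig (b := b) ξ (m ξ * fc ξ f)) hs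
  refine ⟨S, fun ξ => ?_, fun x => (hS x).1⟩
  have h1 := hasSum_fc (hs 0) (fun x => (hS x).1) ξ
  have h2 : HasSum (fun η => fc ξ (trig (b := b) η (m η * fc η f)))
      ((m ξ * fc ξ f + conj (m (-ξ) * fc (-ξ) f)) / 2) := by
    simp only [fc_trig]
    refine HasSum.div_const (HasSum.add ?_ ?_) 2
    · have e : (fun η => if ξ = η then m η * fc η f else 0)
          = fun η => if η = ξ then m ξ * fc ξ f else 0 := by
        funext η
        by_cases h : ξ = η
        · subst h; simp
        · simp [h, Ne.symm h]
      rw [e]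
      exact hasSum_ite_eq ξ _
    · have e : (fun η => if ξ = -η then conj (m η * fc η f) else 0)
          = fun η => if η = -ξ then conj (m (-ξ) * fc (-ξ) f) else 0 := by
        funext η
        by_cases h : ξ = -η
        · subst h; simp
        · have h' : η ≠ -ξ := fun h1 => h (by rw [h1, neg_neg])
          simp [h, h']
      rw [e]
      exact hasSum_ite_eq (-ξ) _
  rw [h1.unique h2, hm', fc_neg]
  simp

/-- The quotient map from `ℝⁿ` to the standard torus, in the coordinates of the lattice basis. -/
def toUnitTorus (b : Module.Basis (Fin n) ℝ (Rn n)) (x : Rn n) : UnitAddTorus (Fin n) :=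
  fun i => (b.repr x i : UnitAddCircle)

theorem isQuotientMap_toUnitTorus : Topology.IsQuotientMap (toUnitTorus b) := by
  have h1 : IsOpenQuotientMap (Pi.map fun (_ : Fin n) (x : ℝ) => (x : UnitAddCircle)) :=
    IsOpenQuotientMap.piMap fun _ => QuotientAddGroup.isOpenQuotientMap_mk
  exact h1.isQuotientMap.comp
    b.equivFun.toContinuousLinearEquiv.toHomeomorph.isQuotientMap

theorem eq_of_toUnitTorus_eq (f : PerSm b) {x y : Rn n} (h : toUnitTorus b x = toUnitTorus b y) :
    f x = f y := by
  have h1 : ∀ i, ∃ m : ℤ, b.repr y i - b.repr x i = m := fun i => by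
    have h2 := congrFun h i
    obtain ⟨m, hm⟩ := AddSubgroup.mem_zmultiples_iff.1 (QuotientAddGroup.eq_iff_sub_mem.1 h2.symm)
    exact ⟨m, by simpa using hm.symm⟩
  choose m hm using h1
  have h3 : y = x + ∑ i, m i • b i := by
    refine b.repr.injective (Finsupp.ext fun i => ?_)
    have := hm i
    simp [Finsupp.single_apply]
    linarith
  rw [h3, f.periodic]
  exact Submodule.sum_mem _ fun i _ => Submodule.smul_mem _ _ (Submodule.subset_span ⟨i, rfl⟩)

theorem mFourier_toUnitTorus (ξ : Fin n → ℤ) (z : ℂ) (x : Rn n) :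
    (z * UnitAddTorus.mFourier ξ (toUnitTorus b x)).re = trig (b := b) ξ z x := by
  have h : UnitAddTorus.mFourier ξ (toUnitTorus b x)
      = Complex.exp ((2 * Real.pi * freq b ξ x : ℝ) * Complex.I) := by
    simp only [UnitAddTorus.mFourier, ContinuousMap.coe_mk, toUnitTorus, fourier_coe_apply,
      ← Complex.exp_sum, freq_apply]
    congr 1
    push_cast
    rw [Finset.mul_sum, Finset.sum_mul]
    refine Finset.sum_congr rfl fun i _ => ?_
    simp; ring
  rw [h, Complex.mul_re, Complex.exp_ofReal_mul_I_re, Complex.exp_ofReal_mul_I_im, trig_apply]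

/-- A smooth function on the torus is determined by its Fourier coefficients (by density of the
trigonometric polynomials). -/
theorem eq_zero_of_fc (f : PerSm b) (h : ∀ ξ, fc ξ f = 0) : f = 0 := by
  have hF : ∃ F : C(UnitAddTorus (Fin n), ℂ), ∀ x, F (toUnitTorus b x) = f x := by
    let fC : C(Rn n, ℂ) := ⟨fun x => (f x : ℂ), Complex.continuous_ofReal.comp f.continuous⟩
    let p : C(Rn n, UnitAddTorus (Fin n)) := ⟨toUnitTorus b, isQuotientMap_toUnitTorus.continuous⟩
    have hp : Topology.IsQuotientMap p := isQuotientMap_toUnitTorus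
    have hfp : Function.FactorsThrough fC p := fun x y hxy => by
      simp [fC, f.eq_of_toUnitTorus_eq hxy]
    exact ⟨hp.lift fC hfp, fun x => ContinuousMap.congr_fun (hp.lift_comp fC hfp) x⟩
  obtain ⟨F, hF⟩ := hF
  have hP : ∀ P ∈ Submodule.span ℂ (Set.range (UnitAddTorus.mFourier (d := Fin n))),
      ∀ z : ℂ, ∃ p : PerSm b, (∀ x, p x = (z * P (toUnitTorus b x)).re) ∧ mean (f * p) = 0 := by
    intro P hP
    induction hP using Submodule.span_induction with
    | mem P hP =>
      obtain ⟨ξ, rfl⟩ := hP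
      intro z
      refine ⟨trig ξ z, fun x => (mFourier_toUnitTorus ξ z x).symm, ?_⟩
      rw [mean_mul_trig, h]; simp
    | zero => exact fun z => ⟨0, fun x => by simp, by simp⟩
    | add P Q _ _ hP hQ =>
      intro z
      obtain ⟨p, hp, hp'⟩ := hP z
      obtain ⟨q, hq, hq'⟩ := hQ z
      exact ⟨p + q, fun x => by simp [hp, hq]; ring, by simp [mul_add, hp', hq']⟩
    | smul c P _ hP =>
      intro z
      obtain ⟨p, hp, hp'⟩ := hP (z * c)
      exact ⟨p, fun x => by rw [hp]; simp [mul_assoc], hp'⟩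
  have hF' : F ∈ (Submodule.span ℂ (Set.range (UnitAddTorus.mFourier (d := Fin n)))).topologicalClosure := by
    rw [UnitAddTorus.span_mFourier_closure_eq_top]; trivial
  refine eq_zero_of_mean_sq (abs_nonpos_iff.1 (le_of_forall_pos_le_add fun ε hε => ?_))
  have hε' : 0 < ε / (supN f + 1) := by
    have := isAlgNorm_supN.nonneg f; positivity
  obtain ⟨P, hPm, hPd⟩ := Metric.mem_closure_iff.1 hF' _ hε'
  obtain ⟨p, hp, hp'⟩ := hP P hPm 1
  have h1 : mean (f * f) = mean (f * (f - p)) := by rw [mul_sub, map_sub, hp', sub_zero]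
  have h2 : supN (f - p) ≤ ε / (supN f + 1) := supN_le fun x => by
    have h3 := (ContinuousMap.dist_apply_le_dist (f := F) (g := P) (toUnitTorus b x)).trans hPd.le
    rw [Complex.dist_eq, hF] at h3
    have h4 : (f - p) x = (↑(f x) - P (toUnitTorus b x)).re := by simp [hp]
    rw [h4]
    exact (Complex.abs_re_le_norm _).trans h3
  rw [h1, zero_add]
  refine (abs_mean_le _).trans ((isAlgNorm_supN.mul_le _ _).trans ?_)
  have h0 := isAlgNorm_supN.nonneg f
  calc supN f * supN (f - p) ≤ (supN f + 1) * (ε / (supN f + 1)) :=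
        mul_le_mul (by linarith) h2 (isAlgNorm_supN.nonneg _) (by positivity)
    _ = ε := by field_simp

theorem ext_fc {f g : PerSm b} (h : ∀ ξ, fc ξ f = fc ξ g) : f = g :=
  sub_eq_zero.1 (eq_zero_of_fc _ fun ξ => by rw [map_sub, h, sub_self])

theorem hasSum_trig_fc (f : PerSm b) (x : Rn n) : HasSum (fun ξ => trig (b := b) ξ (fc ξ f) x) (f x) := by
  obtain ⟨S, hS, hS'⟩ := exists_multiplier (fun _ => 1) (C := 1) (by simp) (by simp) f
  have : S = f := ext_fc fun ξ => by simp [hS]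
  simpa [this] using hS' x

/-! ### The Wiener norm -/

/-- The Wiener norm: the sum of the absolute values of the Fourier coefficients. -/
def wiener (f : PerSm b) : ℝ := ∑' ξ, ‖fc ξ f‖

theorem exists_norm_fc_le (b : Module.Basis (Fin n) ℝ (Rn n)) : ∃ (q : ℕ) (w : (Fin n → ℤ) → ℝ),
    Summable w ∧ ∀ (f : PerSm b) ξ, ‖fc ξ f‖ ≤ w ξ * cnorm q f := by
  obtain ⟨q, hq⟩ := exists_summable_wsum b
  refine ⟨q, _, hq.mul_left 2, fun f ξ => ?_⟩
  have h0 : 0 < 1 + wsum b ξ := by have := wsum_nonneg (b := b) ξ; positivity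
  have h1 := pow_mul_norm_fc_le q ξ f
  rw [mul_right_comm, ← div_eq_mul_inv, le_div_iff₀ (by positivity), mul_comm]
  exact h1

theorem summable_fc (f : PerSm b) : Summable fun ξ => ‖fc ξ f‖ := by
  obtain ⟨q, w, hw, h⟩ := exists_norm_fc_le b
  exact Summable.of_nonneg_of_le (fun _ => norm_nonneg _) (h f) (hw.mul_right _)

theorem exists_wiener_le (b : Module.Basis (Fin n) ℝ (Rn n)) :
    ∃ (q : ℕ) (C : ℝ), 0 ≤ C ∧ ∀ f : PerSm b, wiener f ≤ C * cnorm q f := by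
  obtain ⟨q, w, hw, h⟩ := exists_norm_fc_le b
  refine ⟨q, |∑' ξ, w ξ|, abs_nonneg _, fun f => ?_⟩
  refine ((summable_fc f).tsum_le_tsum (h f) (hw.mul_right _)).trans ?_
  rw [tsum_mul_right]
  exact mul_le_mul_of_nonneg_right (le_abs_self _) ((isAlgNorm_cnorm q).nonneg f)

theorem supN_le_wiener (f : PerSm b) : supN f ≤ wiener f := supN_le fun x => by
  have h := hasSum_trig_fc f x
  rw [← h.tsum_eq]
  have h2 : Summable fun ξ => ‖trig (b := b) ξ (fc ξ f) x‖ :=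
    Summable.of_nonneg_of_le (fun _ => norm_nonneg _) (fun ξ => abs_trig_le ξ _ x) (summable_fc f)
  exact (norm_tsum_le_tsum_norm h2).trans
    (h2.tsum_le_tsum (fun ξ => abs_trig_le ξ _ x) (summable_fc f))

theorem hasSum_fc_sub (η : Fin n → ℤ) (g : PerSm b) :
    HasSum (fun ξ => ‖fc (ξ - η) g‖) (wiener g) :=
  ((Equiv.subRight η).hasSum_iff (f := fun ξ => ‖fc ξ g‖)).2 (summable_fc g).hasSum

theorem hasSum_fc_add (η : Fin n → ℤ) (g : PerSm b) :
    HasSum (fun ξ => ‖fc (ξ + η) g‖) (wiener g) :=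
  ((Equiv.addRight η).hasSum_iff (f := fun ξ => ‖fc ξ g‖)).2 (summable_fc g).hasSum

theorem norm_fc_trig_mul_le (ξ η : Fin n → ℤ) (z : ℂ) (g : PerSm b) :
    ‖fc ξ (trig η z * g)‖ ≤ ‖z‖ / 2 * (‖fc (ξ - η) g‖ + ‖fc (ξ + η) g‖) := by
  rw [fc_trig_mul, norm_div, Complex.norm_ofNat]
  have := norm_add_le (z * fc (ξ - η) g) (conj z * fc (ξ + η) g)
  rw [norm_mul, norm_mul, Complex.norm_conj] at this
  linarith

theorem wiener_trig_mul_le (η : Fin n → ℤ) (z : ℂ) (g : PerSm b) :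
    wiener (trig η z * g) ≤ ‖z‖ * wiener g := by
  have h := hasSum_le (fun ξ => norm_fc_trig_mul_le ξ η z g) (summable_fc (trig η z * g)).hasSum
    (((hasSum_fc_sub η g).add (hasSum_fc_add η g)).mul_left (‖z‖ / 2))
  refine h.trans_eq ?_
  ring

theorem tsum_swap_le {ι : Type*} (K : ι → ι → ℝ) (hK : ∀ i j, 0 ≤ K i j)
    (hs : ∀ i, Summable (K i)) {w : ι → ℝ} (hw : Summable w) (hle : ∀ i, ∑' j, K i j ≤ w i) :
    (∀ j, Summable fun i => K i j) ∧ Summable (fun j => ∑' i, K i j) ∧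
      ∑' j, ∑' i, K i j ≤ ∑' i, w i := by
  have hsum : Summable fun p : ι × ι => K p.1 p.2 :=
    (summable_prod_of_nonneg fun p => hK p.1 p.2).2
      ⟨hs, Summable.of_nonneg_of_le (fun i => tsum_nonneg (hK i)) hle hw⟩
  have hsum' : Summable fun p : ι × ι => K p.2 p.1 := (Equiv.prodComm ι ι).summable_iff.2 hsum
  refine ⟨fun j => hsum'.prod_factor j, hsum'.prod, ?_⟩
  rw [Summable.tsum_comm (f := K) hsum]
  exact hsum.prod.tsum_le_tsum hle hw

theorem isAlgNorm_wiener : IsAlgNorm (wiener (b := b)) where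
  nonneg f := tsum_nonneg fun _ => norm_nonneg _
  add_le f g := by
    rw [wiener, wiener, wiener, ← (summable_fc f).tsum_add (summable_fc g)]
    exact (summable_fc _).tsum_le_tsum (fun ξ => by rw [map_add]; exact norm_add_le _ _)
      ((summable_fc f).add (summable_fc g))
  smul_le c f := by
    simp only [wiener, map_smul, norm_smul, Real.norm_eq_abs, tsum_mul_left]
    exact le_rfl
  mul_le f g := by
    have hs : ∀ ξ, HasSum (fun η => fc ξ (trig η (fc η f) * g)) (fc ξ (f * g)) := fun ξ => by
      refine hasSum_fc ?_ (fun x => by simpa using (hasSum_trig_fc f x).mul_right (g x)) ξ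
      refine Summable.of_nonneg_of_le (fun _ => isAlgNorm_supN.nonneg _) (fun η => ?_)
        ((summable_fc f).mul_right (supN g))
      exact (isAlgNorm_supN.mul_le _ _).trans (mul_le_mul_of_nonneg_right
        (supN_le (abs_trig_le η _)) (isAlgNorm_supN.nonneg _))
    obtain ⟨h1, h2, h3⟩ := tsum_swap_le (fun η ξ => ‖fc ξ (trig (b := b) η (fc η f) * g)‖)
      (fun _ _ => norm_nonneg _) (fun η => summable_fc _) ((summable_fc f).mul_right (wiener g))
      (fun η => wiener_trig_mul_le η _ g)
    refine ((summable_fc (f * g)).tsum_le_tsum (fun ξ => ?_) h2).trans (h3.trans_eq tsum_mul_right)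
    rw [← (hs ξ).tsum_eq]
    exact norm_tsum_le_tsum_norm (h1 ξ)
  one_le := by
    rw [wiener, tsum_eq_single 0]
    · simp [fc_one]
    · intro ξ h; simp [fc_one, h]

/-! ### The Green operator of the first order system `(curl, div)` -/

/-- The square of the Euclidean norm of the wave vector. -/
def waveSq (b : Module.Basis (Fin n) ℝ (Rn n)) (ξ : Fin n → ℤ) : ℝ := ∑ i, wave b ξ i ^ 2

theorem wave_sq_le (ξ : Fin n → ℤ) (i : Fin n) : wave b ξ i ^ 2 ≤ waveSq b ξ :=
  Finset.single_le_sum (f := fun i => wave b ξ i ^ 2) (fun _ _ => sq_nonneg _) (Finset.mem_univ i)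

theorem abs_wave_mul_le (ξ : Fin n → ℤ) (i j : Fin n) :
    |wave b ξ i| * |wave b ξ j| ≤ waveSq b ξ := by
  have h1 := wave_sq_le (b := b) ξ i
  have h2 := wave_sq_le (b := b) ξ j
  rw [← sq_abs] at h1 h2
  nlinarith [sq_nonneg (|wave b ξ i| - |wave b ξ j|)]

theorem exists_one_le_wsum (b : Module.Basis (Fin n) ℝ (Rn n)) :
    ∃ C : ℝ, 0 < C ∧ ∀ ξ : Fin n → ℤ, ξ ≠ 0 → 1 ≤ C * wsum b ξ := by
  obtain ⟨C, hC, h⟩ := exists_abs_le_wsum b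
  refine ⟨C, hC, fun ξ hξ => ?_⟩
  obtain ⟨i, hi⟩ := Function.ne_iff.1 hξ
  refine le_trans ?_ (h ξ i)
  exact_mod_cast Int.one_le_abs hi

theorem waveSq_ne_zero {ξ : Fin n → ℤ} (hξ : ξ ≠ 0) : waveSq b ξ ≠ 0 := by
  intro h
  obtain ⟨C, hC, hw⟩ := exists_one_le_wsum b
  have h2 : ∀ i, wave b ξ i = 0 := fun i =>
    pow_eq_zero_iff two_ne_zero |>.1 (le_antisymm ((wave_sq_le ξ i).trans h.le) (sq_nonneg _))
  have := hw ξ hξ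
  simp [wsum, h2] at this
  linarith

/-- The symbol of `∂ⱼ Δ⁻¹`; it vanishes at `ξ = 0` because there it is `0 / 0`. -/
def greenSymbol (b : Module.Basis (Fin n) ℝ (Rn n)) (j : Fin n) (ξ : Fin n → ℤ) : ℂ :=
  -(Complex.I * wave b ξ j / waveSq b ξ)

theorem exists_norm_greenSymbol_le (b : Module.Basis (Fin n) ℝ (Rn n)) :
    ∃ C : ℝ, ∀ j ξ, ‖greenSymbol b j ξ‖ ≤ C := by
  obtain ⟨C, hC, h⟩ := exists_one_le_wsum b
  refine ⟨n * C, fun j ξ => ?_⟩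
  have hn : ‖greenSymbol b j ξ‖ = |wave b ξ j| / waveSq b ξ := by
    have : 0 ≤ waveSq b ξ := Finset.sum_nonneg fun _ _ => sq_nonneg _
    simp [greenSymbol, abs_of_nonneg this]
  by_cases hξ : ξ = 0
  · subst hξ; simp [greenSymbol]; positivity
  have hpos : 0 < waveSq b ξ := lt_of_le_of_ne (Finset.sum_nonneg fun _ _ => sq_nonneg _)
    (waveSq_ne_zero hξ).symm
  rw [hn, div_le_iff₀ hpos]
  have h1 : |wave b ξ j| ≤ wsum b ξ :=
    Finset.single_le_sum (f := fun i => |wave b ξ i|) (fun _ _ => abs_nonneg _) (Finset.mem_univ j)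
  have h2 : wsum b ξ ^ 2 ≤ n * waveSq b ξ := by
    have := sq_sum_le_card_mul_sum_sq (s := (Finset.univ : Finset (Fin n)))
      (f := fun i => |wave b ξ i|)
    simpa [wsum, waveSq] using this
  have h3 := h ξ hξ
  have h4 := wsum_nonneg (b := b) ξ
  calc |wave b ξ j| ≤ wsum b ξ * 1 := by linarith
    _ ≤ wsum b ξ * (C * wsum b ξ) := mul_le_mul_of_nonneg_left h3 h4
    _ = C * wsum b ξ ^ 2 := by ring
    _ ≤ C * (n * waveSq b ξ) := mul_le_mul_of_nonneg_left h2 hC.le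
    _ = n * C * waveSq b ξ := by ring

theorem exists_green (j : Fin n) (f : PerSm b) :
    ∃ S : PerSm b, ∀ ξ, fc ξ S = greenSymbol b j ξ * fc ξ f := by
  obtain ⟨C, hC⟩ := exists_norm_greenSymbol_le b
  have hneg : ∀ ξ, waveSq b (-ξ) = waveSq b ξ := fun ξ => by simp [waveSq, wave_neg]
  obtain ⟨S, hS, -⟩ := exists_multiplier (greenSymbol b j) (hC j)
    (fun ξ => by simp [greenSymbol, wave_neg, hneg, neg_div]) f
  exact ⟨S, hS⟩

/-- The operator `∂ⱼ Δ⁻¹` on `C^∞(Tⁿ)`, where `Δ⁻¹` is the inverse of the Laplacian on functions of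
mean zero, extended by `0` to the constants. -/
def green (j : Fin n) : PerSm b →ₗ[ℝ] PerSm b where
  toFun f := (exists_green j f).choose
  map_add' f g := ext_fc fun ξ => by
    rw [map_add, (exists_green j _).choose_spec, (exists_green j _).choose_spec,
      (exists_green j _).choose_spec, map_add, mul_add]
  map_smul' c f := ext_fc fun ξ => by
    rw [map_smul, (exists_green j _).choose_spec, (exists_green j _).choose_spec, map_smul,
      mul_smul_comm, RingHom.id_apply]

theorem fc_green (j : Fin n) (ξ : Fin n → ℤ) (f : PerSm b) :
    fc ξ (green j f) = greenSymbol b j ξ * fc ξ f := (exists_green j f).choose_spec ξ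

attribute [irreducible] green

theorem D_green (i j : Fin n) (f : PerSm b) : D i (green j f) = green j (D i f) :=
  ext_fc fun ξ => by rw [fc_D, fc_green, fc_green, fc_D]; ring

theorem D_green_comm (i j : Fin n) (f : PerSm b) : D i (green j f) = D j (green i f) :=
  ext_fc fun ξ => by rw [fc_D, fc_green, fc_D, fc_green, greenSymbol, greenSymbol]; ring

theorem fc_algebraMap {ξ : Fin n → ℤ} (hξ : ξ ≠ 0) (c : ℝ) : fc ξ (algebraMap ℝ (PerSm b) c) = 0 := by
  rw [Algebra.algebraMap_eq_smul_one, map_smul, fc_one, if_neg hξ, smul_zero]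

theorem sum_D_green (f : PerSm b) : ∑ j, D j (green j f) = f - algebraMap ℝ _ (mean f) := by
  refine ext_fc fun ξ => ?_
  rw [map_sum, map_sub]
  simp only [fc_D, fc_green, greenSymbol]
  by_cases hξ : ξ = 0
  · subst hξ; simp [fc_zero_eq]
  · have h : (waveSq b ξ : ℂ) ≠ 0 := by exact_mod_cast waveSq_ne_zero hξ
    rw [fc_algebraMap hξ, sub_zero]
    have h2 : ∀ j, Complex.I * wave b ξ j * (-(Complex.I * wave b ξ j / waveSq b ξ) * fc ξ f)
        = (wave b ξ j : ℂ) ^ 2 * (fc ξ f / waveSq b ξ) := fun j => by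
      have := Complex.I_sq
      field_simp
      rw [this]; ring
    simp only [h2]
    rw [← Finset.sum_mul]
    have h3 : ∑ j, (wave b ξ j : ℂ) ^ 2 = waveSq b ξ := by simp [waveSq]
    rw [h3]
    field_simp

/-- The operator `(∂ᵢsⱼ - ∂ⱼsᵢ, div s) ↦ s - mean s`. -/
theorem green_curl_div (s : Fin n → PerSm b) (j : Fin n) :
    green j (∑ i, D i (s i)) + ∑ i, green i (D i (s j) - D j (s i))
      = s j - algebraMap ℝ _ (mean (s j)) := by
  have h1 : ∑ i, green i (D i (s j)) = s j - algebraMap ℝ _ (mean (s j)) := by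
    rw [← sum_D_green]; exact Finset.sum_congr rfl fun i _ => (D_green i i _).symm
  have h2 : green j (∑ i, D i (s i)) = ∑ i, green i (D j (s i)) := by
    rw [map_sum]
    exact Finset.sum_congr rfl fun i _ => by rw [← D_green, D_green_comm, D_green]
  simp only [map_sub, Finset.sum_sub_distrib, h1, h2]
  abel

/-- The operator that inverts `(curl, div)` is injective on pairs of an exact 2-form and a function of
mean zero, which are the pairs in the range of `(curl, div)`. -/
theorem eq_zero_of_green {f : PerSm b} (hf : mean f = 0) (β : Fin n → PerSm b)
    (h : ∀ j, green j f + ∑ i, green i (D i (β j) - D j (β i)) = 0) :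
    f = 0 ∧ ∀ i j, D i (β j) - D j (β i) = 0 := by
  have h1 : ∀ j, ∃ c : ℝ, β j = green j (∑ i, D i (β i) - f) + algebraMap ℝ _ c := fun j => by
    refine ⟨mean (β j), ?_⟩
    have h2 := green_curl_div β j
    have h3 := h j
    rw [map_sub]
    linear_combination (-1 : PerSm b) * h2 + h3
  choose c hc using h1
  have h2 : ∀ i j, D i (β j) - D j (β i) = 0 := fun i j => by
    rw [hc i, hc j]
    simp only [map_add, D_algebraMap, add_zero]
    rw [D_green_comm i j, sub_self]
  refine ⟨?_, h2⟩
  have h3 := sum_D_green f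
  rw [hf, map_zero, sub_zero] at h3
  rw [← h3]
  refine Finset.sum_eq_zero fun j _ => ?_
  have h4 := h j
  simp only [h2, map_zero, Finset.sum_const_zero, add_zero] at h4
  rw [h4, map_zero]

/-- The Riesz transforms `∂ᵢ∂ⱼΔ⁻¹` do not increase `ν`. -/
def RieszBounded (ν : PerSm b → ℝ) : Prop := ∀ i j f, ν (D i (green j f)) ≤ ν f

theorem rieszBounded_wiener : RieszBounded (wiener (b := b)) := by
  intro i j f
  refine (summable_fc _).tsum_le_tsum (fun ξ => ?_) (summable_fc f)
  rw [fc_D, fc_green, ← mul_assoc, norm_mul]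
  refine mul_le_of_le_one_left (norm_nonneg _) ?_
  have h0 : 0 ≤ waveSq b ξ := Finset.sum_nonneg fun _ _ => sq_nonneg _
  simp only [greenSymbol, norm_mul, norm_neg, norm_div, Complex.norm_I, one_mul, Complex.norm_real,
    Real.norm_eq_abs, abs_of_nonneg h0]
  rw [← mul_div_assoc]
  exact div_le_one_of_le₀ (abs_wave_mul_le ξ i j) h0

theorem RieszBounded.raise {ν : PerSm b → ℝ} (h : RieszBounded ν) {ε : ℝ} (hε : 0 ≤ ε) :
    RieszBounded (raise ε ν) := by
  intro i j f
  refine add_le_add (h i j f) (mul_le_mul_of_nonneg_left (Finset.sum_le_sum fun l _ => ?_) hε)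
  rw [D_comm, D_green l j]
  exact h i j _

theorem RieszBounded.iterate_raise {ν : PerSm b → ℝ} (h : RieszBounded ν) {ε : ℝ} (hε : 0 ≤ ε)
    (j : ℕ) : RieszBounded ((PerSm.raise ε)^[j] ν) := by
  induction j with
  | zero => exact h
  | succ j ih => rw [Function.iterate_succ_apply']; exact ih.raise hε

theorem exists_wiener_le_sum_D (b : Module.Basis (Fin n) ℝ (Rn n)) :
    ∃ C : ℝ, 0 < C ∧ ∀ f : PerSm b, mean f = 0 → wiener f ≤ C * ∑ i, wiener (D i f) := by
  obtain ⟨C, hC, h⟩ := exists_one_le_wsum b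
  refine ⟨C, hC, fun f hf => ?_⟩
  have h1 : ∑ i, wiener (D i f) = ∑' ξ, wsum b ξ * ‖fc ξ f‖ := by
    simp only [wiener]
    rw [← Summable.tsum_finsetSum fun i _ => summable_fc _]
    refine tsum_congr fun ξ => ?_
    rw [wsum, Finset.sum_mul]
    exact Finset.sum_congr rfl fun i _ => by rw [fc_D]; simp
  have hs : Summable fun ξ => wsum b ξ * ‖fc ξ f‖ := by
    have := summable_sum (s := Finset.univ) fun i (_ : i ∈ Finset.univ) => summable_fc (D i f)
    refine this.congr fun ξ => ?_
    rw [wsum, Finset.sum_mul]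
    exact Finset.sum_congr rfl fun i _ => by rw [fc_D]; simp
  rw [h1, ← tsum_mul_left]
  refine (summable_fc f).tsum_le_tsum (fun ξ => ?_) (hs.mul_left C)
  by_cases hξ : ξ = 0
  · subst hξ; simp [fc_zero_eq, hf]
  · rw [← mul_assoc]; exact le_mul_of_one_le_left (norm_nonneg _) (h ξ hξ)

theorem mean_green (j : Fin n) (f : PerSm b) : mean (green j f) = 0 := by
  have h := fc_green j 0 f
  rw [fc_zero_eq] at h
  simpa [greenSymbol] using h

end PerSm

/-! ### Composition with smooth coefficient functions -/

/-- A smooth function on `Tⁿ × ℝⁿ`, given on the universal cover. -/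
structure Coef (b : Module.Basis (Fin n) ℝ (Rn n)) where
  toFun : Tan n → ℝ
  smooth : ContDiff ℝ ∞ toFun
  periodic : ∀ (z : Tan n), ∀ v ∈ Submodule.span ℤ (Set.range b), toFun (z.1 + v, z.2) = toFun z

namespace Coef

instance : CoeFun (Coef b) (fun _ => Tan n → ℝ) := ⟨toFun⟩

theorem differentiable (a : Coef b) : Differentiable ℝ a := a.smooth.differentiable (by simp)

/-- The partial derivative of a coefficient function. -/
def pd (i : Fin n ⊕ Fin n) (a : Coef b) : Coef b where
  toFun := TorusCY.pd i a
  smooth := (a.smooth.fderiv_right (m := ∞) (by simp)).clm_apply contDiff_const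
  periodic z v hv := by
    have h : (fun w => a (w + (v, 0))) = a := funext fun w => by
      have e : w + (v, 0) = (w.1 + v, w.2) := by ext <;> simp
      rw [e]
      exact a.periodic w v hv
    have h2 := fderiv_comp_add_right (𝕜 := ℝ) (f := a) (x := z) ((v, 0) : Tan n)
    rw [h] at h2
    have h3 : z + (v, 0) = (z.1 + v, z.2) := by ext <;> simp
    rw [TorusCY.pd, TorusCY.pd, h2, h3]

theorem pd_apply (i : Fin n ⊕ Fin n) (a : Coef b) (z : Tan n) :
    pd i a z = fderiv ℝ a z (frame n i) := rfl

/-- All partial derivatives of `a` up to order `M` are bounded by `B`. -/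
def Bd : ℕ → Coef b → ℝ → Prop
  | 0, a, B => ∀ z, |a z| ≤ B
  | M + 1, a, B => Bd M a B ∧ ∀ i, Bd M (pd i a) B

theorem Bd.of_le {M M' : ℕ} {a : Coef b} {B : ℝ} (h : Bd M a B) (hM : M' ≤ M) : Bd M' a B := by
  induction hM with
  | refl => exact h
  | step _ ih => exact ih h.1

theorem Bd.nonneg {M : ℕ} {a : Coef b} {B : ℝ} (h : Bd M a B) : 0 ≤ B :=
  (abs_nonneg _).trans (h.of_le (Nat.zero_le M) 0)

end Coef

theorem frame_inl (i : Fin n) : frame n (Sum.inl i) = (EuclideanSpace.single i 1, 0) := by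
  simp [frame]

theorem frame_inr (i : Fin n) : frame n (Sum.inr i) = (0, EuclideanSpace.single i 1) := by
  simp [frame]

theorem sum_smul_single (y : Fin n → ℝ) :
    ∑ l, y l • EuclideanSpace.single l (1 : ℝ) = (WithLp.toLp 2 y : Rn n) := by
  ext j
  simp [Finset.sum_apply, Pi.single_apply]

namespace PerSm

/-- The map `Tⁿ → ℝⁿ` with components `s`. -/
def toVec (s : Fin n → PerSm b) (x : Rn n) : Rn n := WithLp.toLp 2 fun j => s j x

@[simp] theorem toVec_apply (s : Fin n → PerSm b) (x : Rn n) (j : Fin n) :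
    toVec s x j = s j x := rfl

theorem contDiff_toVec (s : Fin n → PerSm b) : ContDiff ℝ ∞ (toVec s) :=
  (contDiff_piLp (p := 2)).2 fun j => (s j).smooth

/-- The graph `x ↦ (x, s(x))`. -/
def graph (s : Fin n → PerSm b) (x : Rn n) : Tan n := (x, toVec s x)

theorem contDiff_graph (s : Fin n → PerSm b) : ContDiff ℝ ∞ (graph s) :=
  contDiff_id.prodMk (contDiff_toVec s)

theorem fderiv_graph (s : Fin n → PerSm b) (x : Rn n) (i : Fin n) :
    fderiv ℝ (graph s) x (EuclideanSpace.single i 1)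
      = (EuclideanSpace.single i 1, toVec (fun l => D i (s l)) x) := by
  have h1 : HasFDerivAt (toVec s) (fderiv ℝ (toVec s) x) x :=
    ((contDiff_toVec s).differentiable (by simp) x).hasFDerivAt
  have h2 := ((hasFDerivAt_id x).prodMk h1).fderiv
  change fderiv ℝ (fun x => (x, toVec s x)) x _ = _
  refine (congrArg (fun L => L (EuclideanSpace.single i 1)) h2).trans ?_
  refine Prod.ext rfl ?_
  ext l
  have h3 := ((EuclideanSpace.proj (𝕜 := ℝ) l : Rn n →L[ℝ] ℝ).hasFDerivAt.comp x h1).fderiv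
  exact (congrArg (fun L => L (EuclideanSpace.single i 1)) h3).symm

theorem fderiv_graph_eq_frame (s : Fin n → PerSm b) (x : Rn n) (i : Fin n) :
    fderiv ℝ (graph s) x (EuclideanSpace.single i 1)
      = frame n (Sum.inl i) + ∑ l, D i (s l) x • frame n (Sum.inr l) := by
  rw [fderiv_graph]
  simp only [frame_inl, frame_inr, Prod.smul_mk, smul_zero]
  refine Prod.ext ?_ ?_
  · simp [Prod.fst_sum]
  · rw [Prod.snd_add, Prod.snd_sum, zero_add]
    exact (sum_smul_single fun l => D i (s l) x).symm

/-- The function `x ↦ a (x, s(x))`. -/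
def comp (a : Coef b) (s : Fin n → PerSm b) : PerSm b :=
  mk (fun x => a (graph s x)) (a.smooth.comp (contDiff_graph s)) fun x v hv => by
    have : toVec s (x + v) = toVec s x := by
      simp only [toVec, (s _).periodic x hv]
    simpa [graph, this] using a.periodic (graph s x) v hv

theorem comp_apply (a : Coef b) (s : Fin n → PerSm b) (x : Rn n) : comp a s x = a (graph s x) := rfl

theorem D_comp (i : Fin n) (a : Coef b) (s : Fin n → PerSm b) :
    D i (comp a s) = comp (a.pd (Sum.inl i)) s + ∑ l, comp (a.pd (Sum.inr l)) s * D i (s l) := by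
  ext x
  have h := fderiv_comp x (a.differentiable (graph s x))
    ((contDiff_graph s).differentiable (by simp) x)
  have h1 : D i (comp a s) x = fderiv ℝ (a.toFun ∘ graph s) x (EuclideanSpace.single i 1) := rfl
  rw [h1, h, ContinuousLinearMap.comp_apply, fderiv_graph_eq_frame, map_add, map_sum]
  simp only [map_smul, add_apply, sum_apply, mul_apply, comp_apply, Coef.pd_apply, smul_eq_mul,
    mul_comm]

theorem supN_comp_sub_le {a : Coef b} {B : ℝ} (h : Coef.Bd 1 a B) (s₁ s₂ : Fin n → PerSm b) {Δ : ℝ}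
    (hs : ∀ l, supN (s₁ l - s₂ l) ≤ Δ) : supN (comp a s₁ - comp a s₂) ≤ n * B * Δ := by
  refine supN_le fun x => ?_
  set w : Fin n → ℝ := fun l => s₁ l x - s₂ l x
  let p : ℝ → Tan n := fun t => graph s₂ x + t • ((0 : Rn n), (WithLp.toLp 2 w : Rn n))
  have hp : ∀ t, HasDerivAt p ((0 : Rn n), (WithLp.toLp 2 w : Rn n)) t := fun t => by
    have := ((hasDerivAt_id t).smul_const ((0 : Rn n), (WithLp.toLp 2 w : Rn n))).const_add
      (graph s₂ x)
    rwa [one_smul] at this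
  have hd : ∀ t, HasDerivAt (fun t => a (p t)) (∑ l, w l * a.pd (Sum.inr l) (p t)) t := fun t => by
    have := (a.differentiable (p t)).hasFDerivAt.comp_hasDerivAt t (hp t)
    refine this.congr_deriv ?_
    have e : ((0 : Rn n), (WithLp.toLp 2 w : Rn n)) = ∑ l, w l • frame n (Sum.inr l) := by
      simp only [frame_inr, Prod.smul_mk, smul_zero]
      refine Prod.ext ?_ ?_
      · simp [Prod.fst_sum]
      · rw [Prod.snd_sum]; exact (sum_smul_single w).symm
    rw [e, map_sum]
    exact Finset.sum_congr rfl fun l _ => by rw [map_smul, smul_eq_mul, Coef.pd_apply]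
  have hb : ∀ t, ‖∑ l, w l * a.pd (Sum.inr l) (p t)‖ ≤ n * B * Δ := fun t => by
    refine (norm_sum_le _ _).trans ?_
    have : ∀ l ∈ Finset.univ, ‖w l * a.pd (Sum.inr l) (p t)‖ ≤ B * Δ := fun l _ => by
      rw [norm_mul, mul_comm]
      exact mul_le_mul (h.2 _ _) ((abs_le_supN (s₁ l - s₂ l) x).trans (hs l)) (norm_nonneg _)
        h.nonneg
    refine (Finset.sum_le_card_nsmul _ _ _ this).trans_eq ?_
    simp [mul_assoc]
  have h1 := norm_image_sub_le_of_norm_deriv_le_segment_01' (f := fun t => a (p t))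
    (fun t _ => (hd t).hasDerivWithinAt) (fun t _ => hb t)
  have e1 : p 1 = graph s₁ x := by
    refine Prod.ext ?_ ?_
    · simp [p, graph]
    · ext l; simp [p, graph, w]
  have e0 : p 0 = graph s₂ x := by simp [p]
  rw [e1, e0] at h1
  exact h1

/-! ### Estimates for the composition operator -/

/-- Sections whose first derivatives are at most `1` in the norm `Q`. -/
def Adm (Q : PerSm b → ℝ) (s : Fin n → PerSm b) : Prop := ∀ i l, Q (D i (s l)) ≤ 1

/-- Two sections are at distance at most `Δ`: in the supremum norm, and in the norm `Q` for the first
derivatives. -/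
structure Close (Q : PerSm b → ℝ) (s₁ s₂ : Fin n → PerSm b) (Δ : ℝ) : Prop where
  nonneg : 0 ≤ Δ
  sup : ∀ l, supN (s₁ l - s₂ l) ≤ Δ
  deriv : ∀ i l, Q (D i (s₁ l - s₂ l)) ≤ Δ

/-- The map `s ↦ a(x, s(x))` is bounded by `K` and has Lipschitz constant `K` in the norm `ν`, on
sections controlled by `Q`. -/
def Est (ν Q : PerSm b → ℝ) (a : Coef b) (K : ℝ) : Prop :=
  (∀ s, Adm Q s → ν (comp a s) ≤ K) ∧
    ∀ s₁ s₂ Δ, Adm Q s₁ → Adm Q s₂ → Close Q s₁ s₂ Δ → ν (comp a s₁ - comp a s₂) ≤ K * Δ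

theorem Adm.of_le {Q Q' : PerSm b → ℝ} (h : ∀ f, Q f ≤ Q' f) {s : Fin n → PerSm b}
    (hs : Adm Q' s) : Adm Q s := fun i l => (h _).trans (hs i l)

theorem Close.of_le {Q Q' : PerSm b → ℝ} (h : ∀ f, Q f ≤ Q' f) {s₁ s₂ : Fin n → PerSm b} {Δ : ℝ}
    (hs : Close Q' s₁ s₂ Δ) : Close Q s₁ s₂ Δ := ⟨hs.1, hs.2, fun i l => (h _).trans (hs.3 i l)⟩

theorem Est.of_le {ν Q Q' : PerSm b → ℝ} (h : ∀ f, Q f ≤ Q' f) {a : Coef b} {K : ℝ}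
    (he : Est ν Q a K) : Est ν Q' a K :=
  ⟨fun s hs => he.1 s (hs.of_le h), fun s₁ s₂ Δ h₁ h₂ hc =>
    he.2 s₁ s₂ Δ (h₁.of_le h) (h₂.of_le h) (hc.of_le h)⟩

theorem Est.nonneg {ν Q : PerSm b → ℝ} (hν : IsAlgNorm ν) (hQ : IsAlgNorm Q) {a : Coef b} {K : ℝ}
    (he : Est ν Q a K) : 0 ≤ K :=
  (hν.nonneg _).trans (he.1 0 fun i l => by simp [hQ.zero])

theorem est_supN {Q : PerSm b → ℝ} {a : Coef b} {B : ℝ} (h : Coef.Bd 1 a B) :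
    Est supN Q a ((n + 1) * B) := by
  have hB := h.nonneg
  refine ⟨fun s _ => supN_le fun x => (h.1 _).trans ?_, fun s₁ s₂ Δ _ _ hc => ?_⟩
  · nlinarith [mul_nonneg (Nat.cast_nonneg (α := ℝ) n) hB]
  · refine (supN_comp_sub_le h s₁ s₂ hc.sup).trans (mul_le_mul_of_nonneg_right ?_ hc.nonneg)
    linarith

theorem Est.mono {ν Q : PerSm b → ℝ} {a : Coef b} {K K' : ℝ} (h : K ≤ K') (he : Est ν Q a K) :
    Est ν Q a K' :=
  ⟨fun s hs => (he.1 s hs).trans h, fun s₁ s₂ Δ h₁ h₂ hc =>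
    (he.2 s₁ s₂ Δ h₁ h₂ hc).trans (mul_le_mul_of_nonneg_right h hc.nonneg)⟩

/-- The chain rule transfers estimates from `ν` to the norm with one more derivative. -/
theorem Est.raise {ν Q : PerSm b → ℝ} (hν : IsAlgNorm ν) {ε κ K K' : ℝ} (hε : 0 ≤ ε) (hκ : 0 ≤ κ)
    (hνQ : ∀ f, ν f ≤ κ * Q f) {a : Coef b} (ha : Est ν Q a K) (hK' : 0 ≤ K')
    (ha' : ∀ i, Est ν Q (a.pd i) K') :
    Est (raise ε ν) Q a (K + ε * (n * (K' + n * (2 * κ * K')))) := by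
  constructor
  · intro s hs
    refine add_le_add (ha.1 s hs) (mul_le_mul_of_nonneg_left ?_ hε)
    refine (Finset.sum_le_card_nsmul _ _ (K' + n * (2 * κ * K')) fun i _ => ?_).trans_eq (by simp; ring)
    rw [D_comp]
    refine (hν.add_le _ _).trans (add_le_add ((ha' _).1 s hs) ?_)
    refine (hν.sum_le_card _ _ (C := 2 * κ * K') fun l _ => ?_).trans_eq (by simp)
    have h1 : ν (D i (s l)) ≤ κ := (hνQ _).trans (mul_le_of_le_one_right hκ (hs i l))
    have h2 := (ha' (Sum.inr l)).1 s hs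
    have h3 := mul_le_mul h2 h1 (hν.nonneg _) hK'
    have := hν.mul_le (comp (a.pd (Sum.inr l)) s) (D i (s l))
    nlinarith [mul_nonneg hκ hK']
  · intro s₁ s₂ Δ h₁ h₂ hc
    have e : (K + ε * (n * (K' + n * (2 * κ * K')))) * Δ
        = K * Δ + ε * (n * (K' * Δ + n * (2 * κ * K' * Δ))) := by ring
    rw [e]
    refine add_le_add (ha.2 s₁ s₂ Δ h₁ h₂ hc) (mul_le_mul_of_nonneg_left ?_ hε)
    refine (Finset.sum_le_card_nsmul _ _ (K' * Δ + n * (2 * κ * K' * Δ)) fun i _ => ?_).trans_eq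
      (by simp; ring)
    have hΔ := hc.nonneg
    have e2 : D i (comp a s₁ - comp a s₂)
        = (comp (a.pd (Sum.inl i)) s₁ - comp (a.pd (Sum.inl i)) s₂)
          + ∑ l, ((comp (a.pd (Sum.inr l)) s₁ - comp (a.pd (Sum.inr l)) s₂) * D i (s₁ l)
            + comp (a.pd (Sum.inr l)) s₂ * D i (s₁ l - s₂ l)) := by
      simp only [map_sub, D_comp, mul_sub, sub_mul, Finset.sum_add_distrib, Finset.sum_sub_distrib]
      ring
    rw [e2]
    refine (hν.add_le _ _).trans (add_le_add ((ha' _).2 s₁ s₂ Δ h₁ h₂ hc) ?_)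
    refine (hν.sum_le_card _ _ (C := 2 * κ * K' * Δ) fun l _ => ?_).trans_eq (by simp)
    have h1 : ν (D i (s₁ l)) ≤ κ := (hνQ _).trans (mul_le_of_le_one_right hκ (h₁ i l))
    have h2 : ν (D i (s₁ l - s₂ l)) ≤ κ * Δ := (hνQ _).trans (mul_le_mul_of_nonneg_left (hc.deriv i l) hκ)
    have h3 := (hν.mul_le _ _).trans (mul_le_mul ((ha' (Sum.inr l)).2 s₁ s₂ Δ h₁ h₂ hc) h1
      (hν.nonneg _) (mul_nonneg hK' hΔ))
    have h4 := (hν.mul_le _ _).trans (mul_le_mul ((ha' (Sum.inr l)).1 s₂ h₂) h2 (hν.nonneg _) hK')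
    have := hν.add_le ((comp (a.pd (Sum.inr l)) s₁ - comp (a.pd (Sum.inr l)) s₂) * D i (s₁ l))
      (comp (a.pd (Sum.inr l)) s₂ * D i (s₁ l - s₂ l))
    linarith

/-- Uniform composition estimates in `ν`: the constant is linear in the size of finitely many
derivatives of the coefficient. -/
def UnifEst (ν Q : PerSm b → ℝ) : Prop :=
  ∃ (M : ℕ) (C : ℝ), 0 ≤ C ∧ ∀ (a : Coef b) (B : ℝ), Coef.Bd M a B → Est ν Q a (C * B)

theorem unifEst_supN (Q : PerSm b → ℝ) : UnifEst supN Q :=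
  ⟨1, n + 1, by positivity, fun _ _ h => est_supN h⟩

theorem UnifEst.raise {ν Q : PerSm b → ℝ} (hν : IsAlgNorm ν) {κ : ℝ} (hκ : 0 ≤ κ)
    (hνQ : ∀ f, ν f ≤ κ * Q f) (h : UnifEst ν Q) : UnifEst (raise 1 ν) Q := by
  obtain ⟨M, C, hC, h⟩ := h
  refine ⟨M + 1, C + 1 * (n * (C + n * (2 * κ * C))), by positivity, fun a B hB => ?_⟩
  have := (h a B hB.1).raise hν zero_le_one hκ hνQ (mul_nonneg hC hB.1.nonneg)
    fun i => h _ B (hB.2 i)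
  convert this using 1
  ring

theorem UnifEst.of_le {ν μ Q : PerSm b → ℝ} {c : ℝ} (hc : 0 ≤ c) (hνμ : ∀ f, ν f ≤ c * μ f)
    (h : UnifEst μ Q) : UnifEst ν Q := by
  obtain ⟨M, C, hC, h⟩ := h
  refine ⟨M, c * C, by positivity, fun a B hB => ⟨fun s hs => ?_, fun s₁ s₂ Δ h₁ h₂ hcl => ?_⟩⟩
  · rw [mul_assoc]
    exact (hνμ _).trans (mul_le_mul_of_nonneg_left ((h a B hB).1 s hs) hc)
  · rw [mul_assoc, mul_assoc, ← mul_assoc C]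
    exact (hνμ _).trans (mul_le_mul_of_nonneg_left ((h a B hB).2 s₁ s₂ Δ h₁ h₂ hcl) hc)

/-- The Wiener norm of the derivatives up to order `q`. -/
def wienerC (q : ℕ) : PerSm b → ℝ := (PerSm.raise 1)^[q] wiener

theorem isAlgNorm_wienerC (q : ℕ) : IsAlgNorm (wienerC (b := b) q) :=
  isAlgNorm_wiener.iterate_raise zero_le_one q

theorem wienerC_succ (q : ℕ) : wienerC (b := b) (q + 1) = PerSm.raise 1 (wienerC q) :=
  Function.iterate_succ_apply' _ _ _

theorem wienerC_mono {q q' : ℕ} (h : q ≤ q') (f : PerSm b) : wienerC q f ≤ wienerC q' f := by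
  induction h with
  | refl => exact le_rfl
  | step _ ih =>
    rw [Nat.succ_eq_add_one, wienerC_succ]
    exact ih.trans ((isAlgNorm_wienerC _).le_raise zero_le_one f)

theorem cnorm_le_wienerC (q : ℕ) (f : PerSm b) : cnorm q f ≤ wienerC q f := by
  simpa [cnorm, wienerC] using iterate_raise_mono (C := 1) zero_le_one
    (fun f => by simpa using supN_le_wiener f) q f

/-- For `q` large, composition with a coefficient function acts on sections with `q` derivatives in the
Wiener algebra: up to order `q`, the chain rule is used in the supremum norm, which controls the Wiener
norm; then it is used again in the Wiener norm. -/
theorem exists_unifEst_wienerC (b : Module.Basis (Fin n) ℝ (Rn n)) :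
    ∃ q : ℕ, UnifEst (wienerC (b := b) q) (wienerC q) := by
  obtain ⟨q, C, hC, h⟩ := exists_wiener_le b
  have h1 : ∀ j ≤ q, UnifEst (cnorm (b := b) j) (wienerC q) := by
    intro j
    induction j with
    | zero => exact fun _ => unifEst_supN _
    | succ j ih =>
      intro hj
      have := (ih (by omega)).raise (isAlgNorm_cnorm j) zero_le_one fun f => by
        rw [one_mul]
        exact (cnorm_le_wienerC j f).trans (wienerC_mono (by omega) f)
      rwa [show cnorm (b := b) (j + 1) = PerSm.raise 1 (cnorm j) from
        Function.iterate_succ_apply' _ _ _]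
  have h2 : ∀ j ≤ q, UnifEst (wienerC (b := b) j) (wienerC q) := by
    intro j
    induction j with
    | zero => exact fun _ => (h1 q le_rfl).of_le hC h
    | succ j ih =>
      intro hj
      have := (ih (by omega)).raise (isAlgNorm_wienerC j) zero_le_one fun f => by
        rw [one_mul]
        exact wienerC_mono (by omega) f
      rwa [wienerC_succ]
  exact ⟨q, h2 q le_rfl⟩

/-- The norm `Q`, with `m` further derivatives of weight `ε`. As `ε → 0` it approaches `Q`; this
makes smallness in `Q` alone sufficient for contraction estimates with any number of derivatives. -/
def lev (Q : PerSm b → ℝ) (m : ℕ) (ε : ℝ) : PerSm b → ℝ := (PerSm.raise ε)^[m] Q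

theorem lev_succ (Q : PerSm b → ℝ) (m : ℕ) (ε : ℝ) : lev Q (m + 1) ε = PerSm.raise ε (lev Q m ε) :=
  Function.iterate_succ_apply' _ _ _

/-- Further derivatives enter the composition estimate with a factor `ε` only: `C * B` depends on
`M` derivatives of the coefficient, and the constant `K`, which depends on all of them, is multiplied
by `ε`. -/
theorem exists_est_lev {Q : PerSm b → ℝ} (hQ : IsAlgNorm Q) {M : ℕ} {C : ℝ}
    (h : ∀ (a : Coef b) (B : ℝ), Coef.Bd M a B → Est Q Q a (C * B)) (m : ℕ) (a : Coef b) (B : ℝ)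
    (hB : Coef.Bd M a B) (ha : ∀ M', ∃ B', Coef.Bd M' a B') :
    ∃ K : ℝ, 0 ≤ K ∧ ∀ ε, 0 ≤ ε → ε ≤ 1 → Est (lev Q m ε) (lev Q m ε) a (C * B + ε * K) := by
  induction m generalizing a B with
  | zero => exact ⟨0, le_rfl, fun ε _ _ => by simpa [lev] using h a B hB⟩
  | succ m ih =>
    obtain ⟨K, hK, hKe⟩ := ih a B hB ha
    have h1 : ∀ i, ∃ K' : ℝ, 0 ≤ K' ∧ ∀ ε, 0 ≤ ε → ε ≤ 1 →
        Est (lev Q m ε) (lev Q m ε) (a.pd i) K' := fun i => by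
      obtain ⟨B', hB'⟩ := ha (M + 1)
      obtain ⟨K', hK', hKe'⟩ := ih (a.pd i) B' (hB'.2 i) fun M' => by
        obtain ⟨B'', hB''⟩ := ha (M' + 1)
        exact ⟨B'', hB''.2 i⟩
      refine ⟨|C * B'| + K', by positivity, fun ε hε hε1 => ?_⟩
      exact (hKe' ε hε hε1).mono (add_le_add (le_abs_self _) (mul_le_of_le_one_left hK' hε1))
    choose K' hK' hKe' using h1
    have hS : 0 ≤ ∑ i, K' i := Finset.sum_nonneg fun i _ => hK' i
    refine ⟨K + n * (∑ i, K' i + n * (2 * 1 * ∑ i, K' i)), by positivity, fun ε hε hε1 => ?_⟩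
    have hm := hQ.iterate_raise hε m
    have h2 := (hKe ε hε hε1).raise hm hε zero_le_one (fun f => (one_mul _).ge) hS fun i =>
      (hKe' i ε hε hε1).mono (Finset.single_le_sum (fun i _ => hK' i) (Finset.mem_univ i))
    rw [lev_succ]
    refine (h2.of_le (hm.le_raise hε)).mono (le_of_eq ?_)
    ring

/-! ### The nonlinear operator -/

/-- The derivatives of `s` are at most `δ` in the norm `ν`. -/
def SmallD (ν : PerSm b → ℝ) (δ : ℝ) (s : Fin n → PerSm b) : Prop := ∀ i j, ν (D i (s j)) ≤ δ

/-- The coordinates of the tangent vector `∂ᵢ(x, s(x))` of the graph of `s` in the coordinate frame. -/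
def entry (s : Fin n → PerSm b) (i : Fin n) : Fin n ⊕ Fin n → PerSm b
  | Sum.inl j => if i = j then 1 else 0
  | Sum.inr j => D i (s j)

/-- A product of coordinates of tangent vectors of the graph of `s`. -/
def monom {N : ℕ} (s : Fin n → PerSm b) (u : Fin N → Fin n) (J : Fin N → Fin n ⊕ Fin n) : PerSm b :=
  ∏ k, entry s (u k) (J k)

/-- At least two of the indices `J` are vertical. -/
def Multi {N : ℕ} (J : Fin N → Fin n ⊕ Fin n) : Prop :=
  ∃ k l, k ≠ l ∧ (J k).isRight = true ∧ (J l).isRight = true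

section Monomials

variable {ν : PerSm b → ℝ} (hν : IsAlgNorm ν) {δ Δ : ℝ} {s s₁ s₂ : Fin n → PerSm b}
include hν

theorem IsAlgNorm.prod_le_one {ι : Type*} (S : Finset ι) {x : ι → PerSm b}
    (hx : ∀ k ∈ S, ν (x k) ≤ 1) : ν (∏ k ∈ S, x k) ≤ 1 := by
  classical
  induction S using Finset.induction_on with
  | empty => simpa using hν.one_le
  | insert k S hk ih =>
    rw [Finset.prod_insert hk]
    exact (hν.mul_le _ _).trans (mul_le_one₀ (hx k (Finset.mem_insert_self k S)) (hν.nonneg _)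
      (ih fun l hl => hx l (Finset.mem_insert_of_mem hl)))

theorem IsAlgNorm.mul_sub_mul_le {x₁ x₂ y₁ y₂ : PerSm b} {A B α β : ℝ} (hx₂ : ν x₂ ≤ A)
    (hy₁ : ν y₁ ≤ B) (hx : ν (x₁ - x₂) ≤ α) (hy : ν (y₁ - y₂) ≤ β) :
    ν (x₁ * y₁ - x₂ * y₂) ≤ α * B + A * β := by
  have e : x₁ * y₁ - x₂ * y₂ = (x₁ - x₂) * y₁ + x₂ * (y₁ - y₂) := by ring
  rw [e]
  refine (hν.add_le _ _).trans (add_le_add ((hν.mul_le _ _).trans ?_) ((hν.mul_le _ _).trans ?_))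
  · exact mul_le_mul hx hy₁ (hν.nonneg _) ((hν.nonneg _).trans hx)
  · exact mul_le_mul hx₂ hy (hν.nonneg _) ((hν.nonneg _).trans hx₂)

theorem IsAlgNorm.prod_sub_prod_le {ι : Type*} (S : Finset ι) {x y : ι → PerSm b}
    (hx : ∀ k ∈ S, ν (x k) ≤ 1) (hy : ∀ k ∈ S, ν (y k) ≤ 1) (hxy : ∀ k ∈ S, ν (x k - y k) ≤ Δ) :
    ν (∏ k ∈ S, x k - ∏ k ∈ S, y k) ≤ S.card * Δ := by
  classical
  induction S using Finset.induction_on with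
  | empty => simp [hν.zero]
  | insert k S hk ih =>
    rw [Finset.prod_insert hk, Finset.prod_insert hk, Finset.card_insert_of_notMem hk]
    have h1 := hν.mul_sub_mul_le (hy k (Finset.mem_insert_self k S))
      (hν.prod_le_one S fun l hl => hx l (Finset.mem_insert_of_mem hl))
      (hxy k (Finset.mem_insert_self k S))
      (ih (fun l hl => hx l (Finset.mem_insert_of_mem hl))
        (fun l hl => hy l (Finset.mem_insert_of_mem hl))
        fun l hl => hxy l (Finset.mem_insert_of_mem hl))
    refine h1.trans_eq ?_
    push_cast; ring

theorem entry_le (hδ : δ ≤ 1) (hs : SmallD ν δ s) (i : Fin n) (J : Fin n ⊕ Fin n) :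
    ν (entry s i J) ≤ 1 := by
  rcases J with j | j
  · simp only [entry]
    split_ifs
    · exact hν.one_le
    · rw [hν.zero]; exact zero_le_one
  · exact (hs i j).trans hδ

theorem entry_sub_le (hc : Close ν s₁ s₂ Δ) (i : Fin n) (J : Fin n ⊕ Fin n) :
    ν (entry s₁ i J - entry s₂ i J) ≤ Δ := by
  rcases J with j | j
  · simp only [entry, sub_self, hν.zero]; exact hc.nonneg
  · simp only [entry, ← map_sub]; exact hc.deriv i j

theorem monom_le {N : ℕ} (u : Fin N → Fin n) (J : Fin N → Fin n ⊕ Fin n) (hδ : δ ≤ 1)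
    (hs : SmallD ν δ s) : ν (monom s u J) ≤ 1 :=
  hν.prod_le_one _ fun _ _ => entry_le hν hδ hs _ _

theorem monom_sub_le {N : ℕ} (u : Fin N → Fin n) (J : Fin N → Fin n ⊕ Fin n) (hδ : δ ≤ 1)
    (h₁ : SmallD ν δ s₁) (h₂ : SmallD ν δ s₂) (hc : Close ν s₁ s₂ Δ) :
    ν (monom s₁ u J - monom s₂ u J) ≤ N * Δ := by
  simpa [monom] using hν.prod_sub_prod_le Finset.univ (fun _ _ => entry_le hν hδ h₁ _ _)
    (fun _ _ => entry_le hν hδ h₂ _ _) fun k _ => entry_sub_le hν hc (u k) (J k)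

omit hν in
theorem Multi.exists_monom_eq {N : ℕ} {J : Fin N → Fin n ⊕ Fin n} (hJ : Multi J)
    (u : Fin N → Fin n) : ∃ (k l : Fin N) (i j : Fin n) (S : Finset (Fin N)), S.card ≤ N ∧
      ∀ s : Fin n → PerSm b,
        monom s u J = (D (u k) (s i) * D (u l) (s j)) * ∏ p ∈ S, entry s (u p) (J p) := by
  obtain ⟨k, l, hkl, hk, hl⟩ := hJ
  obtain ⟨i, hi⟩ := Sum.isRight_iff.1 hk
  obtain ⟨j, hj⟩ := Sum.isRight_iff.1 hl
  refine ⟨k, l, i, j, (Finset.univ.erase k).erase l, (Finset.card_le_univ _).trans (by simp),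
    fun s => ?_⟩
  rw [monom, ← Finset.mul_prod_erase _ _ (Finset.mem_univ k),
    ← Finset.mul_prod_erase _ _ (Finset.mem_erase.2 ⟨hkl.symm, Finset.mem_univ l⟩), hi, hj, mul_assoc]
  rfl

theorem monom_le_of_multi {N : ℕ} (u : Fin N → Fin n) {J : Fin N → Fin n ⊕ Fin n} (hJ : Multi J)
    (hδ0 : 0 ≤ δ) (hδ : δ ≤ 1) (hs : SmallD ν δ s) : ν (monom s u J) ≤ δ := by
  obtain ⟨k, l, i, j, S, -, h⟩ := hJ.exists_monom_eq (b := b) u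
  rw [h]
  have h1 := (hν.mul_le (D (u k) (s i)) (D (u l) (s j))).trans
    (mul_le_mul (hs _ _) ((hs _ _).trans hδ) (hν.nonneg _) hδ0)
  refine (hν.mul_le _ _).trans ((mul_le_mul h1
    (hν.prod_le_one S fun _ _ => entry_le hν hδ hs _ _) (hν.nonneg _) (by linarith)).trans ?_)
  simp

/-- The terms that are at least quadratic in the derivatives have a small Lipschitz constant. -/
theorem monom_sub_le_of_multi {N : ℕ} (u : Fin N → Fin n) {J : Fin N → Fin n ⊕ Fin n} (hJ : Multi J)
    (hδ0 : 0 ≤ δ) (hδ : δ ≤ 1) (h₁ : SmallD ν δ s₁) (h₂ : SmallD ν δ s₂) (hc : Close ν s₁ s₂ Δ) :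
    ν (monom s₁ u J - monom s₂ u J) ≤ (N + 2) * (δ * Δ) := by
  obtain ⟨k, l, i, j, S, hS, h⟩ := hJ.exists_monom_eq (b := b) u
  rw [h, h]
  have hd : ∀ i j, ν (D i (s₁ j) - D i (s₂ j)) ≤ Δ := fun i j => by
    rw [← map_sub]; exact hc.deriv i j
  have h3 := hν.mul_sub_mul_le (h₂ (u k) i) (h₁ (u l) j) (hd _ _) (hd _ _)
  have h4 := (hν.mul_le (D (u k) (s₂ i)) (D (u l) (s₂ j))).trans
    (mul_le_mul (h₂ _ _) ((h₂ _ _).trans hδ) (hν.nonneg _) hδ0)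
  have h5 := hν.prod_sub_prod_le S (fun p _ => entry_le hν hδ h₁ (u p) (J p))
    (fun p _ => entry_le hν hδ h₂ (u p) (J p)) fun p _ => entry_sub_le hν hc (u p) (J p)
  have h6 := hν.prod_le_one S fun p _ => entry_le hν hδ h₁ (u p) (J p)
  have h7 := hν.mul_sub_mul_le h4 h6 h3 h5
  have h8 : (S.card : ℝ) ≤ N := by exact_mod_cast hS
  have h9 := mul_le_mul_of_nonneg_right h8 (mul_nonneg hδ0 hc.nonneg)
  refine h7.trans ?_
  linarith

end Monomials

/-- The coefficients `Im (dz₁ ∧ ⋯ ∧ dzₙ)` in the coordinate frame. -/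
def kap (J : Fin n → Fin n ⊕ Fin n) : ℝ := (stdΩ n fun k => frame n (J k)).im

/-- Coefficients, in the coordinate frame, of the deviation of a 2-form and of an `n`-form from the
flat `ω` and `Im Ω`. -/
structure Pert (b : Module.Basis (Fin n) ℝ (Rn n)) where
  two : (Fin 2 → Fin n ⊕ Fin n) → Coef b
  top : (Fin n → Fin n ⊕ Fin n) → Coef b

/-- All coefficients of the perturbation satisfy the composition estimate with constant `K`. -/
def Pert.Est (A : Pert b) (ν : PerSm b → ℝ) (K : ℝ) : Prop :=
  (∀ J, PerSm.Est ν ν (A.two J) K) ∧ ∀ J, PerSm.Est ν ν (A.top J) K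

/-- The negative of the perturbation of `ω`, on the tangent vectors `∂ᵢ`, `∂ⱼ` of the graph of `s`. As
`∑ dxₖ ∧ dyₖ` takes the value `∂ⱼsᵢ - ∂ᵢsⱼ` on them, the Lagrangian condition reads
`∂ᵢsⱼ - ∂ⱼsᵢ = -errTwo A s i j`. -/
def errTwo (A : Pert b) (s : Fin n → PerSm b) (i j : Fin n) : PerSm b :=
  -∑ J, comp (A.two J) s * monom s ![i, j] J

open Classical in
/-- The difference of `Im Ω` on the graph of `s` and its linear part `div s`. -/
def errTop (A : Pert b) (s : Fin n → PerSm b) : PerSm b :=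
  ∑ J, comp (A.top J) s * monom s id J + ∑ J with Multi J, kap J • monom s id J

/-- The special Lagrangian equation for the graph of `s` with mean value `c` reads
`s = c - picard A s`: it is `div s = -errTop`, `curl s = -errTwo`, solved for `s` by means of
`green_curl_div`. -/
def picard (A : Pert b) (s : Fin n → PerSm b) (j : Fin n) : PerSm b :=
  green j (errTop A s) + ∑ i, green i (errTwo A s i j)

theorem mean_picard (A : Pert b) (s : Fin n → PerSm b) (j : Fin n) : mean (picard A s j) = 0 := by
  simp [picard, mean_green, map_sum]

/-- The constant section. -/
def const (c : Rn n) (j : Fin n) : PerSm b := algebraMap ℝ _ (c j)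

theorem D_const (i : Fin n) (c : Rn n) (j : Fin n) : D i (const (b := b) c j) = 0 :=
  D_algebraMap i _

theorem smallD_const {ν : PerSm b → ℝ} (hν : IsAlgNorm ν) {δ : ℝ} (hδ : 0 ≤ δ) (c : Rn n) :
    SmallD ν δ (const c) := fun i j => by rw [D_const, hν.zero]; exact hδ

/-- The dimensional constant in the estimates for `picard`. -/
def picardConst (n : ℕ) : ℝ :=
  (n + 1) * (Fintype.card (Fin n → Fin n ⊕ Fin n) * (n + 1)
    + (∑ J : Fin n → Fin n ⊕ Fin n, |kap J|) * (n + 2)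
    + Fintype.card (Fin 2 → Fin n ⊕ Fin n) * 3)

section Estimates

variable {ν : PerSm b → ℝ} (hν : IsAlgNorm ν) {δ Δ K : ℝ} {s s₁ s₂ : Fin n → PerSm b} {A : Pert b}
include hν

theorem comp_mul_monom_sub_le {a : Coef b} {N : ℕ} (ha : Est ν ν a K) (u : Fin N → Fin n)
    (J : Fin N → Fin n ⊕ Fin n) (hδ : δ ≤ 1) (h₁ : SmallD ν δ s₁) (h₂ : SmallD ν δ s₂)
    (hc : Close ν s₁ s₂ Δ) :
    ν (comp a s₁ * monom s₁ u J - comp a s₂ * monom s₂ u J) ≤ (N + 1) * K * Δ := by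
  have hA₁ : Adm ν s₁ := fun i j => (h₁ i j).trans hδ
  have hA₂ : Adm ν s₂ := fun i j => (h₂ i j).trans hδ
  refine (hν.mul_sub_mul_le (ha.1 s₂ hA₂) (monom_le hν u J hδ h₁) (ha.2 s₁ s₂ Δ hA₁ hA₂ hc)
    (monom_sub_le hν u J hδ h₁ h₂ hc)).trans_eq ?_
  ring

theorem comp_mul_monom_le {a : Coef b} {N : ℕ} (ha : Est ν ν a K) (u : Fin N → Fin n)
    (J : Fin N → Fin n ⊕ Fin n) (hδ : δ ≤ 1) (hs : SmallD ν δ s) :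
    ν (comp a s * monom s u J) ≤ K := by
  have h1 := ha.1 s fun i j => (hs i j).trans hδ
  refine (hν.mul_le _ _).trans ((mul_le_mul h1 (monom_le hν u J hδ hs) (hν.nonneg _)
    ((hν.nonneg _).trans h1)).trans_eq (mul_one K))

theorem D_picard_le (hR : RieszBounded ν) {X : PerSm b} {Y : Fin n → Fin n → PerSm b} {M₁ M₂ : ℝ}
    (hX : ν X ≤ M₁) (hY : ∀ i j, ν (Y i j) ≤ M₂) (l j : Fin n) :
    ν (D l (green j X + ∑ i, green i (Y i j))) ≤ M₁ + n * M₂ := by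
  rw [map_add, map_sum]
  refine (hν.add_le _ _).trans (add_le_add ((hR l j X).trans hX) ?_)
  simpa using hν.sum_le_card Finset.univ (fun i => D l (green i (Y i j)))
    fun i _ => (hR l i _).trans (hY i j)

/-- The Lipschitz constant of the derivative of `picard` is small if the perturbation and the slopes are:
the Riesz transforms that appear in `D i (picard A s j)` are bounded, and the remaining nonlinear terms
are at least quadratic in the slopes. -/
theorem picard_sub_le (hR : RieszBounded ν) (hA : A.Est ν K) (hδ0 : 0 ≤ δ) (hδ : δ ≤ 1)
    (h₁ : SmallD ν δ s₁) (h₂ : SmallD ν δ s₂) (hc : Close ν s₁ s₂ Δ) (i j : Fin n) :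
    ν (D i (picard A s₁ j - picard A s₂ j)) ≤ picardConst n * (K + δ) * Δ := by
  classical
  have hK : 0 ≤ K := (hA.1 fun _ => Sum.inl i).nonneg hν hν
  have hΔ := hc.nonneg
  have e : picard A s₁ j - picard A s₂ j = green j (errTop A s₁ - errTop A s₂)
      + ∑ i, green i (errTwo A s₁ i j - errTwo A s₂ i j) := by
    simp only [picard, map_sub, Finset.sum_sub_distrib]; abel
  rw [e]
  set N₁ : ℝ := (Fintype.card (Fin n → Fin n ⊕ Fin n) : ℝ)
  set N₂ : ℝ := (Fintype.card (Fin 2 → Fin n ⊕ Fin n) : ℝ)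
  set κ : ℝ := ∑ J : Fin n → Fin n ⊕ Fin n, |kap J|
  have hκ : 0 ≤ κ := Finset.sum_nonneg fun _ _ => abs_nonneg _
  have hX : ν (errTop A s₁ - errTop A s₂) ≤ N₁ * ((n + 1) * K * Δ) + κ * ((n + 2) * (δ * Δ)) := by
    have e1 : errTop A s₁ - errTop A s₂
        = ∑ J, (comp (A.top J) s₁ * monom s₁ id J - comp (A.top J) s₂ * monom s₂ id J)
          + ∑ J with Multi J, kap J • (monom s₁ id J - monom s₂ id J) := by
      simp only [errTop, smul_sub, Finset.sum_sub_distrib]; abel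
    rw [e1]
    refine (hν.add_le _ _).trans (add_le_add ?_ ?_)
    · exact hν.sum_le_card _ _ fun J _ => comp_mul_monom_sub_le hν (hA.2 J) id J hδ h₁ h₂ hc
    · refine (hν.sum_le _ _).trans ?_
      rw [Finset.sum_mul]
      refine (Finset.sum_le_sum (g := fun J => |kap J| * ((n + 2) * (δ * Δ)))
        fun J hJ => ?_).trans (Finset.sum_le_sum_of_subset_of_nonneg (Finset.filter_subset _ _)
          fun J _ _ => by positivity)
      exact (hν.smul_le _ _).trans (mul_le_mul_of_nonneg_left
        (monom_sub_le_of_multi hν id (Finset.mem_filter.1 hJ).2 hδ0 hδ h₁ h₂ hc) (abs_nonneg _))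
  have hY : ∀ i j, ν (errTwo A s₁ i j - errTwo A s₂ i j) ≤ N₂ * (3 * K * Δ) := fun i j => by
    have e1 : errTwo A s₁ i j - errTwo A s₂ i j
        = -∑ J, (comp (A.two J) s₁ * monom s₁ ![i, j] J - comp (A.two J) s₂ * monom s₂ ![i, j] J) := by
      simp only [errTwo, Finset.sum_sub_distrib]; abel
    rw [e1, hν.neg]
    refine hν.sum_le_card _ _ fun J _ => ?_
    refine (comp_mul_monom_sub_le hν (hA.1 J) ![i, j] J hδ h₁ h₂ hc).trans_eq ?_
    norm_num
  refine (D_picard_le hν hR hX hY i j).trans ?_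
  have hn : (0 : ℝ) ≤ n := Nat.cast_nonneg n
  have hN₁ : 0 ≤ N₁ := Nat.cast_nonneg _
  have hN₂ : 0 ≤ N₂ := Nat.cast_nonneg _
  have a1 : N₁ * ((n + 1) * K * Δ) ≤ N₁ * ((n + 1) * (K + δ) * Δ) := by gcongr; linarith
  have a2 : κ * ((n + 2) * (δ * Δ)) ≤ κ * ((n + 2) * ((K + δ) * Δ)) := by gcongr; linarith
  have a3 : N₂ * (3 * K * Δ) ≤ N₂ * (3 * (K + δ) * Δ) := by gcongr; linarith
  calc N₁ * ((n + 1) * K * Δ) + κ * ((n + 2) * (δ * Δ)) + n * (N₂ * (3 * K * Δ))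
      ≤ N₁ * ((n + 1) * (K + δ) * Δ) + κ * ((n + 2) * ((K + δ) * Δ))
        + n * (N₂ * (3 * (K + δ) * Δ)) := by gcongr
    _ ≤ picardConst n * (K + δ) * Δ := by
      have : picardConst n * (K + δ) * Δ = (n + 1) * (N₁ * ((n + 1) * (K + δ) * Δ)
        + κ * ((n + 2) * ((K + δ) * Δ)) + N₂ * (3 * (K + δ) * Δ)) := by
        simp only [picardConst]; ring
      rw [this]
      have b1 : 0 ≤ N₁ * ((n + 1) * (K + δ) * Δ) := by positivity
      have b2 : 0 ≤ κ * ((n + 2) * ((K + δ) * Δ)) := by positivity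
      have b3 : 0 ≤ N₂ * (3 * (K + δ) * Δ) := by positivity
      nlinarith [mul_nonneg hn b1, mul_nonneg hn b2]

theorem picard_const_le (hR : RieszBounded ν) (hA : A.Est ν K) (c : Rn n) (i j : Fin n) :
    ν (D i (picard A (const c) j)) ≤ picardConst n * K := by
  classical
  have hK : 0 ≤ K := (hA.1 fun _ => Sum.inl i).nonneg hν hν
  have hs : SmallD ν 0 (const (b := b) c) := smallD_const hν le_rfl c
  set N₁ : ℝ := (Fintype.card (Fin n → Fin n ⊕ Fin n) : ℝ)
  set N₂ : ℝ := (Fintype.card (Fin 2 → Fin n ⊕ Fin n) : ℝ)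
  have hX : ν (errTop A (const c)) ≤ N₁ * K + 0 := by
    refine (hν.add_le _ _).trans (add_le_add ?_ ?_)
    · exact hν.sum_le_card _ _ fun J _ => comp_mul_monom_le hν (hA.2 J) id J zero_le_one hs
    · refine (hν.sum_le _ _).trans (Finset.sum_nonpos fun J hJ => ?_)
      exact (hν.smul_le _ _).trans (mul_nonpos_of_nonneg_of_nonpos (abs_nonneg _)
        (monom_le_of_multi hν id (Finset.mem_filter.1 hJ).2 le_rfl zero_le_one hs))
  have hY : ∀ i j, ν (errTwo A (const c) i j) ≤ N₂ * K := fun i j => by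
    rw [errTwo, hν.neg]
    exact hν.sum_le_card _ _ fun J _ => comp_mul_monom_le hν (hA.1 J) ![i, j] J zero_le_one hs
  refine (D_picard_le hν hR hX hY i j).trans ?_
  have hn : (0 : ℝ) ≤ n := Nat.cast_nonneg n
  have hN₁ : 0 ≤ N₁ * K := by positivity
  have hN₂ : 0 ≤ N₂ * K := by positivity
  have hκ : 0 ≤ (∑ J : Fin n → Fin n ⊕ Fin n, |kap J|) * (n + 2) * K :=
    mul_nonneg (mul_nonneg (Finset.sum_nonneg fun _ _ => abs_nonneg _) (by positivity)) hK
  have : picardConst n * K = (n + 1) * ((n + 1) * (N₁ * K)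
    + (∑ J : Fin n → Fin n ⊕ Fin n, |kap J|) * (n + 2) * K + 3 * (N₂ * K)) := by
    simp only [picardConst]; ring
  rw [this]
  nlinarith [mul_nonneg hn hN₁, mul_nonneg hn hN₂, mul_nonneg hn hκ, mul_nonneg hn (mul_nonneg hn hN₁)]

end Estimates

/-! ### Solving the special Lagrangian equation -/

/-- The Poincaré inequality for functions of mean zero, with the Wiener norm of the derivatives. -/
theorem exists_poincare (b : Module.Basis (Fin n) ℝ (Rn n)) :
    ∃ C : ℝ, 1 ≤ C ∧ ∀ (f : PerSm b) (η : ℝ), 0 ≤ η → mean f = 0 → (∀ i, wiener (D i f) ≤ η) →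
      supN f ≤ C * η := by
  obtain ⟨C, hC, h⟩ := exists_wiener_le_sum_D b
  refine ⟨C * n + 1, le_add_of_nonneg_left (by positivity), fun f η hη hf hD => ?_⟩
  have h1 : ∑ i, wiener (D i f) ≤ n * η := by
    simpa using Finset.sum_le_card_nsmul Finset.univ (fun i => wiener (D i f)) η fun i _ => hD i
  have h2 := mul_le_mul_of_nonneg_left h1 hC.le
  have h3 := (supN_le_wiener f).trans (h f hf)
  linarith

/-- The constant in the Poincaré inequality for functions of mean zero. -/
def poincare (b : Module.Basis (Fin n) ℝ (Rn n)) : ℝ := (exists_poincare b).choose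

theorem one_le_poincare (b : Module.Basis (Fin n) ℝ (Rn n)) : 1 ≤ poincare b :=
  (exists_poincare b).choose_spec.1

theorem supN_le_poincare {f : PerSm b} {η : ℝ} (hη : 0 ≤ η) (hf : mean f = 0)
    (h : ∀ i, wiener (D i f) ≤ η) : supN f ≤ poincare b * η :=
  (exists_poincare b).choose_spec.2 f η hη hf h

/-- The bound on the Lipschitz constant of `picard` that makes the fixed point argument work. -/
def gap (b : Module.Basis (Fin n) ℝ (Rn n)) : ℝ := (4 * poincare b * (n + 1))⁻¹

theorem gap_pos (b : Module.Basis (Fin n) ℝ (Rn n)) : 0 < gap b := by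
  have := one_le_poincare b
  unfold gap
  positivity

theorem gap_mul (b : Module.Basis (Fin n) ℝ (Rn n)) : gap b * poincare b * (n + 1) = 1 / 4 := by
  have h := one_le_poincare b
  have : (n : ℝ) + 1 ≠ 0 := by positivity
  unfold gap
  field_simp

theorem gap_mul_le (b : Module.Basis (Fin n) ℝ (Rn n)) : gap b * poincare b ≤ 1 / 4 := by
  have h := one_le_poincare b
  have h1 : 0 ≤ gap b * poincare b * n := by have := gap_pos b; positivity
  have := gap_mul b
  linarith

/-- The properties of a norm that are used in the fixed point argument. -/
structure Good (ν : PerSm b → ℝ) : Prop where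
  alg : IsAlgNorm ν
  riesz : RieszBounded ν
  wiener_le : ∀ f, wiener f ≤ ν f

/-- The perturbation `A` is small enough for `picard A` to be a contraction in the norm `ν` on the
sections with derivatives at most `δ`. -/
structure Contr (A : Pert b) (ν : PerSm b → ℝ) (δ K : ℝ) : Prop where
  good : Good ν
  est : A.Est ν K
  nonneg : 0 ≤ δ
  le_one : δ ≤ 1
  le_gap : picardConst n * (K + δ) ≤ gap b

theorem norm_le_of_coord {v : Rn n} {η : ℝ} (h : ∀ j, |v j| ≤ η) : ‖v‖ ≤ n * η := by
  have h1 : v = ∑ j, v j • EuclideanSpace.single j (1 : ℝ) := (sum_smul_single fun j => v j).symm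
  rw [h1]
  refine (norm_sum_le _ _).trans ?_
  simpa using Finset.sum_le_card_nsmul Finset.univ (fun j => ‖v j • EuclideanSpace.single j (1 : ℝ)‖) η
    fun j _ => by simpa [norm_smul] using h j

section Contraction

variable {A : Pert b} {ν : PerSm b → ℝ} {δ K : ℝ}

theorem Good.close (h : Good ν) {s₁ s₂ : Fin n → PerSm b} {c₁ c₂ : Rn n} {η : ℝ}
    (h₁ : ∀ j, mean (s₁ j) = c₁ j) (h₂ : ∀ j, mean (s₂ j) = c₂ j) (hη : 0 ≤ η)
    (hD : ∀ i j, ν (D i (s₁ j - s₂ j)) ≤ η) : Close ν s₁ s₂ (‖c₁ - c₂‖ + poincare b * η) := by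
  have h1 := one_le_poincare b
  refine ⟨by positivity, fun j => ?_, fun i j => (hD i j).trans ?_⟩
  · have e : s₁ j - s₂ j = algebraMap ℝ _ ((c₁ - c₂) j)
        + (s₁ j - s₂ j - algebraMap ℝ _ ((c₁ - c₂) j)) := by abel
    rw [e]
    refine (isAlgNorm_supN.add_le _ _).trans (add_le_add
      ((isAlgNorm_supN.algebraMap_le _).trans (PiLp.norm_apply_le (c₁ - c₂) j))
      (supN_le_poincare hη ?_ fun i => ?_))
    · simp [h₁, h₂, mean_algebraMap]
    · rw [map_sub, D_algebraMap, sub_zero]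
      exact (h.wiener_le _).trans (hD i j)
  · nlinarith [norm_nonneg (c₁ - c₂)]

theorem Contr.sub_le (h : Contr A ν δ K) {s₁ s₂ : Fin n → PerSm b} {Δ : ℝ} (h₁ : SmallD ν δ s₁)
    (h₂ : SmallD ν δ s₂) (hc : Close ν s₁ s₂ Δ) (i j : Fin n) :
    ν (D i (picard A s₁ j - picard A s₂ j)) ≤ gap b * Δ :=
  (picard_sub_le h.good.alg h.good.riesz h.est h.nonneg h.le_one h₁ h₂ hc i j).trans
    (mul_le_mul_of_nonneg_right h.le_gap hc.nonneg)

theorem Contr.sub_le_half (h : Contr A ν δ K) {s₁ s₂ : Fin n → PerSm b} {c : Rn n} {η : ℝ}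
    (m₁ : ∀ j, mean (s₁ j) = c j) (m₂ : ∀ j, mean (s₂ j) = c j) (h₁ : SmallD ν δ s₁)
    (h₂ : SmallD ν δ s₂) (hη : 0 ≤ η) (hD : ∀ i j, ν (D i (s₁ j - s₂ j)) ≤ η) (i j : Fin n) :
    ν (D i (picard A s₁ j - picard A s₂ j)) ≤ η / 2 := by
  have h3 := h.good.close m₁ m₂ hη hD
  rw [sub_self, norm_zero, zero_add] at h3
  refine (h.sub_le h₁ h₂ h3 i j).trans ?_
  have := mul_le_mul_of_nonneg_right (gap_mul_le b) hη
  linarith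

/-- `s` solves the special Lagrangian equation with mean value `c`. -/
def IsSol (A : Pert b) (c : Rn n) (s : Fin n → PerSm b) : Prop :=
  ∀ j, s j = const c j - picard A s j

theorem mean_const (c : Rn n) (j : Fin n) : mean (const (b := b) c j) = c j := mean_algebraMap _

theorem IsSol.mean {c : Rn n} {s : Fin n → PerSm b} (h : IsSol A c s) (j : Fin n) :
    mean (s j) = c j := by
  rw [h j, map_sub, mean_picard, sub_zero, mean_const]

/-- Solutions depend on their mean value in a Lipschitz way; in particular they are determined by it. -/
theorem Contr.lipschitz (h : Contr A ν δ K) {s₁ s₂ : Fin n → PerSm b} {c₁ c₂ : Rn n}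
    (e₁ : IsSol A c₁ s₁) (e₂ : IsSol A c₂ s₂) (h₁ : SmallD ν δ s₁) (h₂ : SmallD ν δ s₂) (x : Rn n) :
    ‖(toVec s₁ x - c₁) - (toVec s₂ x - c₂)‖ ≤ ‖c₁ - c₂‖ / 2 := by
  have hP := one_le_poincare b
  have hg := gap_pos b
  obtain ⟨η, hη, hηle, hηex⟩ : ∃ η : ℝ, 0 ≤ η ∧ (∀ i j, ν (D i (s₁ j - s₂ j)) ≤ η) ∧
      (η = 0 ∨ ∃ i j, ν (D i (s₁ j - s₂ j)) = η) := by
    by_cases hn : Nonempty (Fin n)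
    · obtain ⟨p, hp⟩ := exists_eq_ciSup_of_finite
        (f := fun p : Fin n × Fin n => ν (D p.1 (s₁ p.2 - s₂ p.2)))
      refine ⟨ν (D p.1 (s₁ p.2 - s₂ p.2)), h.good.alg.nonneg _, fun i j => ?_, Or.inr ⟨_, _, rfl⟩⟩
      rw [hp]
      exact le_ciSup (f := fun p : Fin n × Fin n => ν (D p.1 (s₁ p.2 - s₂ p.2)))
        (Set.finite_range _).bddAbove (i, j)
    · exact ⟨0, le_rfl, fun i => (hn ⟨i⟩).elim, Or.inl rfl⟩
  have hc := h.good.close e₁.mean e₂.mean hη hηle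
  have key : ∀ i j, ν (D i (s₁ j - s₂ j)) ≤ gap b * (‖c₁ - c₂‖ + poincare b * η) := fun i j => by
    have : D i (s₁ j - s₂ j) = -D i (picard A s₁ j - picard A s₂ j) := by
      conv_lhs => rw [e₁ j, e₂ j]
      simp only [map_sub, D_const]
      abel
    rw [this, h.good.alg.neg]
    exact h.sub_le h₁ h₂ hc i j
  have hη2 : η ≤ 2 * gap b * ‖c₁ - c₂‖ := by
    rcases hηex with h0 | ⟨i, j, hij⟩
    · rw [h0]; positivity
    · have h1 := key i j
      rw [hij] at h1
      have h2 := mul_le_mul_of_nonneg_right (gap_mul_le b) hη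
      linarith
  have hj : ∀ j, |((toVec s₁ x - c₁) - (toVec s₂ x - c₂)) j| ≤ poincare b * η := fun j => by
    have h1 : supN ((s₁ j - s₂ j) - algebraMap ℝ _ (c₁ j - c₂ j)) ≤ poincare b * η := by
      refine supN_le_poincare hη ?_ fun i => ?_
      · simp [e₁.mean, e₂.mean, mean_algebraMap]
      · rw [map_sub, D_algebraMap, sub_zero]
        exact (h.good.wiener_le _).trans (hηle i j)
    refine le_trans (le_of_eq ?_) ((abs_le_supN _ x).trans h1)
    simp only [PiLp.sub_apply, toVec_apply, sub_apply, algebraMap_apply]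
    congr 1
    ring
  have hsum : ‖(toVec s₁ x - c₁) - (toVec s₂ x - c₂)‖ ≤ n * (poincare b * η) := norm_le_of_coord hj
  refine hsum.trans ?_
  have h1 : n * (poincare b * η) ≤ n * (poincare b * (2 * gap b * ‖c₁ - c₂‖)) := by gcongr
  have h2 := gap_mul b
  have h3 : 0 ≤ gap b * poincare b * ‖c₁ - c₂‖ := by positivity
  have h4 : gap b * poincare b * (n + 1) * ‖c₁ - c₂‖ = 1 / 4 * ‖c₁ - c₂‖ := by rw [h2]
  linarith

theorem Contr.unique (h : Contr A ν δ K) {s₁ s₂ : Fin n → PerSm b} {c : Rn n}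
    (e₁ : IsSol A c s₁) (e₂ : IsSol A c s₂) (h₁ : SmallD ν δ s₁) (h₂ : SmallD ν δ s₂) : s₁ = s₂ := by
  funext j
  ext x
  have h3 := h.lipschitz e₁ e₂ h₁ h₂ x
  rw [sub_self, norm_zero, zero_div, norm_le_zero_iff, sub_sub_sub_cancel_right, sub_eq_zero] at h3
  exact congrArg (fun v : Rn n => v j) h3

/-- A solution with small slopes is close to its mean value. -/
theorem IsSol.norm_sub_le {c : Rn n} {s : Fin n → PerSm b} (h : IsSol A c s) (hν : Good ν)
    (hδ : 0 ≤ δ) (hs : SmallD ν δ s) (x : Rn n) : ‖toVec s x - c‖ ≤ n * (poincare b * δ) := by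
  have hj : ∀ j, |(toVec s x - c) j| ≤ poincare b * δ := fun j => by
    have h1 : supN (s j - algebraMap ℝ _ (c j)) ≤ poincare b * δ := by
      refine supN_le_poincare hδ ?_ fun i => ?_
      · simp [h.mean, mean_algebraMap]
      · rw [map_sub, D_algebraMap, sub_zero]
        exact (hν.wiener_le _).trans (hs i j)
    refine le_trans (le_of_eq ?_) ((abs_le_supN _ x).trans h1)
    simp
  exact norm_le_of_coord hj

/-- The Picard iterates. -/
def iter (A : Pert b) (c : Rn n) : ℕ → Fin n → PerSm b
  | 0 => const c
  | l + 1 => fun j => const c j - picard A (iter A c l) j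

theorem mean_iter (c : Rn n) (l : ℕ) (j : Fin n) : PerSm.mean (iter A c l j) = c j := by
  cases l with
  | zero => exact mean_const c j
  | succ l => simp [iter, map_sub, mean_picard, mean_const]

/-- The increments of the Picard iteration decrease geometrically, with ratio `1/2`, and the iterates
keep slopes less than `δ`. -/
theorem Contr.iter_small (h : Contr A ν δ K) (hK : picardConst n * K ≤ δ / 2) (c : Rn n) (l : ℕ) :
    SmallD ν (δ * (1 - (1 / 2) ^ l)) (iter A c l) ∧
      ∀ i j, ν (D i (iter A c (l + 1) j - iter A c l j)) ≤ δ / 2 * (1 / 2) ^ l := by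
  have hδ := h.nonneg
  have hle : ∀ l : ℕ, δ * (1 - (1 / 2) ^ l) ≤ δ := fun l =>
    mul_le_of_le_one_right h.nonneg (by have : (0 : ℝ) ≤ (1 / 2) ^ l := by positivity
                                        linarith)
  have step : ∀ l : ℕ, SmallD ν (δ * (1 - (1 / 2) ^ l)) (iter A c l) →
      (∀ i j, ν (D i (iter A c (l + 1) j - iter A c l j)) ≤ δ / 2 * (1 / 2) ^ l) →
      SmallD ν (δ * (1 - (1 / 2) ^ (l + 1))) (iter A c (l + 1)) := fun l h1 h2 i j => by
    have e : D i (iter A c (l + 1) j) = D i (iter A c l j)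
        + D i (iter A c (l + 1) j - iter A c l j) := by rw [← map_add]; congr 1; abel
    rw [e]
    refine (h.good.alg.add_le _ _).trans ((add_le_add (h1 i j) (h2 i j)).trans_eq ?_)
    ring
  induction l with
  | zero =>
    refine ⟨?_, fun i j => ?_⟩
    · simpa [iter] using smallD_const h.good.alg le_rfl c
    · have e : iter A c 1 j - iter A c 0 j = -picard A (const c) j := by simp [iter]
      rw [zero_add, e, map_neg, h.good.alg.neg, pow_zero, mul_one]
      exact (picard_const_le h.good.alg h.good.riesz h.est c i j).trans hK
  | succ l ih =>
    have h3 := step l ih.1 ih.2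
    refine ⟨h3, fun i j => ?_⟩
    have e : iter A c (l + 1 + 1) j - iter A c (l + 1) j
        = -(picard A (iter A c (l + 1)) j - picard A (iter A c l) j) := by
      simp only [iter]; abel
    rw [e, map_neg, h.good.alg.neg]
    refine (h.sub_le_half (mean_iter c _) (mean_iter c _) (fun i j => (h3 i j).trans (hle _))
      (fun i j => (ih.1 i j).trans (hle _)) (by positivity) ih.2 i j).trans_eq ?_
    ring

end Contraction

/-- The `C^m` norm is controlled by the supremum norm and the `C^m` norm of the first derivatives, which
are the quantities that the contraction estimates bound. -/
theorem cnorm_le_supN_add (m : ℕ) (f : PerSm b) :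
    cnorm m f ≤ supN f + m * ∑ i, cnorm m (D i f) := by
  induction m with
  | zero => simp [cnorm]
  | succ m ih =>
    have h1 : ∑ i, cnorm m (D i f) ≤ ∑ i, cnorm (m + 1) (D i f) :=
      Finset.sum_le_sum fun i _ => (isAlgNorm_cnorm m).le_raise zero_le_one (D i f) |>.trans_eq (by
        simp [cnorm, Function.iterate_succ_apply'])
    have h2 := mul_le_mul_of_nonneg_left h1 (Nat.cast_nonneg (α := ℝ) m)
    rw [cnorm_succ]
    push_cast
    linarith

theorem cnorm_le_tsum (m : ℕ) {F : ℕ → PerSm b} {S : PerSm b}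
    (hF : ∀ j, Summable fun i => cnorm j (F i)) (hS : ∀ x, HasSum (fun i => F i x) (S x)) :
    cnorm m S ≤ ∑' i, cnorm m (F i) := by
  induction m generalizing F S with
  | zero =>
    refine supN_le fun x => ?_
    rw [← (hS x).tsum_eq]
    have h0 : Summable fun i => supN (F i) := hF 0
    exact tsum_of_norm_bounded (f := fun i => F i x) h0.hasSum fun i => (F i).abs_le_supN x
  | succ m ih =>
    obtain ⟨S', h1⟩ := exists_hasSum F hF
    obtain rfl : S' = S := by ext x; exact (h1 x).1.unique (hS x)
    have hD : ∀ l j, Summable fun i => cnorm j (D l (F i)) := fun l j =>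
      (hF (j + 1)).of_nonneg_of_le (fun i => (isAlgNorm_cnorm j).nonneg _) fun i => by
        rw [cnorm_succ]
        exact (Finset.single_le_sum (f := fun l => cnorm j (D l (F i)))
          (fun l _ => (isAlgNorm_cnorm j).nonneg _) (Finset.mem_univ l)).trans
          (le_add_of_nonneg_left ((isAlgNorm_cnorm j).nonneg _))
    simp only [cnorm_succ]
    rw [Summable.tsum_add (hF m) (summable_sum fun l _ => hD l m),
      Summable.tsum_finsetSum fun l _ => hD l m]
    exact add_le_add (ih hF hS) (Finset.sum_le_sum fun l _ => ih (hD l) fun x => (h1 x).2 l)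

/-- Completeness of `C^∞(Tⁿ)`. -/
theorem exists_tendsto_cnorm {u : ℕ → PerSm b} (hu : ∀ m, Summable fun l => cnorm m (u (l + 1) - u l)) :
    ∃ S, ∀ m, Tendsto (fun l => cnorm m (S - u l)) atTop (𝓝 0) := by
  obtain ⟨S, hS⟩ := exists_hasSum _ hu
  refine ⟨S + u 0, fun m => ?_⟩
  refine squeeze_zero (fun l => (isAlgNorm_cnorm m).nonneg _) (fun l => ?_)
    (tendsto_sum_nat_add fun l => cnorm m (u (l + 1) - u l))
  refine cnorm_le_tsum m (F := fun i => u (i + l + 1) - u (i + l))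
    (fun j => (summable_nat_add_iff (f := fun i => cnorm j (u (i + 1) - u i)) l).2 (hu j)) fun x => ?_
  have h1 := (hasSum_nat_add_iff' l).2 (hS x).1
  have h2 := Finset.sum_range_sub (fun i => u i x) l
  have h3 : ∑ i ∈ Finset.range l, (u (i + 1) - u i) x = u l x - u 0 x := by simpa using h2
  rw [h3] at h1
  have e : (S + u 0 - u l) x = S x - (u l x - u 0 x) := by simp only [sub_apply, add_apply]; ring
  rw [e]
  exact h1

theorem exists_wienerC_le (b : Module.Basis (Fin n) ℝ (Rn n)) (q : ℕ) :
    ∃ (q' : ℕ) (C : ℝ), 0 ≤ C ∧ ∀ f : PerSm b, wienerC q f ≤ C * cnorm q' f := by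
  obtain ⟨p, C, hC, h⟩ := exists_wiener_le b
  refine ⟨q + p, C, hC, fun f => ?_⟩
  have := iterate_raise_mono (ε := 1) zero_le_one h q f
  rwa [cnorm, ← Function.iterate_add_apply] at this

theorem wiener_le_wienerC (q : ℕ) (f : PerSm b) : wiener f ≤ wienerC q f :=
  wienerC_mono (Nat.zero_le q) f

/-- Convergence in every `C^m` norm implies convergence in the sense of `Close`. -/
theorem exists_close (q : ℕ) (u : ℕ → Fin n → PerSm b) (s : Fin n → PerSm b)
    (hs : ∀ j m, Tendsto (fun l => cnorm m (s j - u l j)) atTop (𝓝 0)) :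
    ∃ e : ℕ → ℝ, Tendsto e atTop (𝓝 0) ∧ ∀ l, Close (wienerC q) s (u l) (e l) := by
  obtain ⟨q', C, hC, hq'⟩ := exists_wienerC_le b q
  let e : ℕ → ℝ := fun l => (∑ j, supN (s j - u l j))
    + ∑ j, ∑ i, C * cnorm q' (D i (s j - u l j))
  have he : Tendsto e atTop (𝓝 0) := by
    have h1 : ∀ j i, Tendsto (fun l => cnorm q' (D i (s j - u l j))) atTop (𝓝 0) :=
      fun j i => squeeze_zero (fun l => (isAlgNorm_cnorm q').nonneg _) (fun l => by
        have := Finset.single_le_sum (f := fun i => cnorm q' (D i (s j - u l j)))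
          (fun i _ => (isAlgNorm_cnorm q').nonneg _) (Finset.mem_univ i)
        have h3 := cnorm_succ q' (s j - u l j)
        have h4 := (isAlgNorm_cnorm q').nonneg (s j - u l j)
        linarith) (hs j (q' + 1))
    have h2 := (tendsto_finsetSum Finset.univ fun j _ => hs j 0).add
      (tendsto_finsetSum Finset.univ fun j _ => tendsto_finsetSum Finset.univ fun i _ =>
        (h1 j i).const_mul C)
    simp only [mul_zero, Finset.sum_const_zero, add_zero] at h2
    exact h2
  have hn0 : ∀ j l, 0 ≤ supN (s j - u l j) := fun j l => isAlgNorm_supN.nonneg _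
  have hn1 : ∀ j i l, 0 ≤ C * cnorm q' (D i (s j - u l j)) := fun j i l =>
    mul_nonneg hC ((isAlgNorm_cnorm q').nonneg _)
  have hsupe : ∀ l j, supN (s j - u l j) ≤ e l := fun l j =>
    (Finset.single_le_sum (f := fun j => supN (s j - u l j)) (fun j _ => hn0 j l)
      (Finset.mem_univ j)).trans (le_add_of_nonneg_right
        (Finset.sum_nonneg fun j _ => Finset.sum_nonneg fun i _ => hn1 j i l))
  have hDe : ∀ l i j, wienerC q (D i (s j - u l j)) ≤ e l := fun l i j => by
    refine (hq' _).trans ((Finset.single_le_sum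
      (f := fun i => C * cnorm q' (D i (s j - u l j))) (fun i _ => hn1 j i l)
      (Finset.mem_univ i)).trans ((Finset.single_le_sum
      (f := fun j => ∑ i, C * cnorm q' (D i (s j - u l j)))
      (fun j _ => Finset.sum_nonneg fun i _ => hn1 j i l) (Finset.mem_univ j)).trans
      (le_add_of_nonneg_left (Finset.sum_nonneg fun j _ => hn0 j l))))
  exact ⟨e, he, fun l => ⟨add_nonneg (Finset.sum_nonneg fun j _ => hn0 j l)
      (Finset.sum_nonneg fun j _ => Finset.sum_nonneg fun i _ => hn1 j i l), hsupe l, hDe l⟩⟩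

theorem summable_cnorm_iter {A : Pert b} {δ K : ℝ} {m : ℕ}
    (hm : ∃ (ν : PerSm b → ℝ) (C : ℝ), 0 ≤ C ∧ (∀ f, cnorm m f ≤ C * ν f) ∧ Contr A ν δ K)
    (hK : picardConst n * K ≤ δ / 2) (c : Rn n) (j : Fin n) :
    Summable fun l => cnorm m (iter A c (l + 1) j - iter A c l j) := by
  have hP := one_le_poincare b
  obtain ⟨ν, C, hC, hν, hA⟩ := hm
  have hδ := hA.nonneg
  refine Summable.of_nonneg_of_le (fun l => (isAlgNorm_cnorm m).nonneg _) (fun l => ?_)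
    ((summable_geometric_two).mul_left (poincare b * (δ / 2) + m * (n * (C * (δ / 2)))))
  have h1 := fun i => (hA.iter_small hK c l).2 i j
  have h2 : supN (iter A c (l + 1) j - iter A c l j) ≤ poincare b * (δ / 2 * (1 / 2) ^ l) :=
    supN_le_poincare (by positivity) (by rw [map_sub, mean_iter, mean_iter, sub_self])
      fun i => (hA.good.wiener_le _).trans (h1 i)
  have h3 : ∑ i, cnorm m (D i (iter A c (l + 1) j - iter A c l j))
      ≤ n * (C * (δ / 2 * (1 / 2) ^ l)) := by
    refine (Finset.sum_le_card_nsmul Finset.univ _ _ fun i _ => (hν _).trans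
      (mul_le_mul_of_nonneg_left (h1 i) hC)).trans_eq (by simp)
  refine (cnorm_le_supN_add m _).trans ((add_le_add h2
    (mul_le_mul_of_nonneg_left h3 (Nat.cast_nonneg m))).trans_eq ?_)
  ring

/-- The Picard iteration converges if `picard A` is a contraction in norms that control every `C^m`
norm. -/
theorem exists_isSol {A : Pert b} {q : ℕ} {δ K : ℝ} (h : Contr A (wienerC q) δ K)
    (hm : ∀ m, ∃ (ν : PerSm b → ℝ) (C : ℝ), 0 ≤ C ∧ (∀ f, cnorm m f ≤ C * ν f) ∧ Contr A ν δ K)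
    (hK : picardConst n * K ≤ δ / 2) (c : Rn n) :
    ∃ s, IsSol A c s ∧ SmallD (wienerC q) δ s := by
  have hP := one_le_poincare b
  have hδ := h.nonneg
  have hlim : ∀ j, ∃ S, ∀ m, Tendsto (fun l => cnorm m (S - iter A c l j)) atTop (𝓝 0) := fun j =>
    exists_tendsto_cnorm (u := fun l => iter A c l j) fun m => summable_cnorm_iter (hm m) hK c j
  choose s hs using hlim
  have hsmall : ∀ l, SmallD (wienerC q) δ (iter A c l) := fun l i j =>
    ((h.iter_small hK c l).1 i j).trans (mul_le_of_le_one_right hδ (by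
      have : (0 : ℝ) ≤ (1 / 2) ^ l := by positivity
      linarith))
  obtain ⟨e, he, hclose⟩ := exists_close q (fun l => iter A c l) s hs
  have hQ := isAlgNorm_wienerC (b := b) q
  have hsd : SmallD (wienerC q) δ s := fun i j => by
    have h1 : Tendsto (fun l => δ + e l) atTop (𝓝 (δ + 0)) := he.const_add δ
    rw [add_zero] at h1
    refine ge_of_tendsto' h1 fun l => ?_
    have e2 : D i (s j) = D i (iter A c l j) + D i (s j - iter A c l j) := by
      rw [← map_add]; congr 1; abel
    rw [e2]
    exact (hQ.add_le _ _).trans (add_le_add (hsmall l i j) ((hclose l).deriv i j))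
  refine ⟨s, fun j => ?_, hsd⟩
  ext x
  have hz : Tendsto (fun l => e (l + 1) + poincare b * (gap b * e l)) atTop (𝓝 0) := by
    have := ((tendsto_add_atTop_iff_nat 1).2 he).add ((he.const_mul (gap b)).const_mul (poincare b))
    simpa using this
  have hb : ∀ l, |s j x - (const c j - picard A s j : PerSm b) x| ≤ e (l + 1) + poincare b * (gap b * e l) := by
    intro l
    have h1 : supN (picard A s j - picard A (iter A c l) j) ≤ poincare b * (gap b * e l) :=
      supN_le_poincare (mul_nonneg (gap_pos b).le (hclose l).nonneg)
        (by rw [map_sub, mean_picard, mean_picard, sub_self])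
        fun i => (wiener_le_wienerC q _).trans (h.sub_le hsd (hsmall l) (hclose l) i j)
    have h2 := ((abs_le_supN (s j - iter A c (l + 1) j) x).trans ((hclose (l + 1)).sup j))
    have h3 := (abs_le_supN _ x).trans h1
    have e3 : s j x - (const c j - picard A s j : PerSm b) x = (s j - iter A c (l + 1) j) x
        + (picard A s j - picard A (iter A c l) j) x := by
      simp only [iter, sub_apply]; ring
    rw [e3]
    exact (abs_add_le _ _).trans (add_le_add h2 h3)
  exact sub_eq_zero.1 (abs_nonpos_iff.1 (ge_of_tendsto' hz hb))

end PerSm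

theorem Coef.Bd.mono {M : ℕ} {a : Coef b} {B B' : ℝ} (h : a.Bd M B) (hB : B ≤ B') : a.Bd M B' := by
  induction M generalizing a with
  | zero => exact fun z => (h z).trans hB
  | succ M ih => exact ⟨ih h.1, fun i => ih (h.2 i)⟩

namespace PerSm

/-- All derivatives up to order `M` of the coefficients of the perturbation are bounded by `B`. -/
def Pert.Bd (A : Pert b) (M : ℕ) (B : ℝ) : Prop := (∀ J, (A.two J).Bd M B) ∧ ∀ J, (A.top J).Bd M B

theorem good_wienerC (q : ℕ) : Good (wienerC (b := b) q) :=
  ⟨isAlgNorm_wienerC q, rieszBounded_wiener.iterate_raise zero_le_one q, wiener_le_wienerC q⟩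

theorem Good.lev {Q : PerSm b → ℝ} (h : Good Q) (m : ℕ) {ε : ℝ} (hε : 0 ≤ ε) : Good (lev Q m ε) := by
  refine ⟨h.alg.iterate_raise hε m, h.riesz.iterate_raise hε m, fun f => (h.wiener_le f).trans ?_⟩
  induction m with
  | zero => exact le_rfl
  | succ m ih =>
    rw [lev_succ]
    exact ih.trans ((h.alg.iterate_raise hε m).le_raise hε f)

theorem pow_mul_cnorm_le_lev {Q : PerSm b → ℝ} (h : Good Q) (m : ℕ) {ε : ℝ} (hε : 0 ≤ ε) (hε1 : ε ≤ 1)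
    (f : PerSm b) : ε ^ m * cnorm m f ≤ lev Q m ε f := by
  induction m generalizing f with
  | zero => simpa [cnorm, lev] using (supN_le_wiener f).trans (h.wiener_le f)
  | succ m ih =>
    rw [cnorm_succ, lev_succ, pow_succ, mul_add]
    refine add_le_add ?_ ?_
    · refine le_trans (mul_le_mul_of_nonneg_right ?_ ((isAlgNorm_cnorm m).nonneg f)) (ih f)
      exact mul_le_of_le_one_right (by positivity) hε1
    · rw [mul_comm (ε ^ m), mul_assoc, Finset.mul_sum]
      exact mul_le_mul_of_nonneg_left (Finset.sum_le_sum fun i _ => ih _) hε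

theorem picardConst_nonneg (n : ℕ) : 0 ≤ picardConst n := by
  have : 0 ≤ ∑ J : Fin n → Fin n ⊕ Fin n, |kap J| := Finset.sum_nonneg fun _ _ => abs_nonneg _
  unfold picardConst
  positivity

theorem Pert.Bd.of_le {A : Pert b} {M M' : ℕ} {B B' : ℝ} (h : A.Bd M B) (hM : M' ≤ M) (hB : B ≤ B') :
    A.Bd M' B' :=
  ⟨fun J => ((h.1 J).of_le hM).mono hB, fun J => ((h.2 J).of_le hM).mono hB⟩

/-- If finitely many derivatives of the perturbation are small enough, the special Lagrangian equation
has a smooth solution with any given mean value. The smallness does not depend on the number of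
derivatives of the solution one wants to control. -/
theorem exists_solutions {q : ℕ} (hq : UnifEst (wienerC (b := b) q) (wienerC q)) {δ : ℝ} (hδ : 0 < δ)
    (hδ1 : δ ≤ 1) (hδg : picardConst n * δ ≤ gap b / 2) :
    ∃ (M : ℕ) (B K : ℝ), 0 < B ∧ ∀ A : Pert b, A.Bd M B → (∀ M', ∃ B', A.Bd M' B') →
      Contr A (wienerC q) δ K ∧ ∀ c, ∃ s, IsSol A c s ∧ SmallD (wienerC q) δ s := by
  obtain ⟨M, C, hC, hMC⟩ := hq
  have hg := gap_pos b
  have hP := picardConst_nonneg n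
  -- The bound `K` on the coefficients has to allow both the contraction (with `gap b`) and an invariant
  -- ball of radius `δ`.
  obtain ⟨K, hK, hK1, hK2⟩ : ∃ K : ℝ, 0 < K ∧ picardConst n * K ≤ gap b / 2 ∧
      picardConst n * K ≤ δ / 2 := by
    have h1 : picardConst n / (picardConst n + 1) ≤ 1 := (div_le_one (by linarith)).2 (by linarith)
    have h2 : picardConst n * (min (gap b / 2) (δ / 2) / (picardConst n + 1))
        ≤ min (gap b / 2) (δ / 2) := by
      have h3 : 0 ≤ min (gap b / 2) (δ / 2) := by positivity
      calc _ = picardConst n / (picardConst n + 1) * min (gap b / 2) (δ / 2) := by ring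
        _ ≤ _ := mul_le_of_le_one_left h3 h1
    exact ⟨_, by positivity, h2.trans (min_le_left _ _), h2.trans (min_le_right _ _)⟩
  refine ⟨M, K / (2 * (C + 1)), K, by positivity, fun A hA hA' => ?_⟩
  have hCB : C * (K / (2 * (C + 1))) ≤ K / 2 := by
    rw [mul_div_assoc', div_le_div_iff₀ (by positivity) two_pos]
    nlinarith
  have hle : picardConst n * (K + δ) ≤ gap b := by linarith
  have hQ := good_wienerC (b := b) q
  have hc : Contr A (wienerC q) δ K := by
    refine ⟨hQ, ⟨fun J => ?_, fun J => ?_⟩, hδ.le, hδ1, hle⟩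
    · exact (hMC _ _ (hA.1 J)).mono (by linarith)
    · exact (hMC _ _ (hA.2 J)).mono (by linarith)
  refine ⟨hc, exists_isSol hc (fun m => ?_) hK2⟩
  have h2 := fun J => exists_est_lev hQ.alg hMC m (A.two J) _ (hA.1 J) fun M' =>
    (hA' M').imp fun _ h => h.1 J
  have hn := fun J => exists_est_lev hQ.alg hMC m (A.top J) _ (hA.2 J) fun M' =>
    (hA' M').imp fun _ h => h.2 J
  choose K₂ hK₂ hE₂ using h2
  choose K₃ hK₃ hE₃ using hn
  have s2 : 0 ≤ ∑ J, K₂ J := Finset.sum_nonneg fun J _ => hK₂ J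
  have s3 : 0 ≤ ∑ J, K₃ J := Finset.sum_nonneg fun J _ => hK₃ J
  -- The weight `ε` of the derivatives beyond order `q` depends on the perturbation and on `m`.
  obtain ⟨ε, hε, hε1, hεK⟩ : ∃ ε : ℝ, 0 < ε ∧ ε ≤ 1 ∧ ε * (∑ J, K₂ J + ∑ J, K₃ J) ≤ K / 2 := by
    refine ⟨min 1 (K / 2 / (∑ J, K₂ J + ∑ J, K₃ J + 1)), by positivity, min_le_left _ _, ?_⟩
    refine (mul_le_mul_of_nonneg_right (min_le_right _ _) (by positivity)).trans ?_
    rw [div_mul_eq_mul_div, div_le_iff₀ (by positivity)]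
    nlinarith
  refine ⟨lev (wienerC q) m ε, (ε ^ m)⁻¹, by positivity, fun f => ?_,
    ⟨hQ.lev m hε.le, ⟨fun J => ?_, fun J => ?_⟩, hδ.le, hδ1, hle⟩⟩
  · rw [← div_eq_inv_mul, le_div_iff₀ (by positivity), mul_comm]
    exact pow_mul_cnorm_le_lev hQ m hε.le hε1 f
  · refine (hE₂ J ε hε.le hε1).mono ?_
    have h1 := Finset.single_le_sum (fun J _ => hK₂ J) (Finset.mem_univ J)
    have h2 := mul_le_mul_of_nonneg_left (h1.trans (le_add_of_nonneg_right s3)) hε.le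
    linarith
  · refine (hE₃ J ε hε.le hε1).mono ?_
    have h1 := Finset.single_le_sum (fun J _ => hK₃ J) (Finset.mem_univ J)
    have h2 := mul_le_mul_of_nonneg_left (h1.trans (le_add_of_nonneg_left s2)) hε.le
    linarith

theorem unifEst_wienerC_mono {q q' : ℕ} (h : q ≤ q') (hq : UnifEst (wienerC (b := b) q) (wienerC q)) :
    UnifEst (wienerC (b := b) q') (wienerC q') := by
  induction h with
  | refl => exact hq
  | step hle ih =>
    obtain ⟨M, C, hC, h⟩ := ih
    have h2 := UnifEst.raise (isAlgNorm_wienerC _) zero_le_one (Q := wienerC (_ + 1))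
      (fun f => by rw [one_mul]; exact wienerC_mono (Nat.le_succ _) f)
      ⟨M, C, hC, fun a B hB => (h a B hB).of_le (wienerC_mono (Nat.le_succ _))⟩
    rwa [← wienerC_succ] at h2

/-! ### Restricting the forms to a graph -/

theorem fderiv_graph_eq_sum_entry (s : Fin n → PerSm b) (x : Rn n) (i : Fin n) :
    fderiv ℝ (graph s) x (EuclideanSpace.single i 1) = ∑ a, entry s i a x • frame n a := by
  rw [fderiv_graph_eq_frame, Fintype.sum_sum_type]
  congr 1
  simp [entry, apply_ite (fun f : PerSm b => f x), ite_smul]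

/-- Expansion of a form on tangent vectors of a graph in the coordinate frame. -/
theorem form_graph_eq_sum {E : Type*} [NormedAddCommGroup E] [NormedSpace ℝ E] {N : ℕ}
    (α : Tan n [⋀^Fin N]→L[ℝ] E) (s : Fin n → PerSm b) (u : Fin N → Fin n) (x : Rn n) :
    α (fun k => fderiv ℝ (graph s) x (EuclideanSpace.single (u k) 1))
      = ∑ J : Fin N → Fin n ⊕ Fin n, monom s u J x • α (fun k => frame n (J k)) := by
  simp only [fderiv_graph_eq_sum_entry]
  have h := α.toMultilinearMap.map_sum (fun k a => entry s (u k) a x • frame n a)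
  refine h.trans (Finset.sum_congr rfl fun J _ => ?_)
  have h2 := α.toMultilinearMap.map_smul_univ (fun k => entry s (u k) (J k) x) fun k => frame n (J k)
  rw [monom, prod_apply]
  exact h2

theorem stdKahler_graph (s : Fin n → PerSm b) (i j : Fin n) (x : Rn n) :
    stdKahler n (fun k => fderiv ℝ (graph s) x (EuclideanSpace.single (![i, j] k) 1))
      = D j (s i) x - D i (s j) x := by
  change ∑ l : Fin n, _ = _
  simp [fderiv_graph, Finset.sum_sub_distrib]

theorem stdΩ_frame_apply (J : Fin n → Fin n ⊕ Fin n) :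
    stdΩ n (fun k => frame n (J k)) = Matrix.det (Matrix.of fun i j => dz j (frame n (J i))) := rfl

theorem kap_inl : kap (n := n) Sum.inl = 0 := by
  have : (Matrix.of fun i j : Fin n => dz j (frame n (Sum.inl i))) = 1 := by
    ext i j
    by_cases h : i = j <;> simp [dz, frame_inl, Matrix.one_apply, h, eq_comm (a := j)]
  rw [kap, stdΩ_frame_apply, this]
  simp

/-- The coefficients of `Im (dz₁ ∧ ⋯ ∧ dzₙ)` with exactly one vertical index. -/
theorem kap_update (k l : Fin n) :
    kap (Function.update Sum.inl k (Sum.inr l)) = if k = l then 1 else 0 := by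
  have : (Matrix.of fun i j : Fin n => dz j (frame n (Function.update Sum.inl k (Sum.inr l) i)))
      = Matrix.updateRow 1 k (Complex.I • (1 : Matrix (Fin n) (Fin n) ℂ) l) := by
    ext i j
    by_cases h : i = k
    · subst h
      by_cases hl : l = j <;> simp [dz, frame_inr, Matrix.one_apply, hl, eq_comm (a := j)]
    · rw [Matrix.of_apply, Function.update_of_ne h, Matrix.updateRow_ne h]
      by_cases hl : i = j <;> simp [dz, frame_inl, Matrix.one_apply, hl, eq_comm (a := j)]
  rw [kap, stdΩ_frame_apply, this, Matrix.det_updateRow_smul]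
  split_ifs with h
  · subst h
    have : Matrix.updateRow 1 k ((1 : Matrix (Fin n) (Fin n) ℂ) k) = 1 := Matrix.updateRow_eq_self _ _
    rw [this]
    simp
  · rw [Matrix.det_zero_of_row_eq h (by
      ext j
      rw [Matrix.updateRow_self, Matrix.updateRow_ne (Ne.symm h)])]
    simp

theorem monom_eq_zero {s : Fin n → PerSm b} {J : Fin n → Fin n ⊕ Fin n} {k p : Fin n}
    (h : J k = Sum.inl p) (hp : k ≠ p) : monom s id J = 0 :=
  Finset.prod_eq_zero (Finset.mem_univ k) (by simp [h, entry, hp])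

open Classical in
/-- The part of `Im (dz₁ ∧ ⋯ ∧ dzₙ)` on the graph of `s` that is linear in `s` is the divergence. -/
theorem sum_not_multi (s : Fin n → PerSm b) :
    ∑ J with ¬ Multi J, kap J • monom s id J = ∑ k, D k (s k) := by
  symm
  refine Finset.sum_of_injOn (fun k => Function.update Sum.inl k (Sum.inr k)) ?_ ?_ ?_ ?_
  · intro k _ k' _ h
    by_contra hne
    have h1 := congrFun h k
    simp [Function.update_of_ne hne] at h1
  · intro k _
    simp only [Finset.coe_filter, Finset.mem_univ, true_and, Set.mem_ofPred_eq]
    rintro ⟨i, j, hij, hi, hj⟩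
    have : ∀ i, (Function.update Sum.inl k (Sum.inr k) i : Fin n ⊕ Fin n).isRight = true → i = k :=
      fun i hi => by
        by_contra hne
        simp [Function.update_of_ne hne] at hi
    exact hij ((this i hi).trans (this j hj).symm)
  · intro J hJ hJ'
    have hM : ¬ Multi J := (Finset.mem_filter.1 hJ).2
    by_cases hz : ∃ k p, J k = Sum.inl p ∧ k ≠ p
    · obtain ⟨k, p, h1, h2⟩ := hz
      rw [monom_eq_zero h1 h2, smul_zero]
    · push Not at hz
      by_cases hr : ∃ k l, J k = Sum.inr l
      · obtain ⟨k, l, hk⟩ := hr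
        have e : J = Function.update Sum.inl k (Sum.inr l) := by
          funext i
          by_cases hi : i = k
          · subst hi; simp [hk]
          · rw [Function.update_of_ne hi]
            rcases hJi : J i with p | p
            · rw [hz i p hJi]
            · exact (hM ⟨i, k, hi, by simp [hJi], by simp [hk]⟩).elim
        have hkl : k ≠ l := by
          rintro rfl
          exact hJ' ⟨k, by simp, e.symm⟩
        rw [e, kap_update, if_neg hkl, zero_smul]
      · push Not at hr
        have e : J = Sum.inl := by
          funext i
          rcases hJi : J i with p | p
          · rw [hz i p hJi]
          · exact (hr i p hJi).elim
        rw [e, kap_inl, zero_smul]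
  · intro k _
    rw [kap_update, if_pos rfl, one_smul, monom, Finset.prod_eq_single k]
    · simp [entry]
    · intro i _ hi
      simp [Function.update_of_ne hi, entry]
    · simp

end PerSm

/-! ### Closed forms on graphs -/

theorem toTorus_add (x : Rn n) {v : Rn n} (hv : v ∈ Submodule.span ℤ (Set.range b)) :
    toTorus b (x + v) = toTorus b x :=
  (Submodule.Quotient.eq _).2 (by simpa using hv)

theorem pull_periodic {X : Type*} (F : Torus b × Rn n → X) (z : Tan n) {v : Rn n}
    (hv : v ∈ Submodule.span ℤ (Set.range b)) : pull F (z.1 + v, z.2) = pull F z := by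
  simp only [pull, toTorus_add z.1 hv]

theorem isOpen_coverTube (n : ℕ) (R : ℝ) : IsOpen (coverTube n R) :=
  isOpen_lt (continuous_snd.norm) continuous_const

section Forms

variable {E G : Type*} [NormedAddCommGroup E] [NormedSpace ℝ E] [NormedAddCommGroup G]
  [NormedSpace ℝ G] {N : ℕ}

theorem form_eq_sum (α : Tan n [⋀^Fin N]→L[ℝ] G) (v : Fin N → Tan n) :
    α v = ∑ J : Fin N → Fin n ⊕ Fin n,
      (∏ k, (frame n).coord (J k) (v k)) • α (fun k => frame n (J k)) := by
  conv_lhs => rw [show v = fun k => ∑ a, (frame n).coord a (v k) • frame n a from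
    funext fun k => ((frame n).sum_repr (v k)).symm]
  refine (α.toMultilinearMap.map_sum fun k a => (frame n).coord a (v k) • frame n a).trans
    (Finset.sum_congr rfl fun J _ => ?_)
  exact α.toMultilinearMap.map_smul_univ (fun k => (frame n).coord (J k) (v k)) fun k => frame n (J k)

theorem contDiffAt_form_apply {A : E → Tan n [⋀^Fin N]→L[ℝ] G} {v : E → Fin N → Tan n} {x : E}
    (hA : ContDiffAt ℝ ∞ A x) (hv : ∀ k, ContDiffAt ℝ ∞ (fun y => v y k) x) :
    ContDiffAt ℝ ∞ (fun y => A y (v y)) x := by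
  have h : (fun y => A y (v y)) = fun y => ∑ J : Fin N → Fin n ⊕ Fin n,
      (∏ k, (frame n).coord (J k) (v y k)) • A y (fun k => frame n (J k)) :=
    funext fun y => form_eq_sum (A y) (v y)
  rw [h]
  refine ContDiffAt.sum fun J _ => ContDiffAt.smul (contDiffAt_prod fun k _ => ?_) ?_
  · exact (LinearMap.toContinuousLinearMap ((frame n).coord (J k))).contDiff.contDiffAt.comp x (hv k)
  · exact (ContinuousAlternatingMap.apply ℝ (Tan n) G fun k => frame n (J k)).contDiff.contDiffAt.comp
      x hA

/-- The pull-back of a closed form is closed, in coordinates. -/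
theorem sum_fderiv_pullback {F : Tan n → Tan n [⋀^Fin N]→L[ℝ] G} {f : E → Tan n}
    {p : E} (hF : DifferentiableAt ℝ F (f p)) (hf : ContDiffAt ℝ ∞ f p) (v : Fin (N + 1) → E) :
    ∑ i : Fin (N + 1), (-1 : ℝ) ^ (i : ℕ) • fderiv ℝ (fun p => F (f p) fun k => fderiv ℝ f p (i.removeNth v k)) p (v i)
      = extDeriv F (f p) (fun k => fderiv ℝ f p (v k)) := by
  have h2 : DifferentiableAt ℝ (fderiv ℝ f) p :=
    (hf.fderiv_right (m := ∞) (by simp)).differentiableAt (by simp)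
  have h3 : DifferentiableAt ℝ (fun p => (F (f p)).compContinuousLinearMap (fderiv ℝ f p)) p :=
    ((hF.comp p (hf.differentiableAt (by simp))).hasFDerivAt
      |>.continuousAlternatingMapCompContinuousLinearMap h2.hasFDerivAt).differentiableAt
  have h4 := extDeriv_apply h3 v
  rw [extDeriv_pullback hF hf (by simpa using WithTop.coe_le_coe.2 (le_top : (2 : ℕ∞) ≤ ⊤))] at h4
  refine Eq.trans (Finset.sum_congr rfl fun i _ => ?_) h4.symm
  rw [← Int.cast_smul_eq_zsmul ℝ]
  push_cast
  rfl

end Forms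

namespace PerSm

open MeasureTheory

/-- The integral of the derivative of a periodic function over a period vanishes. -/
theorem integral_fderiv (g : PerSm b) (i : Fin n) :
    ∫ x in ZSpan.fundamentalDomain b, fderiv ℝ g x (EuclideanSpace.single i 1) = 0 := by
  have h := mean_D i g
  rw [mean_def] at h
  exact (mul_eq_zero.1 h).resolve_left (inv_ne_zero torusVol_pos.ne')

/-- The homotopy `(τ, x) ↦ (x, τ s(x))` from the zero section to the graph of `s`. -/
def homotopy (s : Fin n → PerSm b) (p : ℝ × Rn n) : Tan n := (p.2, p.1 • toVec s p.2)

theorem contDiff_homotopy (s : Fin n → PerSm b) : ContDiff ℝ ∞ (homotopy s) :=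
  contDiff_snd.prodMk (contDiff_fst.smul ((contDiff_toVec s).comp contDiff_snd))

theorem toVec_add (s : Fin n → PerSm b) (x : Rn n) {v : Rn n}
    (hv : v ∈ Submodule.span ℤ (Set.range b)) : toVec s (x + v) = toVec s x := by
  simp only [toVec, (s _).periodic x hv]

theorem fderiv_homotopy_add (s : Fin n → PerSm b) (p : ℝ × Rn n) {v : Rn n}
    (hv : v ∈ Submodule.span ℤ (Set.range b)) :
    fderiv ℝ (homotopy s) (p.1, p.2 + v) = fderiv ℝ (homotopy s) p := by
  have h1 : (fun q : ℝ × Rn n => homotopy s (q + (0, v))) = fun q => homotopy s q + (v, 0) :=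
    funext fun q => by simp [homotopy, toVec_add s q.2 hv]
  have h2 := fderiv_comp_add_right (𝕜 := ℝ) (f := homotopy s) (x := p) ((0 : ℝ), v)
  rw [h1, fderiv_add_const] at h2
  rw [h2]
  congr 1
  ext <;> simp

theorem fderiv_homotopy_single (s : Fin n → PerSm b) (τ : ℝ) (x u : Rn n) :
    fderiv ℝ (homotopy s) (τ, x) (0, u) = fderiv ℝ (fun y => (y, τ • toVec s y) : Rn n → Tan n) x u := by
  have h1 : HasFDerivAt (fun y : Rn n => ((τ, y) : ℝ × Rn n)) (ContinuousLinearMap.inr ℝ ℝ (Rn n)) x :=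
    hasFDerivAt_prodMk_right τ x
  have h2 := (((contDiff_homotopy s).differentiable (by simp) (τ, x)).hasFDerivAt.comp x h1).fderiv
  exact (congrArg (fun L => L u) h2).symm

/-- A closed form integrates to the same value over homologous graphs. -/
theorem integral_form_graph {F : Tan n → Tan n [⋀^Fin n]→L[ℝ] ℂ} {R : ℝ}
    (hF : ContDiffOn ℝ ∞ F (coverTube n R))
    (hper : ∀ z : Tan n, ∀ v ∈ Submodule.span ℤ (Set.range b), F (z.1 + v, z.2) = F z)
    (hcl : ∀ z ∈ coverTube n R, extDeriv F z = 0) (s : Fin n → PerSm b)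
    (hs : ∀ x, ‖toVec s x‖ < R) (L : ℂ →L[ℝ] ℝ) :
    ∫ x in ZSpan.fundamentalDomain b,
        L (F (graph s x) fun k => fderiv ℝ (graph s) x (EuclideanSpace.single k 1))
      = ∫ x in ZSpan.fundamentalDomain b, L (F (x, 0) fun k => (EuclideanSpace.single k 1, 0)) := by
  set U : Set (ℝ × Rn n) := homotopy s ⁻¹' coverTube n R with hU
  have hUo : IsOpen U := (isOpen_coverTube n R).preimage (contDiff_homotopy s).continuous
  have hmem : ∀ τ ∈ Set.Icc (0 : ℝ) 1, ∀ x, (τ, x) ∈ U := fun τ hτ x => by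
    change ‖τ • toVec s x‖ < R
    rw [norm_smul, Real.norm_of_nonneg hτ.1]
    exact (mul_le_of_le_one_left (norm_nonneg _) hτ.2).trans_lt (hs x)
  have hFat : ∀ p ∈ U, ContDiffAt ℝ ∞ F (homotopy s p) := fun p hp =>
    hF.contDiffAt ((isOpen_coverTube n R).mem_nhds hp)
  -- the components of the pulled back form
  let Φ : (Fin n → ℝ × Rn n) → ℝ × Rn n → ℂ := fun w p =>
    F (homotopy s p) fun k => fderiv ℝ (homotopy s) p (w k)
  have hΦ : ∀ w, ∀ p ∈ U, ContDiffAt ℝ ∞ (Φ w) p := fun w p hp =>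
    contDiffAt_form_apply ((hFat p hp).comp p (contDiff_homotopy s).contDiffAt) fun k =>
      (((contDiff_homotopy s).fderiv_right (m := ∞) (by simp)).clm_apply contDiff_const).contDiffAt
  have hΦper : ∀ w τ x, ∀ v ∈ Submodule.span ℤ (Set.range b), Φ w (τ, x + v) = Φ w (τ, x) := by
    intro w τ x v hv
    have h1 : homotopy s (τ, x + v) = ((homotopy s (τ, x)).1 + v, (homotopy s (τ, x)).2) := by
      simp [homotopy, toVec_add s x hv]
    simp only [Φ]
    rw [fderiv_homotopy_add s (τ, x) hv, h1, hper _ v hv]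
  let g : (w : Fin n → ℝ × Rn n) → (τ : ℝ) → τ ∈ Set.Icc (0 : ℝ) 1 → PerSm b := fun w τ hτ =>
    mk (fun x => L (Φ w (τ, x))) (contDiff_iff_contDiffAt.2 fun x =>
      L.contDiff.contDiffAt.comp x ((hΦ w _ (hmem τ hτ x)).comp x
        (contDiff_prodMk_right τ).contDiffAt)) fun x v hv => by rw [hΦper w τ x v hv]
  have hg : ∀ w τ (hτ : τ ∈ Set.Icc (0 : ℝ) 1) x i, fderiv ℝ (g w τ hτ) x (EuclideanSpace.single i 1)
      = L (fderiv ℝ (Φ w) (τ, x) (0, EuclideanSpace.single i 1)) := by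
    intro w τ hτ x i
    have h1 : HasFDerivAt (fun y : Rn n => ((τ, y) : ℝ × Rn n)) (ContinuousLinearMap.inr ℝ ℝ (Rn n)) x :=
      hasFDerivAt_prodMk_right τ x
    have h2 := ((hΦ w _ (hmem τ hτ x)).differentiableAt (by simp)).hasFDerivAt.comp x h1
    have h3 := (L.hasFDerivAt.comp x h2).fderiv
    exact congrArg (fun L => L (EuclideanSpace.single i 1)) h3
  let w₀ : Fin n → ℝ × Rn n := fun k => (0, EuclideanSpace.single k 1)
  let H' : ℝ → Rn n → ℝ := fun τ x => L (fderiv ℝ (Φ w₀) (τ, x) (1, 0))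
  have hH' : ∀ τ ∈ Set.Icc (0 : ℝ) 1, ∫ x in ZSpan.fundamentalDomain b, H' τ x = 0 := by
    intro τ hτ
    let v : Fin (n + 1) → ℝ × Rn n := Fin.cons (1, 0) w₀
    have key : ∀ x, H' τ x = -∑ i : Fin n, (-1) ^ ((i : ℕ) + 1) *
        D i (g (i.succ.removeNth v) τ hτ) x := fun x => by
      have h1 := sum_fderiv_pullback ((hFat _ (hmem τ hτ x)).differentiableAt (by simp))
        (contDiff_homotopy s).contDiffAt v
      rw [hcl _ (hmem τ hτ x), Fin.sum_univ_succ] at h1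
      replace h1 := h1.trans (show _ = (0 : ℂ) from rfl)
      have h2 := congrArg L h1
      simp only [map_add, map_sum, Fin.val_zero, pow_zero, one_smul, Fin.val_succ,
        map_zero, map_smul, smul_eq_mul] at h2
      rw [eq_neg_iff_add_eq_zero, ← h2]
      congr 1
      refine Finset.sum_congr rfl fun i _ => ?_
      rw [D_apply, hg _ τ hτ]
      rfl
    simp only [key]
    rw [integral_neg, integral_finsetSum _ fun i _ =>
      ((D i (g (i.succ.removeNth v) τ hτ)).integrable).const_mul ((-1) ^ ((i : ℕ) + 1))]
    simp [integral_const_mul, D_apply, integral_fderiv]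
  have hH'c : ContinuousOn (fun p : ℝ × Rn n => H' p.1 p.2) U := fun p hp =>
    (L.continuous.continuousAt.comp (((((hΦ w₀ p hp).fderiv_right (m := 0) (by simp)).continuousAt)
      ).clm_apply continuousAt_const)).continuousWithinAt
  have hint : ∀ x, ∫ τ in (0 : ℝ)..1, H' τ x = L (Φ w₀ (1, x)) - L (Φ w₀ (0, x)) := by
    intro x
    refine intervalIntegral.integral_eq_sub_of_hasDerivAt (f := fun τ => L (Φ w₀ (τ, x)))
      (fun τ hτ => ?_) (ContinuousOn.intervalIntegrable ?_)
    · rw [Set.uIcc_of_le zero_le_one] at hτ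
      have h1 : HasDerivAt (fun τ : ℝ => ((τ, x) : ℝ × Rn n)) (1, 0) τ :=
        (hasDerivAt_id τ).prodMk (hasDerivAt_const τ x)
      have h3 : HasFDerivAt (Φ w₀) (fderiv ℝ (Φ w₀) (τ, x)) (τ, x) :=
        ((hΦ w₀ _ (hmem τ hτ x)).differentiableAt (by simp)).hasFDerivAt
      have h2 : HasDerivAt (fun τ : ℝ => Φ w₀ (τ, x)) (fderiv ℝ (Φ w₀) (τ, x) (1, 0)) τ :=
        HasFDerivAt.comp_hasDerivAt (f := fun τ : ℝ => ((τ, x) : ℝ × Rn n)) τ h3 h1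
      exact L.hasFDerivAt.comp_hasDerivAt τ h2
    · rw [Set.uIcc_of_le zero_le_one]
      exact hH'c.comp (by fun_prop) fun τ hτ => hmem τ hτ x
  have hswap : ∫ x in ZSpan.fundamentalDomain b, ∫ τ in (0 : ℝ)..1, H' τ x = 0 := by
    rw [← intervalIntegral_integral_swap]
    · refine (intervalIntegral.integral_congr fun τ hτ => ?_).trans intervalIntegral.integral_zero
      rw [Set.uIcc_of_le zero_le_one] at hτ
      exact hH' τ hτ
    · rw [Measure.prod_restrict, Set.uIoc_of_le zero_le_one]
      have hK : IsCompact (Set.Icc (0 : ℝ) 1 ×ˢ closure (ZSpan.fundamentalDomain b)) :=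
        isCompact_Icc.prod (ZSpan.fundamentalDomain_isBounded b).isCompact_closure
      exact ((hH'c.mono fun p hp => hmem p.1 hp.1 p.2).integrableOn_compact hK).mono_set
        (Set.prod_mono Set.Ioc_subset_Icc_self subset_closure)
  simp only [hint] at hswap
  have h0 : (0 : ℝ) ∈ Set.Icc (0 : ℝ) 1 := by simp
  have h1 : (1 : ℝ) ∈ Set.Icc (0 : ℝ) 1 := by simp
  replace hswap := (integral_sub (g w₀ 1 h1).integrable (g w₀ 0 h0).integrable).symm.trans hswap
  rw [sub_eq_zero] at hswap
  replace hswap : ∫ x in ZSpan.fundamentalDomain b, L (Φ w₀ (1, x))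
    = ∫ x in ZSpan.fundamentalDomain b, L (Φ w₀ (0, x)) := hswap
  have e1 : ∀ x, Φ w₀ (1, x) = F (graph s x) fun k => fderiv ℝ (graph s) x (EuclideanSpace.single k 1) :=
    fun x => by
      simp only [Φ, w₀, fderiv_homotopy_single]
      simp only [homotopy, one_smul]
      rfl
  have e0 : ∀ x, Φ w₀ (0, x) = F (x, 0) fun k => (EuclideanSpace.single k 1, 0) := fun x => by
    simp only [Φ, w₀, fderiv_homotopy_single]
    simp only [homotopy, zero_smul]
    congr 1
    funext k
    have := ((hasFDerivAt_id (𝕜 := ℝ) x).prodMk (hasFDerivAt_const (0 : Rn n) x)).fderiv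
    exact congrArg (fun L => L (EuclideanSpace.single k 1)) this
  simp only [e1, e0] at hswap
  exact hswap

/-- The difference of cohomologous 2-forms restricts to a graph as the differential of a 1-form on the
torus. -/
theorem exists_primitive_graph {A : Tan n → Tan n [⋀^Fin 1]→L[ℝ] ℝ} {R : ℝ}
    (hA : ContDiffOn ℝ ∞ A (coverTube n R))
    (hper : ∀ z : Tan n, ∀ v ∈ Submodule.span ℤ (Set.range b), A (z.1 + v, z.2) = A z)
    (s : Fin n → PerSm b) (hs : ∀ x, ‖toVec s x‖ < R) :
    ∃ γ : Fin n → PerSm b, ∀ x i j, extDeriv A (graph s x)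
        (fun k => fderiv ℝ (graph s) x (EuclideanSpace.single (![i, j] k) 1))
      = D i (γ j) x - D j (γ i) x := by
  have hAat : ∀ x, ContDiffAt ℝ ∞ A (graph s x) := fun x =>
    hA.contDiffAt ((isOpen_coverTube n R).mem_nhds (hs x))
  have hgper : ∀ x, ∀ v ∈ Submodule.span ℤ (Set.range b),
      fderiv ℝ (graph s) (x + v) = fderiv ℝ (graph s) x := fun x v hv => by
    have h1 : (fun y => graph s (y + v)) = fun y => graph s y + (v, 0) :=
      funext fun y => by simp [graph, toVec_add s y hv]
    have h2 := fderiv_comp_add_right (𝕜 := ℝ) (f := graph s) (x := x) v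
    rw [h1, fderiv_add_const] at h2
    exact h2.symm
  refine ⟨fun j => mk (fun x => A (graph s x) fun _ => fderiv ℝ (graph s) x (EuclideanSpace.single j 1))
    (contDiff_iff_contDiffAt.2 fun x => contDiffAt_form_apply
      ((hAat x).comp x (contDiff_graph s).contDiffAt) fun _ =>
      (((contDiff_graph s).fderiv_right (m := ∞) (by simp)).clm_apply contDiff_const).contDiffAt)
    fun x v hv => ?_, fun x i j => ?_⟩
  · have h1 : graph s (x + v) = ((graph s x).1 + v, (graph s x).2) := by
      simp [graph, toVec_add s x hv]
    rw [h1, hper _ v hv, hgper x v hv]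
  · have h1 := sum_fderiv_pullback ((hAat x).differentiableAt (by simp))
      (contDiff_graph s).contDiffAt (fun k => EuclideanSpace.single (![i, j] k) (1 : ℝ))
    have r0 : ∀ k : Fin 1, Fin.succAbove 0 k = 1 := by decide
    have r1 : ∀ k : Fin 1, Fin.succAbove 1 k = 0 := by decide
    rw [← h1, Fin.sum_univ_two]
    simp only [Fin.val_zero, pow_zero, one_smul, Fin.val_one, pow_one, neg_smul, Matrix.cons_val_zero,
      Matrix.cons_val_one, D_apply, coe_mk, Fin.removeNth, sub_eq_add_neg, r0, r1]

/-! ### The special Lagrangian equation -/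

/-- On the region `‖y‖ ≤ ρ`, the coefficients of `A` are the components of `ω` and `Im (e^{iθ} Ω)` minus
those of their flat models. -/
structure Pert.Represents (A : Pert b) (S : Quad b) (θ ρ : ℝ) : Prop where
  two : ∀ z : Tan n, ‖z.2‖ ≤ ρ → ∀ J, A.two J z
    = pull S.kahler z (fun k => frame n (J k)) - stdKahler n fun k => frame n (J k)
  top : ∀ z : Tan n, ‖z.2‖ ≤ ρ → ∀ J, A.top J z
    = (Complex.exp (Complex.I * θ) * pull S.Ω z fun k => frame n (J k)).im - kap J

/-- The graph of `s` is special Lagrangian, expressed with the coordinate vector fields. -/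
structure IsSL (S : Quad b) (θ : ℝ) (s : Fin n → PerSm b) : Prop where
  kahler : ∀ x i j, pull S.kahler (graph s x)
    (fun k => fderiv ℝ (graph s) x (EuclideanSpace.single (![i, j] k) 1)) = 0
  im : ∀ x, (Complex.exp (Complex.I * θ) * pull S.Ω (graph s x)
    fun k => fderiv ℝ (graph s) x (EuclideanSpace.single k 1)).im = 0

/-- The real linear form `w ↦ Im (e^{iθ} w)`. -/
def imRot (θ : ℝ) : ℂ →L[ℝ] ℝ :=
  Complex.imCLM.comp (ContinuousLinearMap.mul ℝ ℂ (Complex.exp (Complex.I * θ)))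

theorem imRot_apply (θ : ℝ) (w : ℂ) : imRot θ w = (Complex.exp (Complex.I * θ) * w).im := rfl

section Equation

variable {A : Pert b} {S : Quad b} {θ ρ : ℝ} {s : Fin n → PerSm b}

/-- The Lagrangian condition in terms of `s`. -/
theorem kahler_graph (hA : A.Represents S θ ρ) (hs : ∀ x, ‖toVec s x‖ ≤ ρ) (x : Rn n) (i j : Fin n) :
    pull S.kahler (graph s x) (fun k => fderiv ℝ (graph s) x (EuclideanSpace.single (![i, j] k) 1))
      = -((D i (s j) - D j (s i)) + errTwo A s i j) x := by
  have h1 := form_graph_eq_sum (pull S.kahler (graph s x)) s ![i, j] x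
  have h2 := form_graph_eq_sum (stdKahler n) s ![i, j] x
  rw [stdKahler_graph] at h2
  have h3 : ∀ J, pull S.kahler (graph s x) (fun k => frame n (J k))
      = comp (A.two J) s x + stdKahler n (fun k => frame n (J k)) := fun J => by
    rw [comp_apply, hA.two (graph s x) (hs x)]; ring
  rw [h1]
  simp only [h3, smul_add, Finset.sum_add_distrib, ← h2]
  simp only [errTwo, add_apply, sub_apply, neg_apply, sum_apply, mul_apply, smul_eq_mul, mul_comm]
  ring

theorem errTop_add_apply (x : Rn n) :
    ((∑ k, D k (s k)) + errTop A s) x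
      = ∑ J, (comp (A.top J) s x + kap J) * monom s id J x := by
  classical
  rw [← sum_not_multi, errTop]
  have h := Finset.sum_filter_add_sum_filter_not Finset.univ (fun J => Multi J)
    fun J : Fin n → Fin n ⊕ Fin n => kap J • monom s id J
  have e : (∑ J with ¬ Multi J, kap J • monom s id J) + (∑ J, comp (A.top J) s * monom s id J
      + ∑ J with Multi J, kap J • monom s id J)
      = ∑ J, comp (A.top J) s * monom s id J + ∑ J, kap J • monom s id J := by
    rw [← h]; abel
  convert congrArg (fun f : PerSm b => f x) e using 1
  simp [add_mul, Finset.sum_add_distrib]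

/-- The phase condition in terms of `s`. -/
theorem Ω_graph (hA : A.Represents S θ ρ) (hs : ∀ x, ‖toVec s x‖ ≤ ρ) (x : Rn n) :
    imRot θ (pull S.Ω (graph s x) fun k => fderiv ℝ (graph s) x (EuclideanSpace.single k 1))
      = ((∑ k, D k (s k)) + errTop A s) x := by
  have h1 := form_graph_eq_sum (pull S.Ω (graph s x)) s id x
  simp only [id] at h1
  rw [h1, map_sum, errTop_add_apply]
  refine Finset.sum_congr rfl fun J _ => ?_
  rw [map_smul, comp_apply, hA.top (graph s x) (hs x), imRot_apply, smul_eq_mul, mul_comm]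
  congr 1
  exact (sub_add_cancel _ _).symm

/-- Special Lagrangian graphs solve the fixed point equation. -/
theorem IsSL.isSol (h : IsSL S θ s) (hA : A.Represents S θ ρ) (hs : ∀ x, ‖toVec s x‖ ≤ ρ) {c : Rn n}
    (hc : ∀ j, mean (s j) = c j) : IsSol A c s := by
  have h1 : ∀ i j, D i (s j) - D j (s i) = -errTwo A s i j := fun i j => by
    refine eq_neg_of_add_eq_zero_left (ext fun x => ?_)
    have := kahler_graph hA hs x i j
    rw [h.kahler] at this
    rw [zero_apply]
    linarith
  have h2 : ∑ k, D k (s k) = -errTop A s := by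
    refine eq_neg_of_add_eq_zero_left (ext fun x => ?_)
    rw [← Ω_graph hA hs]
    exact h.im x
  intro j
  have h3 := green_curl_div s j
  simp only [h1, h2, map_neg, Finset.sum_neg_distrib, hc] at h3
  rw [← neg_add] at h3
  rw [picard, const, sub_eq_add_neg, h3]
  abel

theorem integrableOn_period {R : ℝ} (hR : 0 < R) (hsm : SmoothOn S.Ω R) :
    IntegrableOn (fun x : Rn n => pull S.Ω (x, 0) fun k =>
      (((EuclideanSpace.single k (1 : ℝ) : Rn n), (0 : Rn n)) : Tan n)) (ZSpan.fundamentalDomain b) := by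
  have hc : Continuous fun x : Rn n => pull S.Ω (x, 0) fun k =>
      (((EuclideanSpace.single k (1 : ℝ) : Rn n), (0 : Rn n)) : Tan n) :=
    (ContinuousAlternatingMap.apply ℝ (Tan n) ℂ _).continuous.comp
      (hsm.continuousOn.comp_continuous (by fun_prop) fun x => by simpa [coverTube] using hR)
  exact (hc.continuousOn.integrableOn_compact
    (ZSpan.fundamentalDomain_isBounded b).isCompact_closure).mono_set subset_closure

/-- By Stokes' theorem, the mean value of `Im (e^{iθ} Ω)` is the same on the graph of `s` and on the zero
section, where it vanishes by the choice of the phase. -/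
theorem mean_eq_zero_of_closed {R : ℝ} (hA : A.Represents S θ ρ) (hs : ∀ x, ‖toVec s x‖ ≤ ρ)
    (hR : 0 < R) (hρ : ρ < R) (hsm : SmoothOn S.Ω R) (hcl : ∀ z ∈ coverTube n R, extDeriv (pull S.Ω) z = 0)
    (hθ : (Complex.exp (Complex.I * θ) * S.period).im = 0) :
    mean ((∑ k, D k (s k)) + errTop A s) = 0 := by
  have h1 := integral_form_graph hsm (fun z v hv => pull_periodic (b := b) S.Ω z hv) hcl s
    (fun x => (hs x).trans_lt hρ) (imRot θ)
  simp only [Ω_graph hA hs] at h1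
  rw [ContinuousLinearMap.integral_comp_comm _ (integrableOn_period hR hsm)] at h1
  rw [mean_def, h1]
  exact mul_eq_zero_of_right _ hθ

/-- Conversely, the graph of a solution of the fixed point equation is special Lagrangian, under the
cohomological conditions on `ω` and `Ω`. -/
theorem IsSol.isSL {R : ℝ} {c : Rn n} (h : IsSol A c s) (hA : A.Represents S θ ρ)
    (hs : ∀ x, ‖toVec s x‖ ≤ ρ) (hR : 0 < R) (hρ : ρ < R) (hsm : SmoothOn S.Ω R)
    (hcl : ∀ z ∈ coverTube n R, extDeriv (pull S.Ω) z = 0)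
    (hθ : (Complex.exp (Complex.I * θ) * S.period).im = 0)
    (hclass : SameClassOn S.kahler (flat b).kahler R) : IsSL S θ s := by
  have hmean := mean_eq_zero_of_closed hA hs hR hρ hsm hcl hθ
  obtain ⟨α, hα, hαd⟩ := hclass
  obtain ⟨γ, hγ⟩ := exists_primitive_graph hα (fun z v hv => pull_periodic (b := b) α z hv) s
    fun x => (hs x).trans_lt hρ
  have hη : ∀ i j, D i (s j) - D j (s i) + errTwo A s i j
      = D i (s j - γ j) - D j (s i - γ i) := fun i j => ext fun x => by
    have h1 := hγ x i j
    rw [← hαd (graph s x) ((hs x).trans_lt hρ)] at h1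
    have h2 := kahler_graph hA hs x i j
    have h3 := stdKahler_graph s i j x
    have h4 : pull S.kahler (graph s x)
          (fun k => fderiv ℝ (graph s) x (EuclideanSpace.single (![i, j] k) 1))
        - stdKahler n (fun k => fderiv ℝ (graph s) x (EuclideanSpace.single (![i, j] k) 1))
        = D i (γ j) x - D j (γ i) x := h1
    rw [h2, h3] at h4
    simp only [map_sub, sub_apply, add_apply] at h4 ⊢
    linarith
  -- The errors in the system are the exact 2-form `d (s - γ)` and a function of mean zero, and the
  -- fixed point equation says that the Green operator annihilates the pair.
  have key := eq_zero_of_green hmean (fun j => s j - γ j) fun j => by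
    have h3 := green_curl_div s j
    rw [h.mean] at h3
    have h4 := h j
    simp only [← hη, map_add, Finset.sum_add_distrib]
    have h5 : green j (∑ k, D k (s k)) + green j (errTop A s)
        + (∑ i, green i (D i (s j) - D j (s i)) + ∑ i, green i (errTwo A s i j))
        = (green j (∑ i, D i (s i)) + ∑ i, green i (D i (s j) - D j (s i))) + picard A s j := by
      rw [picard]; abel
    rw [h5, h3]
    nth_rw 1 [h4]
    rw [const]
    abel
  refine ⟨fun x i j => ?_, fun x => ?_⟩
  · rw [kahler_graph hA hs, hη, key.2, zero_apply, neg_zero]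
  · rw [← imRot_apply, Ω_graph hA hs, key.1, zero_apply]

theorem basisFun_toBasis_eq (i : Fin n) :
    (EuclideanSpace.basisFun (Fin n) ℝ).toBasis i = EuclideanSpace.single i (1 : ℝ) := by simp

theorem IsSL.kahler_comp (h : IsSL S θ s) (x : Rn n) :
    (pull S.kahler (graph s x)).compContinuousLinearMap (fderiv ℝ (graph s) x) = 0 := by
  refine ContinuousAlternatingMap.toAlternatingMap_injective
    (Module.Basis.ext_alternating (EuclideanSpace.basisFun (Fin n) ℝ).toBasis fun v _ => ?_)
  have h1 := h.kahler x (v 0) (v 1)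
  have h2 : ∀ k, ![v 0, v 1] k = v k := fun k => by fin_cases k <;> rfl
  simp only [h2] at h1
  simp only [basisFun_toBasis_eq]
  exact h1

theorem IsSL.im_apply (h : IsSL S θ s) (x : Rn n) (v : Fin n → Rn n) :
    imRot θ (pull S.Ω (graph s x) fun k => fderiv ℝ (graph s) x (v k)) = 0 := by
  have h0 : (imRot θ).toLinearMap.compAlternatingMap
      ((pull S.Ω (graph s x)).compContinuousLinearMap (fderiv ℝ (graph s) x)).toAlternatingMap = 0 := by
    refine Module.Basis.ext_alternating (EuclideanSpace.basisFun (Fin n) ℝ).toBasis fun v hv => ?_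
    let σ : Equiv.Perm (Fin n) := Equiv.ofBijective v (Finite.injective_iff_bijective.1 hv)
    have h3 := AlternatingMap.map_perm ((imRot θ).toLinearMap.compAlternatingMap
      ((pull S.Ω (graph s x)).compContinuousLinearMap (fderiv ℝ (graph s) x)).toAlternatingMap)
      (fun i => (EuclideanSpace.basisFun (Fin n) ℝ).toBasis i) σ
    refine h3.trans ?_
    simp only [basisFun_toBasis_eq]
    have h4 := h.im x
    refine (congrArg (fun r : ℝ => Equiv.Perm.sign σ • r) h4).trans (smul_zero _)
  exact congrArg (fun f => f v) h0

theorem IsSL.isSpecialLagrangianGraph {R : ℝ} (h : IsSL S θ s) {σ : Torus b → Ball n R}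
    (hσ : graphMap σ = graph s) : S.IsSpecialLagrangianGraph θ σ := by
  refine ⟨hσ ▸ contDiff_graph s, fun x => ?_, fun x v => ?_⟩
  · rw [hσ]
    exact h.kahler_comp x
  · rw [hσ]
    exact h.im_apply x v

end Equation

end PerSm

/-! ### The perturbation tends to zero -/

namespace Coef

theorem norm_frame_le (i : Fin n ⊕ Fin n) : ‖frame n i‖ ≤ 1 := by
  rcases i with i | i
  · simp [frame_inl, Prod.norm_def]
  · simp [frame_inr, Prod.norm_def]

theorem norm_iteratedFDeriv_pd_le (i : Fin n ⊕ Fin n) (a : Coef b) (m : ℕ) (z : Tan n) :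
    ‖iteratedFDeriv ℝ m (a.pd i) z‖ ≤ ‖iteratedFDeriv ℝ (m + 1) a z‖ := by
  have h1 : (a.pd i : Tan n → ℝ) = ContinuousLinearMap.apply ℝ ℝ (frame n i) ∘ fderiv ℝ a := rfl
  rw [h1, ← norm_iteratedFDeriv_fderiv]
  refine (ContinuousLinearMap.norm_iteratedFDeriv_comp_left _
    ((a.smooth.fderiv_right (m := ∞) (by simp)).contDiffAt (n := ∞)) (by exact_mod_cast le_top)).trans
    (mul_le_of_le_one_left (norm_nonneg _) ?_)
  refine ContinuousLinearMap.opNorm_le_bound _ zero_le_one fun L => ?_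
  rw [one_mul]
  exact (L.le_opNorm _).trans (mul_le_of_le_one_right (norm_nonneg _) (norm_frame_le i))

/-- By periodicity, bounds over a fundamental domain suffice. -/
theorem exists_fundamentalDomain (z : Tan n) : ∃ v ∈ Submodule.span ℤ (Set.range b),
    z.1 + v ∈ ZSpan.fundamentalDomain b :=
  ⟨-(ZSpan.floor b z.1 : Rn n), neg_mem (ZSpan.floor b z.1).2, by
    have := ZSpan.fract_mem_fundamentalDomain b z.1
    rwa [ZSpan.fract_apply, sub_eq_add_neg] at this⟩

theorem bd_of_norm_iteratedFDeriv_le {M : ℕ} {a : Coef b} {B : ℝ}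
    (h : ∀ m ≤ M, ∀ z : Tan n, z.1 ∈ ZSpan.fundamentalDomain b → ‖iteratedFDeriv ℝ m a z‖ ≤ B) :
    a.Bd M B := by
  induction M generalizing a with
  | zero =>
    intro z
    obtain ⟨v, hv, hz⟩ := exists_fundamentalDomain (b := b) z
    rw [← a.periodic z v hv]
    simpa using h 0 le_rfl (z.1 + v, z.2) hz
  | succ M ih =>
    exact ⟨ih fun m hm => h m (by omega), fun i => ih fun m hm z hz =>
      (norm_iteratedFDeriv_pd_le i a m z).trans (h (m + 1) (by omega) z hz)⟩

/-- A coefficient function with support in a tube is bounded with all its derivatives. -/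
theorem exists_bd {ρ : ℝ} (M : ℕ) (a : Coef b) (ha : ∀ z : Tan n, ρ < ‖z.2‖ → a z = 0) :
    ∃ B, a.Bd M B := by
  have h0 : ∀ a : Coef b, (∀ z : Tan n, ρ < ‖z.2‖ → a z = 0) → ∃ B, ∀ z, |a z| ≤ B := by
    intro a ha
    have hK : IsCompact (closure (ZSpan.fundamentalDomain b) ×ˢ Metric.closedBall (0 : Rn n) ρ) :=
      (ZSpan.fundamentalDomain_isBounded b).isCompact_closure.prod (isCompact_closedBall _ _)
    obtain ⟨B, hB⟩ := hK.exists_bound_of_continuousOn a.smooth.continuous.continuousOn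
    refine ⟨max B 0, fun z => ?_⟩
    by_cases hz : ρ < ‖z.2‖
    · rw [ha z hz, abs_zero]; exact le_max_right _ _
    · obtain ⟨v, hv, hz'⟩ := exists_fundamentalDomain (b := b) z
      rw [← a.periodic z v hv]
      exact (hB (z.1 + v, z.2) ⟨subset_closure hz', by simpa using hz⟩).trans (le_max_left _ _)
  induction M generalizing a with
  | zero => exact h0 a ha
  | succ M ih =>
    obtain ⟨B, hB⟩ := ih a ha
    have h1 : ∀ i, ∃ B', (a.pd i).Bd M B' := fun i => ih _ fun z hz => by
      have : a.toFun =ᶠ[𝓝 z] fun _ => 0 := by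
        filter_upwards [(isOpen_lt continuous_const (continuous_snd.norm)).mem_nhds hz] with w hw
        exact ha w hw
      rw [pd_apply, this.fderiv_eq]
      simp
    choose B' hB' using h1
    have hB'0 : ∀ i, 0 ≤ B' i := fun i => (hB' i).nonneg
    refine ⟨B + ∑ i, B' i, hB.mono (le_add_of_nonneg_right (Finset.sum_nonneg fun i _ => hB'0 i)),
      fun i => (hB' i).mono ?_⟩
    exact (Finset.single_le_sum (fun i _ => hB'0 i) (Finset.mem_univ i)).trans
      (le_add_of_nonneg_left hB.nonneg)

/-- The product of a function on a tube with a cut-off function of the vertical variable. -/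
def cutoff {R : ℝ} (χ : ContDiffBump (0 : Rn n)) (hχ : χ.rOut < R) (w : Tan n → ℝ)
    (hw : ContDiffOn ℝ ∞ w (coverTube n R))
    (hper : ∀ z : Tan n, ∀ v ∈ Submodule.span ℤ (Set.range b), w (z.1 + v, z.2) = w z) : Coef b where
  toFun z := χ z.2 * w z
  smooth := contDiff_iff_contDiffAt.2 fun z => by
    by_cases hz : ‖z.2‖ < R
    · exact (χ.contDiff.comp contDiff_snd).contDiffAt.mul
        (hw.contDiffAt ((isOpen_coverTube n R).mem_nhds hz))
    · refine ContDiffAt.congr_of_eventuallyEq (f := fun _ => (0 : ℝ)) contDiffAt_const ?_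
      filter_upwards [(isOpen_lt continuous_const (continuous_snd.norm)).mem_nhds
        (show χ.rOut < ‖z.2‖ from hχ.trans_le (not_lt.1 hz))] with u hu
      rw [χ.zero_of_le_dist (by simpa using le_of_lt hu), zero_mul]
  periodic z v hv := by rw [hper z v hv]

theorem cutoff_eq_zero {R : ℝ} (χ : ContDiffBump (0 : Rn n)) (hχ : χ.rOut < R) (w : Tan n → ℝ)
    (hw : ContDiffOn ℝ ∞ w (coverTube n R))
    (hper : ∀ z : Tan n, ∀ v ∈ Submodule.span ℤ (Set.range b), w (z.1 + v, z.2) = w z) (z : Tan n)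
    (hz : χ.rOut < ‖z.2‖) : cutoff (b := b) χ hχ w hw hper z = 0 := by
  change χ z.2 * w z = 0
  rw [χ.zero_of_le_dist (by simpa using hz.le), zero_mul]

theorem exists_bound_bump (χ : ContDiffBump (0 : Rn n)) (m : ℕ) :
    ∃ C, 0 ≤ C ∧ ∀ z : Tan n, ‖iteratedFDeriv ℝ m (fun z : Tan n => χ z.2) z‖ ≤ C := by
  have h1 : Continuous (iteratedFDeriv ℝ m χ) :=
    χ.contDiff.continuous_iteratedFDeriv (n := ∞) (by exact_mod_cast le_top)
  have h2 : HasCompactSupport (iteratedFDeriv ℝ m χ) := χ.hasCompactSupport.iteratedFDeriv m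
  obtain ⟨C, hC⟩ := h1.bounded_above_of_compact_support h2
  refine ⟨C, (norm_nonneg _).trans (hC 0), fun z => ?_⟩
  have h3 : (fun z : Tan n => χ z.2) = χ ∘ ContinuousLinearMap.snd ℝ (Rn n) (Rn n) := rfl
  rw [h3, ContinuousLinearMap.iteratedFDeriv_comp_right _ χ.contDiff z (i := m) (n := ∞)
    (by exact_mod_cast le_top)]
  refine (ContinuousMultilinearMap.norm_compContinuousLinearMap_le _ _).trans ?_
  refine (mul_le_of_le_one_right (norm_nonneg _) (Finset.prod_le_one (fun _ _ => norm_nonneg _)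
    fun _ _ => ContinuousLinearMap.norm_snd_le _ _ _)).trans (hC _)

/-- If the derivatives of `w` are small on compact sets, those of its cut-off are small. -/
theorem exists_cutoff_bd (b : Module.Basis (Fin n) ℝ (Rn n)) {R : ℝ} (χ : ContDiffBump (0 : Rn n))
    (hχ : χ.rOut < R) (M : ℕ) {B : ℝ} (hB : 0 < B) :
    ∃ η > 0, ∀ (w : Tan n → ℝ) (hw : ContDiffOn ℝ ∞ w (coverTube n R))
      (hper : ∀ z : Tan n, ∀ v ∈ Submodule.span ℤ (Set.range b), w (z.1 + v, z.2) = w z),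
      (∀ m ≤ M, ∀ z ∈ closure (ZSpan.fundamentalDomain b) ×ˢ Metric.closedBall (0 : Rn n) χ.rOut,
        ‖iteratedFDeriv ℝ m w z‖ ≤ η) → (cutoff χ hχ w hw hper).Bd M B := by
  choose C hC0 hC using exists_bound_bump χ
  set T : ℝ := ∑ m ∈ Finset.range (M + 1), ∑ i ∈ Finset.range (m + 1), (m.choose i : ℝ) * C i
  have hT : 0 ≤ T := Finset.sum_nonneg fun m _ => Finset.sum_nonneg fun i _ =>
    mul_nonneg (Nat.cast_nonneg _) (hC0 i)
  refine ⟨B / (T + 1), by positivity, fun w hw hper h => bd_of_norm_iteratedFDeriv_le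
    fun m hm z hz => ?_⟩
  by_cases hzR : ‖z.2‖ ≤ χ.rOut
  · have hz' : z ∈ coverTube n R := hzR.trans_lt hχ
    have hopen := isOpen_coverTube n R
    have h1 := norm_iteratedFDerivWithin_mul_le (s := coverTube n R) (N := ∞) (f := fun z : Tan n => χ z.2)
      (g := w) ((χ.contDiff.comp contDiff_snd).contDiffOn) hw hopen.uniqueDiffOn hz' (n := m)
      (by exact_mod_cast le_top)
    simp only [iteratedFDerivWithin_of_isOpen _ hopen hz'] at h1
    refine h1.trans ?_
    have h2 : ∀ i ∈ Finset.range (m + 1), (m.choose i : ℝ) * ‖iteratedFDeriv ℝ i (fun z : Tan n => χ z.2) z‖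
        * ‖iteratedFDeriv ℝ (m - i) w z‖ ≤ (m.choose i : ℝ) * C i * (B / (T + 1)) := fun i _ => by
      have a1 := hC i z
      have a2 := h (m - i) ((Nat.sub_le _ _).trans hm) z ⟨subset_closure hz, by simpa using hzR⟩
      have a3 := hC0 i
      gcongr
    refine (Finset.sum_le_sum h2).trans ?_
    rw [← Finset.sum_mul]
    have h3 : ∑ i ∈ Finset.range (m + 1), (m.choose i : ℝ) * C i ≤ T :=
      Finset.single_le_sum (f := fun m => ∑ i ∈ Finset.range (m + 1), (m.choose i : ℝ) * C i)
        (fun m _ => Finset.sum_nonneg fun i _ => mul_nonneg (Nat.cast_nonneg _) (hC0 i))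
        (Finset.mem_range.2 (by omega))
    calc _ ≤ (T + 1) * (B / (T + 1)) := by gcongr; linarith
      _ = B := by field_simp
  · have h0 : (cutoff (b := b) χ hχ w hw hper).toFun =ᶠ[𝓝 z] fun _ => 0 := by
      filter_upwards [(isOpen_lt continuous_const (continuous_snd.norm)).mem_nhds
        (show χ.rOut < ‖z.2‖ from not_le.1 hzR)] with u hu
      exact cutoff_eq_zero χ hχ w hw hper u hu
    rw [(h0.iteratedFDeriv ℝ m).self_of_nhds]
    rcases m with _ | m
    · simpa using hB.le
    · rw [iteratedFDeriv_succ_const]; simpa using hB.le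

end Coef

/-- If the fields `F k` converge smoothly to the constant field `G` and the linear forms `L k` converge
to `L'`, then `L k ∘ F k` converges smoothly to the constant `L' G`, uniformly on compact sets. -/
theorem eventually_norm_iteratedFDeriv_le {X : Type*} [NormedAddCommGroup X] [NormedSpace ℝ X]
    {F : ℕ → Torus b × Rn n → X} {G : X} {R : ℝ} (hF : ∀ k, SmoothOn (F k) R)
    (hlim : SmoothLimitOn F (fun _ => G) R) {L : ℕ → X →L[ℝ] ℝ} {L' : X →L[ℝ] ℝ}
    (hL : Tendsto L atTop (𝓝 L')) {K : Set (Tan n)} (hK : IsCompact K) (hKR : K ⊆ coverTube n R)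
    (m : ℕ) {η : ℝ} (hη : 0 < η) :
    ∀ᶠ k in atTop, ∀ z ∈ K,
      ‖iteratedFDeriv ℝ m (fun z => L k (pull (F k) z) - L' G) z‖ ≤ η := by
  have h1 := Metric.tendstoUniformlyOn_iff.1 (hlim m K hK hKR) (η / 2 / (‖L'‖ + 1)) (by positivity)
  have h2 : ∀ᶠ k in atTop, ‖L k - L'‖ < min 1 (η / 2 / (‖G‖ + 1)) :=
    (tendsto_iff_norm_sub_tendsto_zero.1 hL).eventually_lt_const (by positivity)
  filter_upwards [h1, h2] with k h1 h2 z hz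
  have hkn : ‖L k‖ ≤ ‖L'‖ + 1 := by
    have := norm_le_norm_add_norm_sub' (L k) L'
    have h3 := h2.le.trans (min_le_left _ _)
    linarith
  have hat : ContDiffAt ℝ ∞ (pull (F k)) z :=
    (hF k).contDiffAt ((isOpen_coverTube n R).mem_nhds (hKR hz))
  have hG : pull (b := b) (fun _ => G) = fun _ : Tan n => G := rfl
  have e : (fun z => L k (pull (F k) z) - L' G)
      = fun z => (L k ∘ fun z => pull (F k) z - G) z + (L k - L') G := by
    funext z; simp
  have hat2 : ContDiffAt ℝ ∞ (fun z => pull (F k) z - G) z := hat.sub contDiffAt_const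
  have b1 : ‖iteratedFDeriv ℝ m (L k ∘ fun z => pull (F k) z - G) z‖ ≤ η / 2 := by
    refine (ContinuousLinearMap.norm_iteratedFDeriv_comp_left _ hat2
      (by exact_mod_cast le_top)).trans ?_
    have h3 := h1 z hz
    rw [dist_eq_norm, hG, ← norm_neg, neg_sub] at h3
    have h4 : iteratedFDeriv ℝ m (fun z => pull (F k) z - G) z
        = iteratedFDeriv ℝ m (pull (F k)) z - iteratedFDeriv ℝ m (fun _ => G) z :=
      fun_iteratedFDeriv_sub_apply (hat.of_le (by exact_mod_cast le_top)) contDiffAt_const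
    rw [h4]
    calc _ ≤ (‖L'‖ + 1) * (η / 2 / (‖L'‖ + 1)) := by gcongr
      _ = η / 2 := by field_simp
  have b2 : ‖iteratedFDeriv ℝ m (fun _ : Tan n => (L k - L') G) z‖ ≤ η / 2 := by
    have h3 : ‖(L k - L') G‖ ≤ η / 2 := by
      refine ((L k - L').le_opNorm G).trans ?_
      have h4 := h2.le.trans (min_le_right _ _)
      calc _ ≤ η / 2 / (‖G‖ + 1) * (‖G‖ + 1) := by gcongr; linarith
        _ = η / 2 := by field_simp
    rcases m with _ | m
    · simpa using h3
    · rw [iteratedFDeriv_succ_const]; simpa using (half_pos hη).le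
  rw [e, fun_iteratedFDeriv_add_apply (f := L k ∘ fun z => pull (F k) z - G)
    (((L k).contDiff.contDiffAt.comp z hat2).of_le (by exact_mod_cast le_top)) contDiffAt_const]
  exact (norm_add_le _ _).trans (by linarith)

namespace PerSm

open MeasureTheory

/-- The perturbation defined by `(ω, Ω)`, cut off in the vertical direction. -/
def pert {R : ℝ} (χ : ContDiffBump (0 : Rn n)) (hχ : χ.rOut < R) (S : Quad b)
    (h₁ : SmoothOn S.kahler R) (h₂ : SmoothOn S.Ω R) (θ : ℝ) : Pert b where
  two J := Coef.cutoff χ hχ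
    (fun z => ContinuousAlternatingMap.apply ℝ (Tan n) ℝ (fun k => frame n (J k)) (pull S.kahler z)
      - ContinuousAlternatingMap.apply ℝ (Tan n) ℝ (fun k => frame n (J k)) (stdKahler n))
    (((ContinuousLinearMap.contDiff _).comp_contDiffOn h₁).sub contDiffOn_const)
    fun z v hv => by rw [pull_periodic _ z hv]
  top J := Coef.cutoff χ hχ
    (fun z => ((imRot θ).comp (ContinuousAlternatingMap.apply ℝ (Tan n) ℂ fun k => frame n (J k)))
        (pull S.Ω z)
      - ((imRot 0).comp (ContinuousAlternatingMap.apply ℝ (Tan n) ℂ fun k => frame n (J k))) (stdΩ n))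
    (((ContinuousLinearMap.contDiff _).comp_contDiffOn h₂).sub contDiffOn_const)
    fun z v hv => by rw [pull_periodic _ z hv]

section Pert

variable {R : ℝ} {χ : ContDiffBump (0 : Rn n)} {hχ : χ.rOut < R}

theorem pert_represents {S : Quad b} {h₁ : SmoothOn S.kahler R} {h₂ : SmoothOn S.Ω R} {θ : ℝ} :
    (pert χ hχ S h₁ h₂ θ).Represents S θ χ.rIn := by
  constructor
  · intro z hz J
    change χ z.2 * _ = _
    rw [χ.one_of_mem_closedBall (by simpa using hz), one_mul]
    rfl
  · intro z hz J
    change χ z.2 * _ = _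
    rw [χ.one_of_mem_closedBall (by simpa using hz), one_mul]
    simp [imRot_apply, kap]

theorem pert_exists_bd {S : Quad b} {h₁ : SmoothOn S.kahler R} {h₂ : SmoothOn S.Ω R} {θ : ℝ} (M : ℕ) :
    ∃ B, (pert χ hχ S h₁ h₂ θ).Bd M B := by
  choose B₁ hB₁ using fun J => Coef.exists_bd (ρ := χ.rOut) M
    ((pert χ hχ S h₁ h₂ θ).two J) fun z hz => by
      rw [show (pert χ hχ S h₁ h₂ θ).two J z = χ z.2 * _ from rfl,
        χ.zero_of_le_dist (by simpa using hz.le), zero_mul]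
  choose B₂ hB₂ using fun J => Coef.exists_bd (ρ := χ.rOut) M
    ((pert χ hχ S h₁ h₂ θ).top J) fun z hz => by
      rw [show (pert χ hχ S h₁ h₂ θ).top J z = χ z.2 * _ from rfl,
        χ.zero_of_le_dist (by simpa using hz.le), zero_mul]
  have p₁ := fun J => (hB₁ J).nonneg
  have p₂ := fun J => (hB₂ J).nonneg
  refine ⟨∑ J, B₁ J + ∑ J, B₂ J, fun J => (hB₁ J).mono ?_, fun J => (hB₂ J).mono ?_⟩
  · exact (Finset.single_le_sum (fun J _ => p₁ J) (Finset.mem_univ J)).trans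
      (le_add_of_nonneg_right (Finset.sum_nonneg fun J _ => p₂ J))
  · exact (Finset.single_le_sum (fun J _ => p₂ J) (Finset.mem_univ J)).trans
      (le_add_of_nonneg_left (Finset.sum_nonneg fun J _ => p₁ J))

theorem continuous_imRot : Continuous imRot :=
  continuous_const.clm_comp ((ContinuousLinearMap.mul ℝ ℂ).continuous.comp (by fun_prop))

/-- The cut-off perturbations defined by a sequence of structures that converges to the flat one tend to
zero with all their derivatives, uniformly on `Tⁿ × ℝⁿ`. -/
theorem eventually_pert_bd {S : ℕ → Quad b} {h₁ : ∀ k, SmoothOn (S k).kahler R}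
    {h₂ : ∀ k, SmoothOn (S k).Ω R} {θ : ℕ → ℝ} (hθ : Tendsto θ atTop (𝓝 0))
    (l₁ : SmoothLimitOn (fun k => (S k).kahler) (flat b).kahler R)
    (l₂ : SmoothLimitOn (fun k => (S k).Ω) (flat b).Ω R) (M : ℕ) {B : ℝ} (hB : 0 < B) :
    ∀ᶠ k in atTop, (pert χ hχ (S k) (h₁ k) (h₂ k) (θ k)).Bd M B := by
  obtain ⟨η, hη, h⟩ := Coef.exists_cutoff_bd b χ hχ M hB
  have hK : IsCompact (closure (ZSpan.fundamentalDomain b) ×ˢ Metric.closedBall (0 : Rn n) χ.rOut) :=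
    (ZSpan.fundamentalDomain_isBounded b).isCompact_closure.prod (isCompact_closedBall _ _)
  have hKR : closure (ZSpan.fundamentalDomain b) ×ˢ Metric.closedBall (0 : Rn n) χ.rOut
      ⊆ coverTube n R := fun z hz => (by simpa using hz.2 : ‖z.2‖ ≤ χ.rOut).trans_lt hχ
  have e₁ : ∀ᶠ k in atTop, ∀ J, ((pert χ hχ (S k) (h₁ k) (h₂ k) (θ k)).two J).Bd M B := by
    refine Filter.eventually_all.2 fun J => ?_
    have := (Set.finite_Iic M).eventually_all.2 fun m _ =>
      eventually_norm_iteratedFDeriv_le h₁ l₁ (tendsto_const_nhds (x :=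
        ContinuousAlternatingMap.apply ℝ (Tan n) ℝ (fun k => frame n (J k)))) hK hKR m hη
    filter_upwards [this] with k hk
    exact h _ (((ContinuousLinearMap.contDiff _).comp_contDiffOn (h₁ k)).sub contDiffOn_const)
      (fun z v hv => by simp only [Function.comp_apply, pull_periodic _ z hv]) hk
  have e₂ : ∀ᶠ k in atTop, ∀ J, ((pert χ hχ (S k) (h₁ k) (h₂ k) (θ k)).top J).Bd M B := by
    refine Filter.eventually_all.2 fun J => ?_
    have hL : Tendsto (fun k => (imRot (θ k)).comp
        (ContinuousAlternatingMap.apply ℝ (Tan n) ℂ fun k => frame n (J k))) atTop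
        (𝓝 ((imRot 0).comp (ContinuousAlternatingMap.apply ℝ (Tan n) ℂ fun k => frame n (J k)))) :=
      ((continuous_imRot.clm_comp continuous_const).tendsto 0).comp hθ
    have := (Set.finite_Iic M).eventually_all.2 fun m _ =>
      eventually_norm_iteratedFDeriv_le h₂ l₂ hL hK hKR m hη
    filter_upwards [this] with k hk
    exact h _ (((ContinuousLinearMap.contDiff _).comp_contDiffOn (h₂ k)).sub contDiffOn_const)
      (fun z v hv => by simp only [Function.comp_apply, pull_periodic _ z hv]) hk
  exact e₁.and e₂

end Pert

/-! ### Periods -/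

theorem flat_period : (flat b).period = torusVol b := by
  have h : ∀ x : Rn n, pull (flat b).Ω (x, 0)
      (fun i => ((EuclideanSpace.single i (1 : ℝ) : Rn n), (0 : Rn n))) = 1 := fun x => by
    change Matrix.det (Matrix.of fun i j : Fin n => dz j
      ((EuclideanSpace.single i (1 : ℝ) : Rn n), (0 : Rn n))) = 1
    have : (Matrix.of fun i j : Fin n => dz j
      ((EuclideanSpace.single i (1 : ℝ) : Rn n), (0 : Rn n))) = 1 := by
      ext i j
      by_cases h : i = j <;> simp [dz, Matrix.one_apply, h, eq_comm (a := j)]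
    rw [this, Matrix.det_one]
  simp only [Quad.period, h]
  simp [torusVol]

theorem tendsto_period {S : ℕ → Quad b} {R : ℝ} (hR : 0 < R) (h : ∀ k, SmoothOn (S k).Ω R)
    (hlim : SmoothLimitOn (fun k => (S k).Ω) (flat b).Ω R) :
    Tendsto (fun k => (S k).period) atTop (𝓝 (flat b).period) := by
  have hflat : SmoothOn (flat b).Ω R := contDiffOn_const
  set e : Fin n → Tan n := fun i => ((EuclideanSpace.single i (1 : ℝ) : Rn n), (0 : Rn n))
  have hK : IsCompact (closure (ZSpan.fundamentalDomain b) ×ˢ ({0} : Set (Rn n))) :=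
    (ZSpan.fundamentalDomain_isBounded b).isCompact_closure.prod isCompact_singleton
  have hKR : closure (ZSpan.fundamentalDomain b) ×ˢ ({0} : Set (Rn n)) ⊆ coverTube n R := fun z hz => by
    have : z.2 = 0 := hz.2
    simpa [coverTube, this] using hR
  rw [Metric.tendsto_atTop']
  intro ε hε
  set E := ContinuousAlternatingMap.apply ℝ (Tan n) ℂ e
  have hV := torusVol_pos (b := b)
  obtain ⟨N, hN⟩ := eventually_atTop.1 (Metric.tendstoUniformlyOn_iff.1 (hlim 0 _ hK hKR)
    (ε / 2 / ((‖E‖ + 1) * torusVol b)) (by positivity))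
  refine ⟨N, fun k hk => ?_⟩
  rw [dist_eq_norm]
  have h1 : (S k).period - (flat b).period
      = ∫ x in ZSpan.fundamentalDomain b, E (pull (S k).Ω (x, 0) - pull (flat b).Ω (x, 0)) := by
    simp only [map_sub]
    exact (integral_sub (integrableOn_period hR (h k)) (integrableOn_period hR hflat)).symm
  have h2 : ∀ x ∈ ZSpan.fundamentalDomain b, ‖E (pull (S k).Ω (x, 0) - pull (flat b).Ω (x, 0))‖
      ≤ (‖E‖ + 1) * (ε / 2 / ((‖E‖ + 1) * torusVol b)) := fun x hx => by
    refine (E.le_opNorm _).trans ?_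
    have h3 := hN k hk.le (x, 0) ⟨subset_closure hx, rfl⟩
    rw [dist_eq_norm, ← norm_neg, neg_sub] at h3
    have h4 : ‖pull (S k).Ω (x, 0) - pull (flat b).Ω (x, 0)‖
        ≤ ε / 2 / ((‖E‖ + 1) * torusVol b) := by
      rw [iteratedFDeriv_zero_eq_comp, iteratedFDeriv_zero_eq_comp, Function.comp_apply,
        Function.comp_apply, ← map_sub, LinearIsometryEquiv.norm_map] at h3
      exact h3.le
    gcongr
    linarith
  rw [h1]
  refine (norm_setIntegral_le_of_norm_le_const volume_fundamentalDomain_lt_top h2).trans_lt ?_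
  change _ * torusVol b < ε
  have : (‖E‖ + 1) * (ε / 2 / ((‖E‖ + 1) * torusVol b)) * torusVol b = ε / 2 := by
    have : ‖E‖ + 1 ≠ 0 := by positivity
    field_simp
  rw [this]
  linarith

/-- The phase `θ k` is minus the argument of the quotient of the period of `S k` by the flat period,
which is real and positive; `a k` is the modulus of the quotient. -/
theorem exists_phase {S : ℕ → Quad b} {R : ℝ} (hR : 0 < R) (h : ∀ k, SmoothOn (S k).Ω R)
    (hlim : SmoothLimitOn (fun k => (S k).Ω) (flat b).Ω R) :
    ∃ a θ : ℕ → ℝ, Tendsto a atTop (𝓝 1) ∧ Tendsto θ atTop (𝓝 0) ∧ ∀ k,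
      (S k).period = a k * Complex.exp (-(Complex.I * θ k)) * (flat b).period ∧
      (Complex.exp (Complex.I * θ k) * (S k).period).im = 0 := by
  have hV := torusVol_pos (b := b)
  have hV' : (torusVol b : ℂ) ≠ 0 := by exact_mod_cast hV.ne'
  set q : ℕ → ℂ := fun k => (S k).period / torusVol b with hq
  have hq1 : Tendsto q atTop (𝓝 1) := by
    have := (tendsto_period hR h hlim).div_const (torusVol b : ℂ)
    rwa [flat_period, div_self hV'] at this
  have key : ∀ k, (S k).period
      = ‖q k‖ * Complex.exp (-(Complex.I * ((-(q k).arg : ℝ) : ℂ))) * (flat b).period := fun k => by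
    have h1 := Complex.norm_mul_exp_arg_mul_I (q k)
    have h2 : -(Complex.I * ((-(q k).arg : ℝ) : ℂ)) = (q k).arg * Complex.I := by push_cast; ring
    rw [h2, h1, flat_period, hq, div_mul_cancel₀ _ hV']
  refine ⟨fun k => ‖q k‖, fun k => -(q k).arg, by simpa using hq1.norm, ?_, fun k => ⟨key k, ?_⟩⟩
  · have := ((Complex.continuousAt_arg (x := 1) (by simp)).tendsto.comp hq1).neg
    simpa using this
  · rw [key k, flat_period]
    have e : Complex.exp (Complex.I * ((-(q k).arg : ℝ) : ℂ))
        * (‖q k‖ * Complex.exp (-(Complex.I * ((-(q k).arg : ℝ) : ℂ))) * torusVol b)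
        = ((‖q k‖ * torusVol b : ℝ) : ℂ) := by
      rw [Complex.exp_neg]
      have := Complex.exp_ne_zero (Complex.I * ((-(q k).arg : ℝ) : ℂ))
      push_cast at this ⊢
      field_simp
    rw [e, Complex.ofReal_im]

end PerSm

/-! ### Symmetries of the flat structure -/

section Lift

variable {R : ℝ} {Γ : Type*} [Group Γ] [MulAction Γ (Torus b)] [MulAction Γ (Ball n R)]

theorem stdKahler_horizontal_vertical (u v : Rn n) :
    stdKahler n ![((u, 0) : Tan n), (0, v)] = inner ℝ u v := by
  change ∑ j : Fin n, _ = _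
  simp [PiLp.inner_apply, mul_comm]

/-- A product transformation that preserves `ω` and `g` is affine: preserving `g` makes the
differentials isometries, and preserving `ω` makes the differential in the `y` direction the inverse
transpose of that in the `x` direction, so that both are constant. -/
theorem exists_affine_lift (hR : 0 < R) (hΓ : IsSmoothAction b R Γ) (hinv : (flat b).IsPreservedBy R Γ)
    {γ : Γ} {φ ψ : Rn n → Rn n} (h : IsLift (b := b) (R := R) γ φ ψ) :
    ∃ (P : Rn n ≃ₗᵢ[ℝ] Rn n) (t : Rn n), (∀ x, φ x = P x + t) ∧ ∀ y, ‖y‖ < R → ψ y = P y := by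
  have hk : ∀ x y, ‖y‖ < R → ∀ u v, inner ℝ (fderiv ℝ φ x u) (fderiv ℝ ψ y v) = inner ℝ u v := by
    intro x y hy u v
    have h1 := hinv.kahler_inv γ φ ψ h (x, y) hy
    have h2 := congrArg (fun α => α ![((u, 0) : Tan n), (0, v)]) h1
    have h3 : (pull (flat b).kahler (φ x, ψ y)).compContinuousLinearMap (liftDeriv φ ψ (x, y))
        ![((u, 0) : Tan n), (0, v)]
        = stdKahler n ![((fderiv ℝ φ x u, 0) : Tan n), (0, fderiv ℝ ψ y v)] := by
      refine (ContinuousAlternatingMap.compContinuousLinearMap_apply _ _ _).trans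
        (congrArg (stdKahler n) ?_)
      funext k
      fin_cases k <;> simp [liftDeriv]
    have h4 := h3.symm.trans h2
    rw [stdKahler_horizontal_vertical] at h4
    exact h4.trans (stdKahler_horizontal_vertical u v)
  have hg : ∀ x u v, inner ℝ (fderiv ℝ φ x u) (fderiv ℝ φ x v) = inner ℝ u v := by
    intro x u v
    have h1 := hinv.g_inv γ φ ψ h (x, 0) (by simpa [coverTube] using hR) (u, 0) (v, 0)
    simpa [pull, flat, stdg, liftDeriv] using h1
  have hsurj : ∀ x, Function.Surjective (fderiv ℝ φ x) := fun x => by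
    have hinj : Function.Injective (fderiv ℝ φ x : Rn n →ₗ[ℝ] Rn n) := by
      rw [← LinearMap.ker_eq_bot, LinearMap.ker_eq_bot']
      intro u hu
      have := hg x u u
      rw [show fderiv ℝ φ x u = 0 from hu, inner_zero_left] at this
      exact inner_self_eq_zero.1 this.symm
    exact LinearMap.injective_iff_surjective.1 hinj
  have heq : ∀ x y, ‖y‖ < R → fderiv ℝ ψ y = fderiv ℝ φ x := fun x y hy => by
    ext1 v
    obtain ⟨u, hu⟩ := hsurj x (fderiv ℝ ψ y v - fderiv ℝ φ x v)
    have h1 : inner ℝ (fderiv ℝ φ x u) (fderiv ℝ ψ y v - fderiv ℝ φ x v) = 0 := by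
      rw [inner_sub_right, hk x y hy, hg, sub_self]
    rw [hu] at h1
    exact sub_eq_zero.1 (inner_self_eq_zero.1 h1)
  set L := fderiv ℝ φ 0
  have h0 : ‖(0 : Rn n)‖ < R := by simpa using hR
  have hφ : ∀ x, fderiv ℝ φ x = L := fun x => (heq x 0 h0).symm.trans (heq 0 0 h0)
  let P₀ : Rn n →ₗᵢ[ℝ] Rn n := ⟨L.toLinearMap, fun u => by
    have := hg 0 u u
    rw [real_inner_self_eq_norm_sq, real_inner_self_eq_norm_sq] at this
    exact (pow_left_inj₀ (norm_nonneg _) (norm_nonneg _) two_ne_zero).1 this⟩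
  let P : Rn n ≃ₗᵢ[ℝ] Rn n := P₀.toLinearIsometryEquiv rfl
  have hP : ∀ u, P u = L u := fun u => rfl
  refine ⟨P, φ 0, fun x => ?_, fun y hy => ?_⟩
  · have hd : Differentiable ℝ fun x => φ x - L x :=
      (h.smooth_torus.differentiable (by simp)).sub L.differentiable
    have := is_const_of_fderiv_eq_zero (𝕜 := ℝ) hd (fun x => by
      rw [fderiv_fun_sub (h.smooth_torus.differentiable (by simp) x) L.differentiableAt, hφ,
        ContinuousLinearMap.fderiv, sub_self]) x 0
    rw [map_zero, sub_zero, sub_eq_iff_eq_add'] at this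
    rw [hP, this]
  · have hd : DifferentiableOn ℝ (fun y => ψ y - L y) (Metric.ball 0 R) :=
      (h.smooth_ball.differentiableOn (by simp)).sub L.differentiable.differentiableOn
    have hψ0 : ψ 0 = 0 := by
      have h1 := h.lift_ball ⟨0, by simpa using hR⟩
      rw [h1]
      exact hΓ.zero_invariant γ _ rfl
    have := Metric.isOpen_ball.is_const_of_fderiv_eq_zero (𝕜 := ℝ)
      (convex_ball (0 : Rn n) R).isPreconnected hd (fun z hz => by
        have hz' : ‖z‖ < R := by simpa using hz
        have hat : DifferentiableAt ℝ ψ z := (h.smooth_ball.differentiableOn (by simp)).differentiableAt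
          (Metric.isOpen_ball.mem_nhds hz)
        rw [fderiv_fun_sub hat L.differentiableAt, heq 0 z hz', ContinuousLinearMap.fderiv, sub_self]
        rfl) (by simpa using hy : y ∈ Metric.ball (0 : Rn n) R) (by simpa using hR : (0 : Rn n) ∈ _)
    rw [map_zero, hψ0, sub_zero, sub_eq_zero] at this
    rw [hP, this]

end Lift

/-- An affine isometry `x ↦ P x + t` whose inverse descends to the torus. -/
structure AffSym (b : Module.Basis (Fin n) ℝ (Rn n)) where
  P : Rn n ≃ₗᵢ[ℝ] Rn n
  t : Rn n
  periodic : ∀ x, ∀ v ∈ Submodule.span ℤ (Set.range b),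
    toTorus b (P.symm (x + v - t)) = toTorus b (P.symm (x - t))

namespace PerSm

theorem apply_eq_of_toTorus_eq (f : PerSm b) {x y : Rn n} (h : toTorus b x = toTorus b y) :
    f x = f y := by
  have h1 := (Submodule.Quotient.eq _).1 h
  have h2 := f.periodic y h1
  rwa [add_sub_cancel] at h2

variable (Φ : AffSym b)

/-- Push-forward of functions under the symmetry `x ↦ P x + t` of the torus. -/
def tr (f : PerSm b) : PerSm b :=
  mk (fun x => f (Φ.P.symm (x - Φ.t))) (f.smooth.comp
    (Φ.P.symm.toContinuousLinearEquiv.contDiff.comp (contDiff_id.sub contDiff_const)))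
    fun x v hv => f.apply_eq_of_toTorus_eq (Φ.periodic x v hv)

theorem tr_apply (f : PerSm b) (x : Rn n) : tr Φ f x = f (Φ.P.symm (x - Φ.t)) := rfl

theorem tr_add (f g : PerSm b) : tr Φ (f + g) = tr Φ f + tr Φ g := rfl

theorem D_tr (i : Fin n) (f : PerSm b) :
    D i (tr Φ f) = ∑ l, Φ.P.symm (EuclideanSpace.single i 1) l • tr Φ (D l f) := by
  ext x
  have h1 : HasFDerivAt (fun x => Φ.P.symm (x - Φ.t))
      (Φ.P.symm.toContinuousLinearEquiv : Rn n →L[ℝ] Rn n) x :=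
    Φ.P.symm.toContinuousLinearEquiv.hasFDerivAt.comp x ((hasFDerivAt_id x).sub_const Φ.t)
  have h2 := ((f.differentiable (Φ.P.symm (x - Φ.t))).hasFDerivAt.comp x h1).fderiv
  have h3 : D i (tr Φ f) x = fderiv ℝ f (Φ.P.symm (x - Φ.t)) (Φ.P.symm (EuclideanSpace.single i 1)) :=
    congrArg (fun L => L (EuclideanSpace.single i 1)) h2
  rw [h3, fderiv_eq_sum]
  simp [tr_apply]

/-- Symmetries preserve mean values: a function with mean zero is a divergence, and so is its
push-forward. -/
theorem mean_tr (f : PerSm b) : mean (tr Φ f) = mean f := by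
  have h1 : f = algebraMap ℝ _ (mean f) + ∑ j, D j (green j f) := by rw [sum_D_green]; abel
  have h2 : ∀ g : Fin n → PerSm b, tr Φ (∑ j, D j (g j))
      = ∑ i, D i (∑ j, Φ.P (EuclideanSpace.single j 1) i • tr Φ (g j)) := by
    intro g
    ext x
    simp only [map_sum, map_smul, D_tr, sum_apply, smul_apply, tr_apply]
    have key : ∀ j l : Fin n, ∑ i, Φ.P (EuclideanSpace.single j 1) i
        * Φ.P.symm (EuclideanSpace.single i 1) l = if j = l then 1 else 0 := fun j l => by
      have h3 : ∀ i, Φ.P.symm (EuclideanSpace.single i 1) l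
          = Φ.P (EuclideanSpace.single l 1) i := fun i => by
        have h4 := Φ.P.inner_map_map (Φ.P.symm (EuclideanSpace.single i (1 : ℝ)))
          (EuclideanSpace.single l (1 : ℝ))
        rw [LinearIsometryEquiv.apply_symm_apply, EuclideanSpace.inner_single_left,
          EuclideanSpace.inner_single_right] at h4
        simpa using h4.symm
      have h5 := Φ.P.inner_map_map (EuclideanSpace.single l (1 : ℝ)) (EuclideanSpace.single j (1 : ℝ))
      rw [EuclideanSpace.inner_single_left, PiLp.inner_apply] at h5
      simp only [h3]
      simpa [mul_comm, Pi.single_apply, eq_comm] using h5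
    symm
    calc ∑ i, ∑ j, Φ.P (EuclideanSpace.single j 1) i
          * ∑ l, Φ.P.symm (EuclideanSpace.single i 1) l * D l (g j) (Φ.P.symm (x - Φ.t))
        = ∑ j, ∑ l, (∑ i, Φ.P (EuclideanSpace.single j 1) i
          * Φ.P.symm (EuclideanSpace.single i 1) l) * D l (g j) (Φ.P.symm (x - Φ.t)) := by
          simp only [Finset.mul_sum, Finset.sum_mul, ← mul_assoc]
          rw [Finset.sum_comm]
          exact Finset.sum_congr rfl fun j _ => Finset.sum_comm
      _ = ∑ j, D j (g j) (Φ.P.symm (x - Φ.t)) := by simp [key]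
  have h3 : tr Φ f = algebraMap ℝ _ (mean f)
      + ∑ i, D i (∑ j, Φ.P (EuclideanSpace.single j 1) i • tr Φ (green j f)) := by
    conv_lhs => rw [h1, tr_add, h2]
    rfl
  rw [h3, map_add, mean_algebraMap, map_sum]
  simp [mean_D]

theorem abs_symm_single_le (i l : Fin n) : |Φ.P.symm (EuclideanSpace.single i 1) l| ≤ 1 := by
  refine (PiLp.norm_apply_le (Φ.P.symm (EuclideanSpace.single i (1 : ℝ))) l).trans ?_
  rw [LinearIsometryEquiv.norm_map]
  simp

theorem abs_single_le (i l : Fin n) : |Φ.P (EuclideanSpace.single i 1) l| ≤ 1 := by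
  refine (PiLp.norm_apply_le (Φ.P (EuclideanSpace.single i (1 : ℝ))) l).trans ?_
  rw [LinearIsometryEquiv.norm_map]
  simp

theorem cnorm_tr_le (m : ℕ) (f : PerSm b) : cnorm m (tr Φ f) ≤ (n + 1) ^ m * cnorm m f := by
  induction m generalizing f with
  | zero =>
    rw [pow_zero, one_mul]
    exact supN_le fun x => f.abs_le_supN _
  | succ m ih =>
    have hm := isAlgNorm_cnorm (b := b) m
    rw [cnorm_succ, cnorm_succ]
    have h1 : ∀ i, cnorm m (D i (tr Φ f)) ≤ (n + 1) ^ m * ∑ l, cnorm m (D l f) := fun i => by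
      rw [D_tr, Finset.mul_sum]
      refine (hm.sum_le _ _).trans (Finset.sum_le_sum fun l _ => ?_)
      exact (hm.smul_le _ _).trans ((mul_le_of_le_one_left (hm.nonneg _)
        (abs_symm_single_le Φ i l)).trans (ih _))
    have h2 : ∑ i, cnorm m (D i (tr Φ f)) ≤ n * ((n + 1) ^ m * ∑ l, cnorm m (D l f)) := by
      simpa using Finset.sum_le_card_nsmul Finset.univ _ _ fun i _ => h1 i
    have h3 : 0 ≤ (n + 1 : ℝ) ^ m * ∑ l, cnorm m (D l f) :=
      mul_nonneg (by positivity) (Finset.sum_nonneg fun l _ => hm.nonneg _)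
    have h4 : 0 ≤ n * ((n + 1 : ℝ) ^ m * cnorm m f) :=
      mul_nonneg (by positivity) (mul_nonneg (by positivity) (hm.nonneg _))
    have h5 := ih f
    rw [pow_succ]
    linarith

/-- Push-forward of sections under the symmetry `(x, y) ↦ (P x + t, P y)`. -/
def trSec (s : Fin n → PerSm b) (j : Fin n) : PerSm b :=
  ∑ l, Φ.P (EuclideanSpace.single l 1) j • tr Φ (s l)

theorem toVec_trSec (s : Fin n → PerSm b) (x : Rn n) :
    toVec (trSec Φ s) x = Φ.P (toVec s (Φ.P.symm (x - Φ.t))) := by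
  have h := sum_smul_single fun l => s l (Φ.P.symm (x - Φ.t))
  have h2 : toVec s (Φ.P.symm (x - Φ.t))
    = ∑ l, s l (Φ.P.symm (x - Φ.t)) • EuclideanSpace.single l (1 : ℝ) := h.symm
  rw [h2, map_sum]
  ext j
  simp [trSec, tr_apply, mul_comm]

theorem mean_trSec {s : Fin n → PerSm b} {c : Rn n} (h : ∀ j, mean (s j) = c j) (j : Fin n) :
    mean (trSec Φ s j) = Φ.P c j := by
  have h2 : c = ∑ l, c l • EuclideanSpace.single l (1 : ℝ) := (sum_smul_single fun l => c l).symm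
  conv_rhs => rw [h2, map_sum]
  simp [trSec, mean_tr, h, mul_comm]

/-- Symmetries distort the norms `wienerC q`, but by comparison with the `C^q'` norms, slopes that are
small in a stronger norm of this type stay small. -/
theorem exists_smallD_trSec (b : Module.Basis (Fin n) ℝ (Rn n)) (q : ℕ) :
    ∃ (q' : ℕ) (C : ℝ), 0 ≤ C ∧ ∀ (Φ : AffSym b) (s : Fin n → PerSm b) (δ : ℝ), 0 ≤ δ →
      SmallD (wienerC q') δ s → SmallD (wienerC q) (C * δ) (trSec Φ s) := by
  obtain ⟨q', C, hC, h⟩ := exists_wienerC_le b q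
  refine ⟨q', n * (n * (C * (n + 1) ^ q')), by positivity, fun Φ s δ hδ hs i j => ?_⟩
  have hq := isAlgNorm_wienerC (b := b) q
  have h1 : ∀ l m, wienerC q (tr Φ (D m (s l))) ≤ C * (n + 1) ^ q' * δ := fun l m => by
    refine (h _).trans ?_
    rw [mul_assoc]
    refine mul_le_mul_of_nonneg_left ((cnorm_tr_le Φ q' _).trans ?_) hC
    exact mul_le_mul_of_nonneg_left ((cnorm_le_wienerC q' _).trans (hs m l)) (by positivity)
  rw [trSec, map_sum]
  have h2 : ∀ l ∈ Finset.univ, wienerC q (D i (Φ.P (EuclideanSpace.single l 1) j • tr Φ (s l)))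
      ≤ n * (C * (n + 1) ^ q' * δ) := fun l _ => by
    rw [map_smul, D_tr]
    refine (hq.smul_le _ _).trans ((mul_le_of_le_one_left (hq.nonneg _) (abs_single_le Φ l j)).trans ?_)
    have := hq.sum_le_card Finset.univ
      (fun m => Φ.P.symm (EuclideanSpace.single i 1) m • tr Φ (D m (s l)))
      (C := C * (n + 1) ^ q' * δ) fun m _ =>
      (hq.smul_le _ _).trans ((mul_le_of_le_one_left (hq.nonneg _) (abs_symm_single_le Φ i m)).trans
        (h1 l m))
    simpa using this
  refine (hq.sum_le_card _ _ h2).trans_eq ?_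
  simp
  ring

section Invariance

variable {R : ℝ} {Γ : Type*} [Group Γ] [MulAction Γ (Torus b)] [MulAction Γ (Ball n R)]

/-- The symmetry `Φ` lifts the action of `γ` on `Tⁿ × B(0, R)`. -/
def Lifts (R : ℝ) [MulAction Γ (Ball n R)] (Φ : AffSym b) (γ : Γ) : Prop :=
  IsLift (b := b) (R := R) γ (fun x => Φ.P x + Φ.t) Φ.P

theorem exists_lifts (hR : 0 < R) (hΓ : IsSmoothAction b R Γ) (hinv : (flat b).IsPreservedBy R Γ)
    (γ : Γ) : ∃ Φ : AffSym b, Lifts R Φ γ := by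
  obtain ⟨φ, ψ, h⟩ := hΓ.smooth γ
  obtain ⟨P, t, hφ, hψ⟩ := exists_affine_lift hR hΓ hinv h
  have hc : ∀ z, γ • toTorus b (P.symm (z - t)) = toTorus b z := fun z => by
    rw [← h.lift_torus, hφ]
    simp
  refine ⟨⟨P, t, fun x v hv => MulAction.injective γ ?_⟩, ?_⟩
  · simp only [hc, toTorus_add x hv]
  · refine ⟨P.toContinuousLinearEquiv.contDiff.add contDiff_const, fun x => ?_,
      P.toContinuousLinearEquiv.contDiff.contDiffOn, fun y => ?_⟩
    · rw [← h.lift_torus, hφ]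
    · rw [← h.lift_ball, hψ _ (mem_ball_zero_iff.1 y.2)]

variable {Φ : AffSym b} {γ : Γ} {S : Quad b} {θ : ℝ} {s : Fin n → PerSm b}

theorem liftDeriv_affSym (Φ : AffSym b) (z w : Tan n) :
    liftDeriv (fun x => Φ.P x + Φ.t) Φ.P z w = (Φ.P w.1, Φ.P w.2) := by
  have h1 : HasFDerivAt (fun x => Φ.P x + Φ.t) (Φ.P.toContinuousLinearEquiv : Rn n →L[ℝ] Rn n) z.1 :=
    Φ.P.toContinuousLinearEquiv.hasFDerivAt.add_const _
  have h2 : HasFDerivAt Φ.P (Φ.P.toContinuousLinearEquiv : Rn n →L[ℝ] Rn n) z.2 :=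
    Φ.P.toContinuousLinearEquiv.hasFDerivAt
  rw [liftDeriv, h1.fderiv, h2.fderiv]
  rfl

theorem graph_trSec (Φ : AffSym b) (s : Fin n → PerSm b) (x : Rn n) :
    graph (trSec Φ s) x = ((fun x => Φ.P x + Φ.t) (graph s (Φ.P.symm (x - Φ.t))).1,
      Φ.P (graph s (Φ.P.symm (x - Φ.t))).2) := by
  simp [graph, toVec_trSec]

theorem fderiv_graph_trSec (Φ : AffSym b) (s : Fin n → PerSm b) (x w : Rn n) :
    fderiv ℝ (graph (trSec Φ s)) x w = liftDeriv (fun x => Φ.P x + Φ.t) Φ.P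
      (graph s (Φ.P.symm (x - Φ.t))) (fderiv ℝ (graph s) (Φ.P.symm (x - Φ.t)) (Φ.P.symm w)) := by
  have h1 : HasFDerivAt (fun x => Φ.P.symm (x - Φ.t))
      (Φ.P.symm.toContinuousLinearEquiv : Rn n →L[ℝ] Rn n) x :=
    Φ.P.symm.toContinuousLinearEquiv.hasFDerivAt.comp x ((hasFDerivAt_id x).sub_const Φ.t)
  have h2 := (((contDiff_graph s).differentiable (by simp)) (Φ.P.symm (x - Φ.t))).hasFDerivAt.comp x h1
  have h3 : HasFDerivAt (fun z : Tan n => (Φ.P z.1 + Φ.t, Φ.P z.2))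
      ((Φ.P.toContinuousLinearEquiv : Rn n →L[ℝ] Rn n).prodMap
        (Φ.P.toContinuousLinearEquiv : Rn n →L[ℝ] Rn n)) (graph s (Φ.P.symm (x - Φ.t))) :=
    ((Φ.P.toContinuousLinearEquiv.hasFDerivAt.comp _ hasFDerivAt_fst).add_const _).prodMk
      (Φ.P.toContinuousLinearEquiv.hasFDerivAt.comp _ hasFDerivAt_snd)
  have h4 := h3.comp x h2
  have h5 : graph (trSec Φ s) = (fun z : Tan n => (Φ.P z.1 + Φ.t, Φ.P z.2)) ∘
      (graph s ∘ fun x => Φ.P.symm (x - Φ.t)) := funext fun x => graph_trSec Φ s x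
  rw [liftDeriv_affSym, h5, h4.fderiv]
  rfl

/-- A symmetry that preserves `ω` and `Ω` maps special Lagrangian graphs to special Lagrangian
graphs. -/
theorem IsSL.trSec (h : IsSL S θ s) (hinv : S.IsPreservedBy R Γ) (hΦ : Lifts R Φ γ)
    (hs : ∀ x, ‖toVec s x‖ < R) : IsSL S θ (PerSm.trSec Φ s) := by
  refine ⟨fun x i j => ?_, fun x => ?_⟩
  · simp only [fderiv_graph_trSec, graph_trSec]
    have h1 := congrArg (fun α => α fun k => fderiv ℝ (graph s) (Φ.P.symm (x - Φ.t))
      (Φ.P.symm (EuclideanSpace.single (![i, j] k) 1)))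
      (hinv.kahler_inv γ _ _ hΦ (graph s (Φ.P.symm (x - Φ.t))) (hs _))
    have h2 := congrArg (fun α => α fun k => Φ.P.symm (EuclideanSpace.single (![i, j] k) 1))
      (h.kahler_comp (Φ.P.symm (x - Φ.t)))
    exact h1.trans h2
  · simp only [fderiv_graph_trSec, graph_trSec]
    have h1 := congrArg (fun α => α fun k => fderiv ℝ (graph s) (Φ.P.symm (x - Φ.t))
      (Φ.P.symm (EuclideanSpace.single k 1)))
      (hinv.Ω_inv γ _ _ hΦ (graph s (Φ.P.symm (x - Φ.t))) (hs _))
    have h2 := h.im_apply (Φ.P.symm (x - Φ.t)) fun k => Φ.P.symm (EuclideanSpace.single k 1)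
    exact (congrArg (imRot θ) h1).trans h2

end Invariance

/-! ### Foliations by graphs over the torus -/

/-- A family of maps `Tⁿ → ℝⁿ`, indexed by `c ∈ ℝⁿ`, that is a small perturbation
of the family of constant maps `c`, in a Lipschitz sense. -/
structure IsLeafFamily (sol : Rn n → Fin n → PerSm b) (η : ℝ) : Prop where
  lipschitz : ∀ c c' x,
    ‖(toVec (sol c) x - c) - (toVec (sol c') x - c')‖ ≤ ‖c - c'‖ / 2
  close : ∀ c x, ‖toVec (sol c) x - c‖ ≤ η

theorem IsLeafFamily.norm_sub_le {sol : Rn n → Fin n → PerSm b} {η : ℝ} (h : IsLeafFamily sol η)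
    (c c' x : Rn n) : ‖c - c'‖ ≤ 2 * ‖toVec (sol c) x - toVec (sol c') x‖ := by
  have h1 := h.lipschitz c c' x
  have h2 : c - c' = (toVec (sol c) x - toVec (sol c') x)
    - ((toVec (sol c) x - c) - (toVec (sol c') x - c')) := by abel
  have h3 := _root_.norm_sub_le (toVec (sol c) x - toVec (sol c') x)
    ((toVec (sol c) x - c) - (toVec (sol c') x - c'))
  rw [← h2] at h3
  linarith

/-- The leaf through `(x, y)` is the fixed point of the contraction `c ↦ y - (s_c(x) - c)`. -/
theorem IsLeafFamily.exists_leaf {sol : Rn n → Fin n → PerSm b} {η : ℝ} (h : IsLeafFamily sol η)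
    (x y : Rn n) : ∃ c, toVec (sol c) x = y := by
  have hc : ContractingWith (1 / 2) fun c => y - (toVec (sol c) x - c) := by
    refine ⟨by norm_num, LipschitzWith.of_dist_le_mul fun c c' => ?_⟩
    rw [dist_eq_norm, dist_eq_norm, sub_sub_sub_cancel_left, norm_sub_rev]
    refine (h.lipschitz c c' x).trans_eq ?_
    push_cast
    ring
  refine ⟨hc.fixedPoint _, ?_⟩
  have h1 : y - (toVec (sol (hc.fixedPoint _)) x - hc.fixedPoint _) = hc.fixedPoint _ :=
    hc.fixedPoint_isFixedPt
  rw [sub_sub_eq_add_sub, sub_eq_iff_eq_add, add_comm y] at h1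
  exact (add_left_cancel h1).symm

/-- The index of the leaf through `(x, y)`, for `x` in the universal cover of the torus. -/
def leaf (sol : Rn n → Fin n → PerSm b) (x y : Rn n) : Rn n :=
  Classical.epsilon fun c => toVec (sol c) x = y

theorem IsLeafFamily.leaf_spec {sol : Rn n → Fin n → PerSm b} {η : ℝ} (h : IsLeafFamily sol η)
    (x y : Rn n) : toVec (sol (leaf sol x y)) x = y := Classical.epsilon_spec (h.exists_leaf x y)

theorem IsLeafFamily.leaf_eq_iff {sol : Rn n → Fin n → PerSm b} {η : ℝ} (h : IsLeafFamily sol η)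
    {x y c : Rn n} : leaf sol x y = c ↔ toVec (sol c) x = y := by
  refine ⟨fun e => e ▸ h.leaf_spec x y, fun e => sub_eq_zero.1 (norm_le_zero_iff.1 ?_)⟩
  refine (h.norm_sub_le _ _ x).trans_eq ?_
  rw [h.leaf_spec, e, sub_self, norm_zero, mul_zero]

theorem IsLeafFamily.continuous_leaf {sol : Rn n → Fin n → PerSm b} {η : ℝ} (h : IsLeafFamily sol η) :
    Continuous fun z : Tan n => leaf sol z.1 z.2 := by
  refine continuous_iff_continuousAt.2 fun z₀ => tendsto_iff_norm_sub_tendsto_zero.2 ?_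
  have h1 : Continuous fun z : Tan n => 2 * ‖z.2 - toVec (sol (leaf sol z₀.1 z₀.2)) z.1‖ :=
    continuous_const.mul (continuous_snd.sub
      ((contDiff_toVec _).continuous.comp continuous_fst)).norm
  have h2 := h1.tendsto z₀
  rw [h.leaf_spec, sub_self, norm_zero, mul_zero] at h2
  refine squeeze_zero (fun _ => norm_nonneg _) (fun z => ?_) h2
  have := h.norm_sub_le (leaf sol z.1 z.2) (leaf sol z₀.1 z₀.2) z.1
  rwa [h.leaf_spec] at this

theorem toVec_eq_of_toTorus_eq (s : Fin n → PerSm b) {x y : Rn n} (h : toTorus b x = toTorus b y) :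
    toVec s x = toVec s y := by
  ext j
  exact (s j).apply_eq_of_toTorus_eq h

theorem isOpenQuotientMap_toTorus : IsOpenQuotientMap (toTorus b) :=
  Submodule.isOpenQuotientMap_mkQ _

/-- The map that sends a point of the tube to the index of the leaf through it. As the leaves are graphs
of periodic maps, it does not matter which representative `Quotient.out` selects. -/
def tubeLeaf (sol : Rn n → Fin n → PerSm b) {R : ℝ} (z : Tube b R) : Rn n :=
  leaf sol (Quotient.out z.1) z.2

variable {sol : Rn n → Fin n → PerSm b} {η R : ℝ}

theorem toTorus_out (p : Torus b) : toTorus b (Quotient.out p) = p := Quotient.out_eq p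

theorem IsLeafFamily.tubeLeaf_eq_iff (h : IsLeafFamily sol η) {x : Rn n} {y : Ball n R} {c : Rn n} :
    tubeLeaf sol (toTorus b x, y) = c ↔ toVec (sol c) x = y := by
  rw [tubeLeaf, h.leaf_eq_iff]
  exact Eq.congr_left (toVec_eq_of_toTorus_eq _ (toTorus_out _))

theorem IsLeafFamily.tubeLeaf_spec (h : IsLeafFamily sol η) (x : Rn n) (y : Ball n R) :
    toVec (sol (tubeLeaf sol (toTorus b x, y))) x = y := h.tubeLeaf_eq_iff.1 rfl

theorem IsLeafFamily.norm_tubeLeaf_sub_le (h : IsLeafFamily sol η) (z : Tube b R) :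
    ‖tubeLeaf sol z - z.2‖ ≤ η := by
  obtain ⟨p, y⟩ := z
  rw [← toTorus_out p, norm_sub_rev]
  nth_rw 1 [← h.tubeLeaf_spec (Quotient.out p) y]
  exact h.close _ _

theorem IsLeafFamily.continuous_tubeLeaf (h : IsLeafFamily sol η) :
    Continuous (tubeLeaf sol : Tube b R → Rn n) := by
  rw [← (isOpenQuotientMap_toTorus.prodMap IsOpenQuotientMap.id).continuous_comp_iff]
  have h1 : (tubeLeaf sol : Tube b R → Rn n) ∘ Prod.map (toTorus b) id
      = fun z => leaf sol z.1 z.2 := funext fun z => by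
    refine h.tubeLeaf_eq_iff.2 (h.leaf_spec _ _)
  rw [h1]
  exact h.continuous_leaf.comp (continuous_fst.prodMk (continuous_subtype_val.comp continuous_snd))

/-- A family of special Lagrangian graphs that is close to the family of constant graphs and is
compatible with the group action is the family of fibres of an equivariant special Lagrangian
fibration. -/
theorem IsLeafFamily.exists_isEquivariantFibration (h : IsLeafFamily sol η) {S : Quad b} {θ ρ r : ℝ}
    {Γ : Type*} [Group Γ] [MulAction Γ (Torus b)] [MulAction Γ (Ball n R)] (hrρ : r + η ≤ ρ)
    (hρR : ρ + η ≤ R) (hη : 0 ≤ η) (hR : 0 < R) (hSL : ∀ c, ‖c‖ < ρ → IsSL S θ (sol c))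
    (hΓ : ∀ γ : Γ, ∃ Φ : AffSym b, Lifts R Φ γ ∧ ∀ c, ‖c‖ < ρ → sol (Φ.P c) = trSec Φ (sol c)) :
    ∃ (W : Set (Tube b R)) (B : Set (Ball n R)) (f : Tube b R → Ball n R),
      {z : Tube b R | ‖(z.2 : Rn n)‖ < r} ⊆ W ∧ S.IsEquivariantFibration θ Γ W B f := by
  have hρ' : ∀ c : Rn n, ‖c‖ < ρ → c ∈ Metric.ball (0 : Rn n) R := fun c hc =>
    mem_ball_zero_iff.2 (hc.trans_le (by linarith))
  have hsol : ∀ c, ‖c‖ < ρ → ∀ x, ‖toVec (sol c) x‖ < R := fun c hc x => by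
    have h1 := h.close c x
    have h2 := norm_sub_norm_le (toVec (sol c) x) c
    linarith
  classical
  let f : Tube b R → Ball n R := fun z => if hz : ‖tubeLeaf sol z‖ < ρ then ⟨tubeLeaf sol z, hρ' _ hz⟩
    else ⟨0, Metric.mem_ball_self hR⟩
  have hf : ∀ z, ‖tubeLeaf sol z‖ < ρ → (f z : Rn n) = tubeLeaf sol z := fun z hz => by
    simp [f, hz]
  -- The action permutes the leaves.
  have hact : ∀ γ : Γ, ∃ P : Rn n ≃ₗᵢ[ℝ] Rn n, (∀ y : Ball n R, ((γ • y : Ball n R) : Rn n) = P y) ∧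
      ∀ z : Tube b R, ‖tubeLeaf sol z‖ < ρ → tubeLeaf sol (γ • z) = P (tubeLeaf sol z) := fun γ => by
    obtain ⟨Φ, h1, h2⟩ := hΓ γ
    refine ⟨Φ.P, fun y => (h1.lift_ball y).symm, fun z hz => ?_⟩
    obtain ⟨p, y⟩ := z
    obtain ⟨x, rfl⟩ := isOpenQuotientMap_toTorus.surjective p
    have h3 : γ • ((toTorus b x, y) : Tube b R) = (toTorus b (Φ.P x + Φ.t), γ • y) :=
      Prod.ext (h1.lift_torus x).symm rfl
    rw [h3, h.tubeLeaf_eq_iff, h2 _ hz, toVec_trSec, add_sub_cancel_right,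
      LinearIsometryEquiv.symm_apply_apply, h.tubeLeaf_spec, ← h1.lift_ball]
  refine ⟨{z | ‖tubeLeaf sol z‖ < ρ}, {y | ‖(y : Rn n)‖ < ρ}, f, fun z hz => ?_, ?_, ?_, ?_, ?_, ?_, ?_,
    ?_, ?_⟩
  · have h1 := h.norm_tubeLeaf_sub_le z
    have h2 := norm_sub_norm_le (tubeLeaf sol z) z.2
    have h3 : ‖(z.2 : Rn n)‖ < r := hz
    change ‖tubeLeaf sol z‖ < ρ
    linarith
  · exact isOpen_lt h.continuous_tubeLeaf.norm continuous_const
  · exact isOpen_lt continuous_subtype_val.norm continuous_const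
  · rw [Topology.IsInducing.subtypeVal.continuousOn_iff]
    exact h.continuous_tubeLeaf.continuousOn.congr fun z hz => hf z hz
  · ext y
    constructor
    · rintro ⟨z, hz, rfl⟩
      change ‖(f z : Rn n)‖ < ρ
      rw [hf z hz]
      exact hz
    · intro hy
      have h1 : tubeLeaf sol ((toTorus b 0, ⟨toVec (sol y) 0, mem_ball_zero_iff.2 (hsol y hy 0)⟩) :
          Tube b R) = y := h.tubeLeaf_eq_iff.2 rfl
      have h2 : ‖tubeLeaf sol ((toTorus b 0, ⟨toVec (sol y) 0, mem_ball_zero_iff.2 (hsol y hy 0)⟩) :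
          Tube b R)‖ < ρ := by rw [h1]; exact hy
      exact ⟨_, h2, Subtype.ext ((hf _ h2).trans h1)⟩
  · intro γ z hz
    obtain ⟨P, -, h2⟩ := hact γ
    change ‖tubeLeaf sol (γ • z)‖ < ρ
    rw [h2 z hz, LinearIsometryEquiv.norm_map]
    exact hz
  · intro γ y hy
    obtain ⟨P, h1, -⟩ := hact γ
    change ‖((γ • y : Ball n R) : Rn n)‖ < ρ
    rw [h1, LinearIsometryEquiv.norm_map]
    exact hy
  · intro γ z hz
    obtain ⟨P, h1, h2⟩ := hact γ
    refine Subtype.ext ?_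
    rw [hf, h1, hf z hz, h2 z hz]
    rw [h2 z hz, LinearIsometryEquiv.norm_map]
    exact hz
  · intro y hy
    let s : Torus b → Ball n R := fun p =>
      ⟨toVec (sol y) (Quotient.out p), mem_ball_zero_iff.2 (hsol y hy _)⟩
    have hs : ∀ x, (s (toTorus b x) : Rn n) = toVec (sol y) x := fun x =>
      toVec_eq_of_toTorus_eq _ (toTorus_out _)
    refine ⟨s, ?_, (hSL y hy).isSpecialLagrangianGraph
      (funext fun x => Prod.ext rfl (hs x))⟩
    ext ⟨p, w⟩
    obtain ⟨x, rfl⟩ := isOpenQuotientMap_toTorus.surjective p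
    constructor
    · rintro ⟨hz, hzy⟩
      refine ⟨toTorus b x, Prod.ext rfl (Subtype.ext ?_)⟩
      rw [← hzy] at hs
      exact (hs x).trans (h.tubeLeaf_eq_iff.1 (hf _ hz).symm)
    · rintro ⟨p, hp⟩
      obtain ⟨rfl, rfl⟩ := Prod.mk.inj hp
      have h1 : tubeLeaf sol ((toTorus b x, s (toTorus b x)) : Tube b R) = y :=
        h.tubeLeaf_eq_iff.2 (hs x).symm
      have h2 : ‖tubeLeaf sol ((toTorus b x, s (toTorus b x)) : Tube b R)‖ < ρ := by
        rw [h1]; exact hy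
      exact ⟨h2, Subtype.ext ((hf _ h2).trans h1)⟩

/-- For a small perturbation, the solutions of the special Lagrangian equation form a family of
leaves, which is mapped to itself by the symmetries that preserve the equation. The solutions are
unique among sections with derivatives bounded by some `δ` in some norm `wienerC q`; as symmetries
distort this norm, the solutions are constructed with bounds in a stronger norm. -/
theorem exists_leafFamily (b : Module.Basis (Fin n) ℝ (Rn n)) {η : ℝ} (hη : 0 < η) :
    ∃ (M : ℕ) (B : ℝ), 0 < B ∧ ∀ A : Pert b, A.Bd M B → (∀ M', ∃ B', A.Bd M' B') →
      ∃ sol : Rn n → Fin n → PerSm b, IsLeafFamily sol η ∧ (∀ c, IsSol A c (sol c)) ∧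
        ∀ (Φ : AffSym b) (c c' : Rn n), IsSol A c' (trSec Φ (sol c)) → sol c' = trSec Φ (sol c) := by
  have hP := picardConst_nonneg n
  have hg := gap_pos b
  have hp := one_le_poincare b
  obtain ⟨δ, hδ, hδ1, hδg, hδη⟩ : ∃ δ : ℝ, 0 < δ ∧ δ ≤ 1 ∧ picardConst n * δ ≤ gap b / 2 ∧
      n * (poincare b * δ) ≤ η := by
    refine ⟨min 1 (min (gap b / 2 / (picardConst n + 1)) (η / (n * poincare b + 1))), by positivity,
      min_le_left _ _, ?_, ?_⟩
    · have h1 : gap b / 2 / (picardConst n + 1) * (picardConst n + 1) = gap b / 2 :=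
        div_mul_cancel₀ _ (by positivity)
      have h2 : 0 ≤ gap b / 2 / (picardConst n + 1) := by positivity
      have h3 := mul_le_mul_of_nonneg_left ((min_le_right 1 _).trans (min_le_left
        (gap b / 2 / (picardConst n + 1)) (η / (n * poincare b + 1)))) hP
      linarith
    · have h1 : η / (n * poincare b + 1) * (n * poincare b + 1) = η :=
        div_mul_cancel₀ _ (by positivity)
      have h2 : 0 ≤ η / (n * poincare b + 1) := by positivity
      have h3 := mul_le_mul_of_nonneg_left ((min_le_right 1 _).trans (min_le_right
        (gap b / 2 / (picardConst n + 1)) (η / (n * poincare b + 1))))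
        (by positivity : (0 : ℝ) ≤ n * poincare b)
      linarith
  obtain ⟨q, hq⟩ := exists_unifEst_wienerC b
  obtain ⟨q', C, hC, htr⟩ := exists_smallD_trSec b q
  obtain ⟨M₁, B₁, K₁, hB₁, h₁⟩ := exists_solutions hq hδ hδ1 hδg
  have hδ' : δ / (C + 1) ≤ δ := div_le_self hδ.le (by linarith)
  have hCδ : C * (δ / (C + 1)) ≤ δ := by
    rw [mul_div_assoc', div_le_iff₀ (by positivity)]
    nlinarith
  obtain ⟨M₂, B₂, K₂, hB₂, h₂⟩ := exists_solutions (unifEst_wienerC_mono (le_max_left q q') hq)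
    (by positivity : 0 < δ / (C + 1)) (hδ'.trans hδ1)
    ((mul_le_mul_of_nonneg_left hδ' hP).trans hδg)
  -- Solutions have slopes at most `δ / (C + 1)` in the strong norm, so that their images under
  -- symmetries have slopes at most `δ` in the weak norm, in which uniqueness holds.
  refine ⟨max M₁ M₂, min B₁ B₂, lt_min hB₁ hB₂, fun A hA hA' => ?_⟩
  have hc := (h₁ A (hA.of_le (le_max_left _ _) (min_le_left _ _)) hA').1
  choose sol hsol hsmall using
    (h₂ A (hA.of_le (le_max_right _ _) (min_le_right _ _)) hA').2
  have hs : ∀ c, SmallD (wienerC q) δ (sol c) := fun c i j =>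
    (wienerC_mono (le_max_left q q') _).trans ((hsmall c i j).trans hδ')
  refine ⟨sol, ⟨fun c c' x => hc.lipschitz (hsol c) (hsol c') (hs c) (hs c') x,
    fun c x => ((hsol c).norm_sub_le hc.good hδ.le (hs c) x).trans hδη⟩, hsol, fun Φ c c' h => ?_⟩
  refine hc.unique (hsol c') h (hs c') fun i j => ?_
  exact (htr Φ (sol c) _ (by positivity)
    (fun i j => (wienerC_mono (le_max_right q q') _).trans (hsmall c i j)) i j).trans hCδ

end PerSm

end TorusCY

end

open PerSm

theorem proposition4p1 {n : ℕ} (b : Module.Basis (Fin n) ℝ (Rn n)) (r : ℝ) (hr : 0 < r)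
    (S : ℕ → Quad b)
    (hCY : ∀ k, (S k).IsCalabiYauOn (2 * r))
    (hlim : Quad.SmoothLimit S (flat b) (2 * r))
    (hclass : ∀ k, SameClassOn (S k).kahler (flat b).kahler (2 * r))
    (Γ : Type*) [Group Γ] [Finite Γ] [MulAction Γ (Torus b)] [MulAction Γ (Ball n (2 * r))]
    (hΓ : IsSmoothAction b (2 * r) Γ)
    (hflat_inv : (flat b).IsPreservedBy (2 * r) Γ)
    (hinv : ∀ k, (S k).IsPreservedBy (2 * r) Γ) :
    ∃ (a θ : ℕ → ℝ), Tendsto a atTop (𝓝 1) ∧ Tendsto θ atTop (𝓝 0) ∧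
      ∀ᶠ k in atTop,
        0 < a k ∧
        (S k).period = a k * Complex.exp (-(Complex.I * θ k)) * (flat b).period ∧
        ∃ (W : Set (Tube b (2 * r))) (B : Set (Ball n (2 * r)))
          (f : Tube b (2 * r) → Ball n (2 * r)),
          {z : Tube b (2 * r) | ‖(z.2 : Rn n)‖ < r} ⊆ W ∧
          (S k).IsEquivariantFibration (θ k) Γ W B f := by
  have hR : 0 < 2 * r := by linarith
  have hk := fun k => (hCY k).smooth_kahler
  have hΩ := fun k => (hCY k).smooth_Ω
  obtain ⟨a, θ, ha, hθ, hper⟩ := exists_phase hR hΩ hlim.2.2.2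
  refine ⟨a, θ, ha, hθ, ?_⟩
  -- The leaves with `‖c‖ < 3r/2` stay in `‖y‖ ≤ 7r/4`, where the cut-off function equals one.
  let χ : ContDiffBump (0 : Rn n) := ⟨7 * r / 4, 15 * r / 8, by linarith, by linarith⟩
  have hχ : χ.rOut < 2 * r := by change 15 * r / 8 < 2 * r; linarith
  obtain ⟨M, B, hB, hfam⟩ := exists_leafFamily b (by linarith : 0 < r / 4)
  filter_upwards [ha.eventually_const_lt one_pos,
    eventually_pert_bd (χ := χ) (hχ := hχ) (h₁ := hk) (h₂ := hΩ) hθ hlim.1 hlim.2.2.2 M hB]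
    with k hak hbd
  refine ⟨hak, (hper k).1, ?_⟩
  obtain ⟨sol, hleaf, hsol, hsym⟩ := hfam _ hbd pert_exists_bd
  have hle : ∀ c, ‖c‖ < 3 * r / 2 → ∀ x, ‖toVec (sol c) x‖ ≤ 7 * r / 4 := fun c hc x => by
    have h1 := hleaf.close c x
    have h2 := norm_sub_norm_le (toVec (sol c) x) c
    linarith
  have hSL : ∀ c, ‖c‖ < 3 * r / 2 → IsSL (S k) (θ k) (sol c) := fun c hc =>
    (hsol c).isSL pert_represents (hle c hc) hR (by change 7 * r / 4 < 2 * r; linarith) (hΩ k)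
      (hCY k).Ω_closed (hper k).2 (hclass k)
  refine hleaf.exists_isEquivariantFibration (r := r) (ρ := 3 * r / 2) (by linarith) (by linarith)
    (by linarith) hR hSL fun γ => ?_
  obtain ⟨Φ, hΦ⟩ := exists_lifts hR hΓ hflat_inv γ
  refine ⟨Φ, hΦ, fun c hc => hsym Φ c _ ?_⟩
  refine IsSL.isSol ((hSL c hc).trSec (hinv k) hΦ fun x => (hle c hc x).trans_lt (by linarith))
    pert_represents (fun x => ?_) (mean_trSec Φ (hsol c).mean)
  rw [toVec_trSec, LinearIsometryEquiv.norm_map]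
  exact hle c hc _
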